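/- Let $H$ be a complex Hilbert space (of arbitrary finite or infinite dimension), and let $\mathcal C=\mathcal G(\sigma,d)$ be a unitary conjugacy class $\{UTU^*: U \text{ unitary on } H\}$ of a finite-rank self-adjoint bounded operator $T$ on $H$. Let $\sigma=\{a_1,\dots,a_k\}$ (with $a_1,\dots,a_k$ distinct real numbers) be the common spectrum of the operators in $\mathcal C$, and let $n_i$ be the (possibly infinite) dimension of the eigenspace of any operator of $\mathcal C$ corresponding to $a_i$; write $d=\{n_1,\dots,n_k\}$. Let $\Gamma^c(\sigma,d)$ be the simple graph with vertex set $\mathcal C$ in which $A,B\in\mathcal C$ are connected by an edge if and only if they are commutatively adjacent, i.e. $AB=BA$ and $A-B$ has rank $2$. Let $S(d)$ be the group of all permutations $\delta$ of $\{1,\dots,k\}$ such that $n_{\delta(i)}=n_i$ for all $i$, and for $\delta\in S(d)$ and $A\in\mathcal C$ put $$\delta(A)=\sum_{i=1}^k a_i P_{X_{\delta(i)}},$$ where $X_i$ is the eigenspace of $A$ corresponding to $a_i$ and $P_X$ is the orthogonal projection on $X$. Suppose that $k\ge 2$, that $n_i>1$ for all $i\in\{1,\dots,k\}$, and that there is at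 most one $i$ such that $n_i=2$. Then for every automorphism $f$ of the graph $\Gamma^c(\sigma,d)$ there are a unitary or anti-unitary operator $U$ on $H$ and a permutation $\delta\in S(d)$ such that $$f(A)=U\,\delta(A)\,U^*$$ for all $A\in\mathcal C$. (An anti-unitary operator is an invertible conjugate-linear $U:H\to H$ with $\langle U x,U y\rangle=\overline{\langle x,y\rangle}$ for all $x,y\in H$; for such $U$ one has $U^*=U^{-1}$.) -/

import Mathlib

namespace OrthoGrassmann

variable {H : Type*} [NormedAddCommGroup H] [InnerProductSpace ℂ H] [CompleteSpace H]

/-- The conjugacy class of a bounded operator `T`: all operators `U T U*` with `U` unitary. -/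
def conjClass (T : H →L[ℂ] H) : Set (H →L[ℂ] H) :=
  {A | ∃ U ∈ unitary (H →L[ℂ] H), A = U * T * star U}

/-- The operator `A` has finite rank. -/
def FiniteRank (A : H →L[ℂ] H) : Prop :=
  FiniteDimensional ℂ (LinearMap.range (A : H →ₗ[ℂ] H))

/-- The eigenspace `{x | A x = a x}` of `A` for the real number `a`. -/
def eigSpace (A : H →L[ℂ] H) (a : ℝ) : Submodule ℂ H :=
  Module.End.eigenspace (A : H →ₗ[ℂ] H) (a : ℂ)

/-- Eigenspaces of bounded operators are closed, so that orthogonal projections on them exist. -/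
instance completeSpace_eigSpace (A : H →L[ℂ] H) (a : ℝ) : CompleteSpace (eigSpace A a) := by
  have h : IsClosed (eigSpace A a : Set H) := by
    have : (eigSpace A a : Set H) = {x | A x = (a : ℂ) • x} := by
      ext x
      simp [eigSpace]
    rw [this]
    exact isClosed_eq A.continuous (continuous_const_smul _)
  exact h.completeSpace_coe

/-- The group `S(d)` of all permutations `δ` of the indices with `n (δ i) = n i` for all `i`,
where `n i` is the dimension attached to the index `i`. -/
def multPerm {k : ℕ} (n : Fin k → Cardinal) : Subgroup (Equiv.Perm (Fin k)) where
  carrier := {δ | ∀ i, n (δ i) = n i}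
  one_mem' := fun _ => rfl
  mul_mem' := fun {δ ε} hδ hε i => (hδ (ε i)).trans (hε i)
  inv_mem' := fun {δ} hδ i => by
    have h := hδ (δ⁻¹ i)
    have e : δ (δ⁻¹ i) = i := δ.apply_symm_apply i
    rw [e] at h
    exact h.symm

/-- The operator `δ(A) = ∑ i, a i • P_{X (δ i)}`, where `X i` is the eigenspace of `A`
for the eigenvalue `a i` and `P_X` is the orthogonal projection on `X`. -/
noncomputable def permute {k : ℕ} (a : Fin k → ℝ) (δ : Equiv.Perm (Fin k)) (A : H →L[ℂ] H) :
    H →L[ℂ] H :=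
  ∑ i, (a i : ℂ) • (eigSpace A (a (δ i))).starProjection

/-- `A` and `B` are commutatively adjacent: they commute and `A - B` has rank two. -/
def CommAdj (A B : H →L[ℂ] H) : Prop :=
  A * B = B * A ∧ LinearMap.rank ((A - B : H →L[ℂ] H) : H →ₗ[ℂ] H) = 2

/-- The graph of commutatively adjacent operators in the conjugacy class of `T`. -/
def commGraph (T : H →L[ℂ] H) : SimpleGraph (conjClass T) where
  Adj A B := CommAdj (A : H →L[ℂ] H) (B : H →L[ℂ] H)
  symm := ⟨by
    rintro A B ⟨h1, h2⟩
    refine ⟨h1.symm, ?_⟩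
    have h3 : (((B : H →L[ℂ] H) - A : H →L[ℂ] H) : H →ₗ[ℂ] H)
        = -(((A : H →L[ℂ] H) - B : H →L[ℂ] H) : H →ₗ[ℂ] H) := by
      ext x; simp
    rw [h3, LinearMap.rank, LinearMap.range_neg]
    exact h2⟩
  loopless := ⟨by
    rintro A ⟨-, h⟩
    rw [sub_self] at h
    simp at h⟩

/-- An anti-unitary operator: an invertible conjugate-linear operator `U` such that
`⟪U x, U y⟫` is the complex conjugate of `⟪x, y⟫` for all `x, y`. -/
def IsAntiunitary (U : H ≃ₛₗ[starRingEnd ℂ] H) : Prop :=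
  ∀ x y : H, inner ℂ (U x) (U y) = starRingEnd ℂ (inner ℂ x y)

end OrthoGrassmann

/-!
# Automorphisms of the graph of commutatively adjacent operators

Two operators of the conjugacy class are commutatively adjacent exactly when one arises from the
other by exchanging a line `p` of one eigenspace with a line `q` of another eigenspace
(`CommAdj.exists_swap`, `Swap.commAdj`). The neighbours of `A` are thus unordered pairs `{p, q}` of
eigenlines of `A` for different eigenvalues, and two neighbours are adjacent if and only if their
pairs share a line and the other two lines are orthogonal lines of one eigenspace
(`Swap.exists_common`). An automorphism `f` therefore acts on such pairs, and the aim is to show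
that this action comes from one transformation of the lines of `H`.

*At one vertex.* Two pairs taken from the same two eigenspaces which differ in both lines, by
orthogonal ones, have exactly two common neighbours that are also neighbours of `A`; pairs which
differ in one line only never do (`twoCommon_of_diff`, `not_twoCommon_of_same`). Hence `f` respects
the product structure of the pairs taken from two fixed eigenspaces, as long as orthogonality of
lines in the eigenspaces is a connected relation, which holds in dimension at least three. If one of
the two eigenspaces has dimension two, vertices at distance two from `A` give the missing
information (`IsFiber.partner_eq`); this is where it matters that at most one eigenspace has
dimension two. So `f` acts on the pairs from two eigenspaces through a map of lines
(`exists_pairMap`). For three eigenspaces, counting the common neighbours in the whole graph shows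
that pairs which share a line are sent to pairs which share a line (`share_of_two_common`,
`exists_two_common`), so that these maps agree, and form one map of the eigenlines of `A`
(`exists_lineMap`).

*Globally.* The line maps at adjacent vertices agree on the eigenlines that are not destroyed by the
swap (`LineMap.eq_of_swap`), and any two vertices with a common eigenline are joined by a path of
swaps that keeps this eigenline (`linked_of_eigLine`). Since every pair of orthogonal lines consists
of eigenlines of some vertex, `f` yields a bijection of the projective space of `H` that preserves
orthogonality in both directions (`exists_forall_lineMap`, `perp_iff_of_lineMap`). By Uhlhorn's
theorem (`exists_of_perp_iff`) it is induced by a unitary or anti-unitary operator `U`. The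
permutation of the eigenvalues induced by `f` does not change along swaps
(`exists_eigenvalue_map`), and `U` maps each eigenspace of `A` onto the eigenspace of `f A` for the
permuted eigenvalue.
-/

namespace OrthoGrassmann

set_option linter.unusedSectionVars false

open scoped LinearAlgebra.Projectivization InnerProductSpace

variable {H : Type*} [NormedAddCommGroup H] [InnerProductSpace ℂ H] [CompleteSpace H]

/-! ### Lines, orthogonality and rank-one projections -/

/-- Two lines of `H`, as points of the projective space, are orthogonal. The chosen representatives
decide; by `perp_mk_mk` any others would do. -/
def Perp (p q : ℙ ℂ H) : Prop := ⟪p.rep, q.rep⟫_ℂ = 0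

/-- The orthogonal projection on a line. -/
noncomputable def linePr (p : ℙ ℂ H) : H →L[ℂ] H := p.submodule.starProjection

/-- The line `p` consists of eigenvectors of `A` for the real number `c`. -/
def EigLine (A : H →L[ℂ] H) (p : ℙ ℂ H) (c : ℝ) : Prop := A p.rep = (c : ℂ) • p.rep

theorem exists_rep_mk (x : H) (hx : x ≠ 0) :
    ∃ a : ℂ, a ≠ 0 ∧ (Projectivization.mk ℂ x hx).rep = a • x := by
  obtain ⟨a, ha⟩ := Projectivization.exists_smul_eq_mk_rep ℂ x hx
  exact ⟨a, a.ne_zero, ha.symm⟩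

theorem perp_mk_mk {x y : H} (hx : x ≠ 0) (hy : y ≠ 0) :
    Perp (Projectivization.mk ℂ x hx) (Projectivization.mk ℂ y hy) ↔ ⟪x, y⟫_ℂ = 0 := by
  obtain ⟨a, ha, hax⟩ := exists_rep_mk x hx
  obtain ⟨b, hb, hby⟩ := exists_rep_mk y hy
  simp [Perp, hax, hby, ha, hb]

theorem perp_mk_right {p : ℙ ℂ H} {y : H} (hy : y ≠ 0) :
    Perp p (Projectivization.mk ℂ y hy) ↔ ⟪p.rep, y⟫_ℂ = 0 := by
  obtain ⟨b, hb, hby⟩ := exists_rep_mk y hy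
  simp [Perp, hby, hb]

theorem Perp.symm {p q : ℙ ℂ H} (h : Perp p q) : Perp q p := inner_eq_zero_symm.1 h

theorem Perp.ne {p q : ℙ ℂ H} (h : Perp p q) : p ≠ q := by
  rintro rfl
  exact p.rep_nonzero (inner_self_eq_zero.1 h)

theorem linePr_apply (p : ℙ ℂ H) (v : H) :
    linePr p v = (⟪p.rep, v⟫_ℂ / ((‖p.rep‖ ^ 2 : ℝ) : ℂ)) • p.rep := by
  have h : ∀ (K L : Submodule ℂ H) [K.HasOrthogonalProjection] [L.HasOrthogonalProjection],
      K = L → K.starProjection v = L.starProjection v := by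
    intro K L _ _ e
    subst e
    rfl
  rw [linePr, h p.submodule (ℂ ∙ p.rep) p.submodule_eq]
  exact Submodule.starProjection_singleton ℂ v

theorem linePr_rep (p : ℙ ℂ H) : linePr p p.rep = p.rep := by
  have h : ((‖p.rep‖ : ℂ)) ≠ 0 := by simpa using p.rep_nonzero
  rw [linePr_apply, inner_self_eq_norm_sq_to_K]
  simp [h]

theorem linePr_eq_zero {p : ℙ ℂ H} {v : H} (h : ⟪p.rep, v⟫_ℂ = 0) : linePr p v = 0 := by
  rw [linePr_apply, h]; simp

theorem linePr_perp {p q : ℙ ℂ H} (h : Perp p q) : linePr p q.rep = 0 := linePr_eq_zero h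

theorem linePr_smul_rep (p : ℙ ℂ H) (v : H) : ∃ a : ℂ, linePr p v = a • p.rep :=
  ⟨_, linePr_apply p v⟩

theorem inner_rep_linePr (p : ℙ ℂ H) (v : H) : ⟪p.rep, linePr p v⟫_ℂ = ⟪p.rep, v⟫_ℂ := by
  have h : ((‖p.rep‖ : ℂ)) ≠ 0 := by simpa using p.rep_nonzero
  rw [linePr_apply, inner_smul_right, inner_self_eq_norm_sq_to_K]
  push_cast
  field_simp
  simp

theorem eq_of_smul_rep {p q : ℙ ℂ H} {a : ℂ} (h : p.rep = a • q.rep) : p = q := by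
  rw [← p.mk_rep, ← q.mk_rep, Projectivization.mk_eq_mk_iff']
  exact ⟨a, h.symm⟩

theorem eigLine_mk {A : H →L[ℂ] H} {x : H} (hx : x ≠ 0) {c : ℝ} :
    EigLine A (Projectivization.mk ℂ x hx) c ↔ A x = (c : ℂ) • x := by
  obtain ⟨a, ha, hax⟩ := exists_rep_mk x hx
  rw [EigLine, hax, map_smul, smul_comm]
  exact smul_right_injective H ha |>.eq_iff

theorem mem_eigSpace {A : H →L[ℂ] H} {c : ℝ} {x : H} :
    x ∈ eigSpace A c ↔ A x = (c : ℂ) • x := by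
  simp [eigSpace]

theorem EigLine.unique {A : H →L[ℂ] H} {p : ℙ ℂ H} {c d : ℝ} (h1 : EigLine A p c)
    (h2 : EigLine A p d) : c = d := by
  have h : (c : ℂ) • p.rep = (d : ℂ) • p.rep := h1.symm.trans h2
  exact_mod_cast smul_left_injective ℂ p.rep_nonzero h

theorem inner_eq_zero_of_eigenvalue_ne {A : H →L[ℂ] H} (hA : IsSelfAdjoint A) {c d : ℝ}
    (hcd : c ≠ d) {x y : H} (hx : A x = (c : ℂ) • x) (hy : A y = (d : ℂ) • y) :
    ⟪x, y⟫_ℂ = 0 := by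
  have h : ⟪A x, y⟫_ℂ = ⟪x, A y⟫_ℂ := hA.isSymmetric x y
  rw [hx, hy, inner_smul_left, inner_smul_right, Complex.conj_ofReal] at h
  have h2 : ((c : ℂ) - d) * ⟪x, y⟫_ℂ = 0 := by linear_combination h
  rcases mul_eq_zero.1 h2 with h3 | h3
  · exact absurd (by exact_mod_cast sub_eq_zero.1 h3) hcd
  · exact h3

theorem EigLine.perp {A : H →L[ℂ] H} (hA : IsSelfAdjoint A) {p q : ℙ ℂ H} {c d : ℝ}
    (hcd : c ≠ d) (hp : EigLine A p c) (hq : EigLine A q d) : Perp p q :=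
  inner_eq_zero_of_eigenvalue_ne hA hcd hp hq

/-! ### Spectral decomposition in a conjugacy class -/

/-- The assumptions on `T`, phrased without an enumeration of the eigenvalues: `T` is self-adjoint
of finite rank, has at least two and finitely many eigenvalues, each eigenspace has dimension at
least two, and at most one of them has dimension exactly two. -/
structure Admissible (T : H →L[ℂ] H) : Prop where
  selfAdjoint : IsSelfAdjoint T
  finiteRank : FiniteRank T
  one_lt : ∀ c, eigSpace T c ≠ ⊥ → 1 < Module.rank ℂ (eigSpace T c)
  rank_two_unique : ∀ c d, Module.rank ℂ (eigSpace T c) = 2 → Module.rank ℂ (eigSpace T d) = 2 →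
    c = d
  exists_ne : ∃ c d, c ≠ d ∧ eigSpace T c ≠ ⊥ ∧ eigSpace T d ≠ ⊥
  finite : {c | eigSpace T c ≠ ⊥}.Finite

theorem exists_conj {T A : H →L[ℂ] H} (hA : A ∈ conjClass T) :
    ∃ U : H ≃ₗᵢ[ℂ] H, ∀ x, A (U x) = U (T x) := by
  obtain ⟨U, hU, rfl⟩ := hA
  refine ⟨Unitary.linearIsometryEquiv ⟨U, hU⟩, fun x => ?_⟩
  have h : star U (U x) = x := by
    have := (Unitary.mem_iff.1 hU).1
    calc star U (U x) = (star U * U) x := rfl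
      _ = x := by rw [this]; rfl
  change U (T (star U (U x))) = U (T x)
  rw [h]

theorem mem_conjClass_of_conj {T A : H →L[ℂ] H} (U : H ≃ₗᵢ[ℂ] H)
    (h : ∀ x, A (U x) = U (T x)) : A ∈ conjClass T := by
  let V := (Unitary.linearIsometryEquiv (𝕜 := ℂ) (H := H)).symm U
  have hV : ∀ x, (V : H →L[ℂ] H) x = U x := fun x => rfl
  refine ⟨V, V.2, ?_⟩
  have h1 : A * V = V * T := by
    ext x
    simp only [mul_apply_eq_comp, hV, h]
  rw [← h1, mul_assoc, (Unitary.mem_iff.1 V.2).2, mul_one]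

theorem conjClass_trans {T A B : H →L[ℂ] H} (hA : A ∈ conjClass T) (hB : B ∈ conjClass A) :
    B ∈ conjClass T := by
  obtain ⟨U, hU⟩ := exists_conj hA
  obtain ⟨V, hV⟩ := exists_conj hB
  exact mem_conjClass_of_conj (U.trans V) fun x => by simp [hU, hV]

theorem isSelfAdjoint_of_mem {T A : H →L[ℂ] H} (hT : IsSelfAdjoint T) (hA : A ∈ conjClass T) :
    IsSelfAdjoint A := by
  obtain ⟨U, hU, rfl⟩ := hA
  exact hT.conjugate U

theorem eigSpace_conj {T A : H →L[ℂ] H} {U : H ≃ₗᵢ[ℂ] H} (hU : ∀ x, A (U x) = U (T x)) (c : ℝ) :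
    eigSpace A c = (eigSpace T c).map (U.toLinearEquiv : H →ₗ[ℂ] H) := by
  ext x
  simp only [Submodule.mem_map, mem_eigSpace]
  constructor
  · intro hx
    refine ⟨U.symm x, ?_, by simp⟩
    apply U.injective
    rw [← hU, U.apply_symm_apply, hx, map_smul, U.apply_symm_apply]
  · rintro ⟨y, hy, rfl⟩
    change A (U y) = (c : ℂ) • U y
    rw [hU, hy, map_smul]

theorem rank_eigSpace_of_mem {T A : H →L[ℂ] H} (hA : A ∈ conjClass T) (c : ℝ) :
    Module.rank ℂ (eigSpace A c) = Module.rank ℂ (eigSpace T c) := by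
  obtain ⟨U, hU⟩ := exists_conj hA
  rw [eigSpace_conj hU]
  exact (U.toLinearEquiv.submoduleMap (eigSpace T c)).rank_eq.symm

theorem finiteRank_of_mem {T A : H →L[ℂ] H} (hT : FiniteRank T) (hA : A ∈ conjClass T) :
    FiniteRank A := by
  obtain ⟨U, hU⟩ := exists_conj hA
  have : FiniteDimensional ℂ (LinearMap.range (T : H →ₗ[ℂ] H)) := hT
  have h : LinearMap.range (A : H →ₗ[ℂ] H) ≤
      (LinearMap.range (T : H →ₗ[ℂ] H)).map (U.toLinearEquiv : H →ₗ[ℂ] H) := by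
    rintro _ ⟨x, rfl⟩
    refine ⟨T (U.symm x), ⟨_, rfl⟩, ?_⟩
    change U (T (U.symm x)) = A x
    rw [← hU]; simp
  exact Submodule.finiteDimensional_of_le h

theorem finiteDimensional_eigSpace {A : H →L[ℂ] H} (hA : FiniteRank A) {c : ℝ} (hc : c ≠ 0) :
    FiniteDimensional ℂ (eigSpace A c) := by
  have : FiniteDimensional ℂ (LinearMap.range (A : H →ₗ[ℂ] H)) := hA
  refine Submodule.finiteDimensional_of_le (S₂ := LinearMap.range (A : H →ₗ[ℂ] H)) ?_
  intro x hx
  refine ⟨(c : ℂ)⁻¹ • x, ?_⟩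
  have hc' : (c : ℂ) ≠ 0 := by exact_mod_cast hc
  change A ((c : ℂ)⁻¹ • x) = x
  rw [map_smul, mem_eigSpace.1 hx, smul_smul, inv_mul_cancel₀ hc', one_smul]

/-- A self-adjoint operator of finite rank is diagonalizable: the kernel and the range decompose
the space, and the range is finite-dimensional. -/
theorem iSup_eigSpace {A : H →L[ℂ] H} (hs : IsSelfAdjoint A) (hA : FiniteRank A) :
    ⨆ c : ℝ, eigSpace A c = ⊤ := by
  have hfin : FiniteDimensional ℂ (LinearMap.range (A : H →ₗ[ℂ] H)) := hA
  set R := LinearMap.range (A : H →ₗ[ℂ] H) with hR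
  have hsym := hs.isSymmetric
  have hinv : ∀ v ∈ R, (A : H →ₗ[ℂ] H) v ∈ R := fun v _ => ⟨v, rfl⟩
  have hsR := hsym.restrict_invariant hinv
  have htop := hsR.orthogonalComplement_iSup_eigenspaces_eq_bot
  rw [Submodule.orthogonal_eq_bot_iff] at htop
  have hle : ∀ x ∈ R, x ∈ ⨆ c : ℝ, eigSpace A c := by
    intro x hx
    have h1 : (⟨x, hx⟩ : R) ∈ ⨆ μ, Module.End.eigenspace ((A : H →ₗ[ℂ] H).restrict hinv) μ := by
      rw [htop]; trivial
    have h2 : ∀ y : R, y ∈ (⨆ μ, Module.End.eigenspace ((A : H →ₗ[ℂ] H).restrict hinv) μ) →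
        (y : H) ∈ ⨆ c : ℝ, eigSpace A c := by
      intro y hy
      refine Submodule.iSup_induction _ (motive := fun y : R => (y : H) ∈ ⨆ c : ℝ, eigSpace A c)
        hy ?_ (by simp) ?_
      · intro μ z hz
        by_cases hz0 : z = 0
        · simp [hz0]
        have hev : Module.End.HasEigenvalue ((A : H →ₗ[ℂ] H).restrict hinv) μ :=
          Module.End.hasEigenvalue_of_hasEigenvector ⟨hz, hz0⟩
        have hμ : ((μ.re : ℝ) : ℂ) = μ := Complex.conj_eq_iff_re.1 (hsR.conj_eigenvalue_eq_self hev)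
        refine Submodule.mem_iSup_of_mem μ.re ?_
        rw [mem_eigSpace, hμ]
        have := Module.End.mem_eigenspace_iff.1 hz
        exact congrArg Subtype.val this
      · intro y z hy hz
        simpa using Submodule.add_mem _ hy hz
    exact h2 _ h1
  rw [eq_top_iff]
  intro v _
  have hv : v = R.starProjection v + (v - R.starProjection v) := by abel
  rw [hv]
  refine Submodule.add_mem _ (hle _ (Submodule.starProjection_apply_mem _ _)) ?_
  refine Submodule.mem_iSup_of_mem 0 ?_
  rw [mem_eigSpace]
  set w := v - R.starProjection v with hw
  have h3 : ⟪A w, A w⟫_ℂ = 0 := by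
    have : ⟪A w, A w⟫_ℂ = ⟪w, A (A w)⟫_ℂ := hsym w (A w)
    rw [this]
    exact Submodule.starProjection_inner_eq_zero v (A (A w)) ⟨A w, rfl⟩
  simpa using h3

/-- Every vector is a finite sum of eigenvectors. -/
theorem exists_decomp {A : H →L[ℂ] H} (hs : IsSelfAdjoint A) (hA : FiniteRank A) (v : H) :
    ∃ f : ℝ →₀ H, (∀ c, A (f c) = (c : ℂ) • f c) ∧ f.sum (fun _ x => x) = v := by
  have hv : v ∈ ⨆ c : ℝ, eigSpace A c := by rw [iSup_eigSpace hs hA]; trivial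
  obtain ⟨f, hf, hs⟩ := (Submodule.mem_iSup_iff_exists_finsupp _ _).1 hv
  exact ⟨f, fun c => mem_eigSpace.1 (hf c), hs⟩

theorem inner_decomp {A : H →L[ℂ] H} (hs : IsSelfAdjoint A) {f : ℝ →₀ H}
    (hf : ∀ c, A (f c) = (c : ℂ) • f c) {c : ℝ} {x : H} (hx : A x = (c : ℂ) • x) :
    ⟪x, f.sum (fun _ y => y)⟫_ℂ = ⟪x, f c⟫_ℂ := by
  rw [Finsupp.sum, inner_sum]
  refine Finset.sum_eq_single c ?_ ?_
  · intro d _ hd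
    exact inner_eq_zero_of_eigenvalue_ne hs hd.symm hx (hf d)
  · intro h
    simp [Finsupp.notMem_support_iff.1 h]

/-- By the spectral decomposition, the eigenspace for `c` contains all vectors orthogonal to the
other eigenspaces. -/
theorem mem_eigSpace_of_inner {A : H →L[ℂ] H} (hs : IsSelfAdjoint A) (hA : FiniteRank A) {c : ℝ}
    {v : H} (h : ∀ d, d ≠ c → ∀ x, A x = (d : ℂ) • x → ⟪x, v⟫_ℂ = 0) : A v = (c : ℂ) • v := by
  obtain ⟨f, hf, rfl⟩ := exists_decomp hs hA v
  have h0 : ∀ d, d ≠ c → f d = 0 := by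
    intro d hd
    have h1 := h d hd (f d) (hf d)
    rw [inner_decomp hs hf (hf d)] at h1
    exact inner_self_eq_zero.1 h1
  have h1 : f.sum (fun _ y => y) = f c := by
    rw [Finsupp.sum]
    refine Finset.sum_eq_single c (fun d _ hd => h0 d hd) ?_
    intro hc
    exact Finsupp.notMem_support_iff.1 hc
  rw [h1, hf c]

/-- An operator of the class is determined by all eigenspaces but one. -/
theorem eq_of_eigSpace {A B : H →L[ℂ] H} (hA : IsSelfAdjoint A) (hAf : FiniteRank A)
    (hB : IsSelfAdjoint B) (hBf : FiniteRank B) (c : ℝ)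
    (h : ∀ d, d ≠ c → ∀ x, A x = (d : ℂ) • x ↔ B x = (d : ℂ) • x) : A = B := by
  have h1 : ∀ x, A x = (c : ℂ) • x → B x = (c : ℂ) • x := by
    intro x hx
    refine mem_eigSpace_of_inner hB hBf fun d hd y hy => ?_
    exact inner_eq_zero_of_eigenvalue_ne hA hd ((h d hd y).2 hy) hx
  ext v
  obtain ⟨f, hf, rfl⟩ := exists_decomp hA hAf v
  rw [Finsupp.sum, map_sum, map_sum]
  refine Finset.sum_congr rfl fun d _ => ?_
  by_cases hd : d = c
  · subst hd; rw [hf, h1 _ (hf d)]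
  · rw [hf, (h d hd _).1 (hf d)]

/-! ### Swapping two eigenlines -/

/-- `B` arises from `A` by exchanging the eigenlines `p` and `q`, which belong to different
eigenvalues of `A`. The relation is symmetric in `p` and `q`. -/
def Swap (A B : H →L[ℂ] H) (p q : ℙ ℂ H) : Prop :=
  ∃ c d : ℝ, c ≠ d ∧ EigLine A p c ∧ EigLine A q d ∧
    B = A + ((c : ℂ) - d) • (linePr q - linePr p)

theorem exists_swap {A : H →L[ℂ] H} {p q : ℙ ℂ H} {c d : ℝ} (hcd : c ≠ d) (hp : EigLine A p c)
    (hq : EigLine A q d) : ∃ B, Swap A B p q :=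
  ⟨_, c, d, hcd, hp, hq, rfl⟩

section

variable {A B C : H →L[ℂ] H} {p q r s : ℙ ℂ H} {c d e : ℝ}

theorem Swap.symm (h : Swap A B p q) : Swap A B q p := by
  obtain ⟨c, d, hcd, hp, hq, rfl⟩ := h
  refine ⟨d, c, hcd.symm, hq, hp, ?_⟩
  congr 1
  rw [← neg_sub (linePr q), smul_neg, ← neg_smul, neg_sub]

theorem Swap.eq (h : Swap A B p q) (hp : EigLine A p c) (hq : EigLine A q d) :
    c ≠ d ∧ B = A + ((c : ℂ) - d) • (linePr q - linePr p) := by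
  obtain ⟨c', d', hcd, hp', hq', rfl⟩ := h
  rw [hp.unique hp', hq.unique hq']
  exact ⟨hcd, rfl⟩

theorem Swap.perp (hA : IsSelfAdjoint A) (h : Swap A B p q) : Perp p q := by
  obtain ⟨c, d, hcd, hp, hq, rfl⟩ := h
  exact hp.perp hA hcd hq

theorem Swap.ne (hA : IsSelfAdjoint A) (h : Swap A B p q) : p ≠ q := (h.perp hA).ne

theorem Swap.op_unique {B' : H →L[ℂ] H} (h : Swap A B p q) (h' : Swap A B' p q) : B = B' := by
  obtain ⟨c, d, hcd, hp, hq, rfl⟩ := h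
  rw [(h'.eq hp hq).2]

theorem Swap.apply_of_inner (h : Swap A B p q) {v : H} (hp : ⟪p.rep, v⟫_ℂ = 0)
    (hq : ⟪q.rep, v⟫_ℂ = 0) : B v = A v := by
  obtain ⟨c, d, hcd, -, -, rfl⟩ := h
  simp [linePr_eq_zero hp, linePr_eq_zero hq]

theorem Swap.eigLine_of_perp (h : Swap A B p q) (hr : EigLine A r e) (hpr : Perp p r)
    (hqr : Perp q r) : EigLine B r e := by
  rw [EigLine, h.apply_of_inner hpr hqr]; exact hr

theorem Swap.eigLine_left (hA : IsSelfAdjoint A) (h : Swap A B p q) (hq : EigLine A q d) :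
    EigLine B p d := by
  have hpq := h.perp hA
  obtain ⟨c, d', hcd, hp, hq', rfl⟩ := h
  obtain rfl := hq.unique hq'
  have hp' : A p.rep = (c : ℂ) • p.rep := hp
  have : (A + ((c : ℂ) - d) • (linePr q - linePr p)) p.rep = (d : ℂ) • p.rep := by
    simp only [add_apply, smul_apply, sub_apply, linePr_rep, linePr_perp hpq.symm, hp']
    module
  exact this

theorem Swap.eigLine_right (hA : IsSelfAdjoint A) (h : Swap A B p q) (hp : EigLine A p c) :
    EigLine B q c := h.symm.eigLine_left hA hp

theorem Swap.rev (hA : IsSelfAdjoint A) (h : Swap A B p q) : Swap B A p q := by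
  obtain ⟨c, d, hcd, hp, hq, e⟩ := id h
  refine ⟨d, c, hcd.symm, h.eigLine_left hA hq, h.eigLine_right hA hp, ?_⟩
  rw [e]
  module

theorem Swap.eigLine_iff_of_ne (hA : IsSelfAdjoint A) (hB : IsSelfAdjoint B) (h : Swap A B p q)
    (hp : EigLine A p c) (hq : EigLine A q d) (hec : e ≠ c) (hed : e ≠ d) :
    EigLine B r e ↔ EigLine A r e := by
  constructor
  · intro hr
    exact (h.rev hA).eigLine_of_perp hr ((h.eigLine_left hA hq).perp hB hed.symm hr)
      ((h.eigLine_right hA hp).perp hB hec.symm hr)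
  · intro hr
    exact h.eigLine_of_perp hr (hp.perp hA hec.symm hr) (hq.perp hA hed.symm hr)

/-- Swapping one line with either of two orthogonal lines of the same eigenspace gives two operators
which differ by a swap. -/
theorem Swap.trans_of_perp (hA : IsSelfAdjoint A) (hB : Swap A B p q) (hC : Swap A C p r)
    (hq : EigLine A q d) (hr : EigLine A r d) (hqr : Perp q r) : Swap B C q r := by
  obtain ⟨c, d', hcd, hp, hq', e⟩ := id hB
  obtain rfl := hq.unique hq'
  refine ⟨c, d, hcd, hB.eigLine_right hA hp, hB.eigLine_of_perp hr (hC.perp hA) hqr, ?_⟩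
  rw [(hC.eq hp hr).2, e]
  module

/-- The eigenvectors of a difference of two orthogonal rank-one projections for nonzero eigenvalues
lie on one of the two lines. -/
theorem eq_or_eq_of_linePr_sub (hrs : Perp r s) {k : ℂ} (hk : k ≠ 0)
    (h : linePr s p.rep - linePr r p.rep = k • p.rep) : p = r ∨ p = s := by
  have hp : p.rep = k⁻¹ • (linePr s p.rep - linePr r p.rep) := by
    rw [h, smul_smul, inv_mul_cancel₀ hk, one_smul]
  obtain ⟨a, ha⟩ := linePr_smul_rep s p.rep
  obtain ⟨b, hb⟩ := linePr_smul_rep r p.rep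
  have h1 : ⟪s.rep, p.rep⟫_ℂ = k * ⟪s.rep, p.rep⟫_ℂ := by
    have := congrArg (fun v => ⟪s.rep, v⟫_ℂ) h
    simp only [inner_sub_right, inner_rep_linePr, inner_smul_right] at this
    rw [hb, inner_smul_right, hrs.symm] at this
    simpa using this
  have h2 : -⟪r.rep, p.rep⟫_ℂ = k * ⟪r.rep, p.rep⟫_ℂ := by
    have := congrArg (fun v => ⟪r.rep, v⟫_ℂ) h
    simp only [inner_sub_right, inner_rep_linePr, inner_smul_right] at this
    rw [ha, inner_smul_right, hrs] at this
    simpa using this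
  by_cases h0 : ⟪s.rep, p.rep⟫_ℂ = 0
  · left
    rw [linePr_eq_zero h0, hb, zero_sub, smul_neg, smul_smul, ← neg_smul] at hp
    exact eq_of_smul_rep hp
  · right
    have hk1 : k = 1 := by
      have : (1 - k) * ⟪s.rep, p.rep⟫_ℂ = 0 := by linear_combination h1
      rcases mul_eq_zero.1 this with h | h
      · linear_combination -h
      · exact absurd h h0
    rw [hk1] at h2
    have h3 : ⟪r.rep, p.rep⟫_ℂ = 0 := by linear_combination -h2 / 2
    rw [linePr_eq_zero h3, ha, sub_zero, smul_smul] at hp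
    exact eq_of_smul_rep hp

theorem perp_of_linePr_eq (hrs : Perp r s) {v : H} (h : linePr s v = linePr r v) :
    ⟪r.rep, v⟫_ℂ = 0 ∧ ⟪s.rep, v⟫_ℂ = 0 := by
  obtain ⟨a, ha⟩ := linePr_smul_rep s v
  obtain ⟨b, hb⟩ := linePr_smul_rep r v
  constructor
  · rw [← inner_rep_linePr, ← h, ha, inner_smul_right, hrs, mul_zero]
  · rw [← inner_rep_linePr, h, hb, inner_smul_right, hrs.symm, mul_zero]

theorem Swap.lines_left (hA : IsSelfAdjoint A) (h : Swap A B p q) (h' : Swap A B r s) :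
    p = r ∨ p = s := by
  have hrs := h'.perp hA
  have hpq := h.perp hA
  obtain ⟨c, d, hcd, hp, hq, e⟩ := id h
  obtain ⟨c', d', hcd', hr, hs, e'⟩ := id h'
  have e2 : ((c : ℂ) - d) • (linePr q - linePr p) = ((c' : ℂ) - d') • (linePr s - linePr r) := by
    rw [e] at e'
    exact add_left_cancel e'
  have h1 := congrArg (fun L : H →L[ℂ] H => L p.rep) e2
  simp only [smul_apply, sub_apply, linePr_rep, linePr_perp hpq.symm, zero_sub] at h1
  have hn : (c : ℂ) - d ≠ 0 := sub_ne_zero.2 (by exact_mod_cast hcd)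
  have hn' : (c' : ℂ) - d' ≠ 0 := sub_ne_zero.2 (by exact_mod_cast hcd')
  refine eq_or_eq_of_linePr_sub hrs (k := -((c' : ℂ) - d')⁻¹ * ((c : ℂ) - d)) ?_ ?_
  · exact mul_ne_zero (neg_ne_zero.2 (inv_ne_zero hn')) hn
  · rw [mul_smul, neg_smul, ← smul_neg, ← smul_neg, h1, smul_smul, inv_mul_cancel₀ hn', one_smul]

theorem Swap.lines_eq (hA : IsSelfAdjoint A) (h : Swap A B p q) (h' : Swap A B r s) :
    (p = r ∧ q = s) ∨ (p = s ∧ q = r) := by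
  have h1 := h.lines_left hA h'
  have h2 := h.symm.lines_left hA h'
  have h3 := h.ne hA
  grind

/-- Conjugation by the reflection which exchanges the unit vectors of the two lines realizes a
swap. -/
theorem Swap.mem_conjClass (hA : IsSelfAdjoint A) (h : Swap A B p q) : B ∈ conjClass A := by
  have hpq := h.perp hA
  obtain ⟨c, d, hcd, hp, hq, rfl⟩ := h
  obtain ⟨x, hx1, hpx⟩ : ∃ x : H, ‖x‖ = 1 ∧ p.submodule = ℂ ∙ x := by
    have h0 : ((‖p.rep‖ : ℂ))⁻¹ ≠ 0 := by simpa using p.rep_nonzero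
    refine ⟨((‖p.rep‖ : ℂ))⁻¹ • p.rep, ?_, ?_⟩
    · have := p.rep_nonzero
      rw [norm_smul]; simp [this]
    · rw [Submodule.span_singleton_smul_eq (IsUnit.mk0 _ h0), p.submodule_eq]
  obtain ⟨y, hy1, hqy⟩ : ∃ x : H, ‖x‖ = 1 ∧ q.submodule = ℂ ∙ x := by
    have h0 : ((‖q.rep‖ : ℂ))⁻¹ ≠ 0 := by simpa using q.rep_nonzero
    refine ⟨((‖q.rep‖ : ℂ))⁻¹ • q.rep, ?_, ?_⟩
    · have := q.rep_nonzero
      rw [norm_smul]; simp [this]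
    · rw [Submodule.span_singleton_smul_eq (IsUnit.mk0 _ h0), q.submodule_eq]
  have hpr : ∀ (K L : Submodule ℂ H) [K.HasOrthogonalProjection] [L.HasOrthogonalProjection],
      K = L → ∀ v, K.starProjection v = L.starProjection v := by
    intro K L _ _ e v
    subst e
    rfl
  have hPx : ∀ v, linePr p v = ⟪x, v⟫_ℂ • x := fun v => by
    rw [linePr, hpr _ _ hpx, Submodule.starProjection_unit_singleton ℂ hx1]
  have hPy : ∀ v, linePr q v = ⟪y, v⟫_ℂ • y := fun v => by
    rw [linePr, hpr _ _ hqy, Submodule.starProjection_unit_singleton ℂ hy1]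
  have hxm : x ∈ ℂ ∙ p.rep := by
    rw [← p.submodule_eq, hpx]; exact Submodule.mem_span_singleton_self x
  have hym : y ∈ ℂ ∙ q.rep := by
    rw [← q.submodule_eq, hqy]; exact Submodule.mem_span_singleton_self y
  obtain ⟨a, rfl⟩ := Submodule.mem_span_singleton.1 hxm
  obtain ⟨b, rfl⟩ := Submodule.mem_span_singleton.1 hym
  set x := a • p.rep with hx
  set y := b • q.rep with hy
  have hxy : ⟪x, y⟫_ℂ = 0 := by
    have : ⟪p.rep, q.rep⟫_ℂ = 0 := hpq
    simp [hx, hy, this]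
  have hyx : ⟪y, x⟫_ℂ = 0 := inner_eq_zero_symm.1 hxy
  have hxx : ⟪x, x⟫_ℂ = 1 := by rw [inner_self_eq_norm_sq_to_K, hx1]; simp
  have hyy : ⟪y, y⟫_ℂ = 1 := by rw [inner_self_eq_norm_sq_to_K, hy1]; simp
  have hAx : A x = (c : ℂ) • x := by
    have : A p.rep = (c : ℂ) • p.rep := hp
    rw [hx, map_smul, this, smul_comm]
  have hAy : A y = (d : ℂ) • y := by
    have : A q.rep = (d : ℂ) • q.rep := hq
    rw [hy, map_smul, this, smul_comm]
  have hnorm : ‖x - y‖ ^ 2 = 2 := by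
    have h2 : ((‖x - y‖ : ℂ)) ^ 2 = 2 := by
      have := inner_self_eq_norm_sq_to_K (𝕜 := ℂ) (x - y)
      rw [inner_sub_left, inner_sub_right, inner_sub_right, hxy, hyx, hxx, hyy] at this
      have h3 : (2 : ℂ) = (‖x - y‖ : ℂ) ^ 2 := by
        rw [← RCLike.ofReal_eq_complex_ofReal, ← this]; norm_num
      exact h3.symm
    exact_mod_cast h2
  let W : H ≃ₗᵢ[ℂ] H := ((ℂ ∙ (x - y))ᗮ).reflection
  have hW : ∀ v, W v = v - (⟪x, v⟫_ℂ - ⟪y, v⟫_ℂ) • (x - y) := by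
    intro v
    have h1 : W v = - (ℂ ∙ (x - y)).reflection v := by
      simp only [W, Submodule.reflection_orthogonal]
      rfl
    rw [h1, Submodule.reflection_apply, Submodule.starProjection_singleton, hnorm, inner_sub_left]
    push_cast
    module
  have hAi : ∀ v, ⟪x, A v⟫_ℂ = c * ⟪x, v⟫_ℂ := fun v => by
    have : ⟪A x, v⟫_ℂ = ⟪x, A v⟫_ℂ := hA.isSymmetric x v
    rw [← this, hAx, inner_smul_left, Complex.conj_ofReal]
  have hAj : ∀ v, ⟪y, A v⟫_ℂ = d * ⟪y, v⟫_ℂ := fun v => by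
    have : ⟪A y, v⟫_ℂ = ⟪y, A v⟫_ℂ := hA.isSymmetric y v
    rw [← this, hAy, inner_smul_left, Complex.conj_ofReal]
  refine mem_conjClass_of_conj W fun v => ?_
  simp only [add_apply, smul_apply, sub_apply, hPx, hPy, hW, map_sub, map_smul, hxx, hxy,
    hyx, hyy, hAx, hAy, hAi, hAj]
  module

theorem commute_linePr (hA : IsSelfAdjoint A) (hp : EigLine A p c) :
    A * linePr p = linePr p * A := by
  have hp' : A p.rep = (c : ℂ) • p.rep := hp
  ext v
  simp only [mul_apply_eq_comp, linePr_apply, map_smul, hp']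
  have : ⟪A p.rep, v⟫_ℂ = ⟪p.rep, A v⟫_ℂ := hA.isSymmetric p.rep v
  rw [← this, hp', inner_smul_left, Complex.conj_ofReal, smul_smul]
  congr 1
  ring

theorem Swap.commAdj (hA : IsSelfAdjoint A) (h : Swap A B p q) : CommAdj A B := by
  have hpq := h.perp hA
  obtain ⟨c, d, hcd, hp, hq, rfl⟩ := h
  have hn : (c : ℂ) - d ≠ 0 := sub_ne_zero.2 (by exact_mod_cast hcd)
  constructor
  · rw [mul_add, add_mul, mul_smul_comm, smul_mul_assoc, mul_sub, sub_mul,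
      commute_linePr hA hp, commute_linePr hA hq]
  · have hr : LinearMap.range
        ((A - (A + ((c : ℂ) - d) • (linePr q - linePr p)) : H →L[ℂ] H) : H →ₗ[ℂ] H) =
        Submodule.span ℂ (Set.range ![p.rep, q.rep]) := by
      apply le_antisymm
      · rintro _ ⟨v, rfl⟩
        obtain ⟨a, ha⟩ := linePr_smul_rep p v
        obtain ⟨b, hb⟩ := linePr_smul_rep q v
        have h1 : ((A - (A + ((c : ℂ) - d) • (linePr q - linePr p)) : H →L[ℂ] H) : H →ₗ[ℂ] H) v
            = -(((c : ℂ) - d) • (b • q.rep - a • p.rep)) := by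
          simp [ha, hb]
        rw [h1]
        have h2 : p.rep ∈ Submodule.span ℂ (Set.range ![p.rep, q.rep]) :=
          Submodule.subset_span ⟨0, rfl⟩
        have h3 : q.rep ∈ Submodule.span ℂ (Set.range ![p.rep, q.rep]) :=
          Submodule.subset_span ⟨1, rfl⟩
        exact neg_mem (Submodule.smul_mem _ _
          (sub_mem (Submodule.smul_mem _ _ h3) (Submodule.smul_mem _ _ h2)))
      · rw [Submodule.span_le]
        rintro _ ⟨i, rfl⟩
        fin_cases i
        · refine ⟨((c : ℂ) - d)⁻¹ • p.rep, ?_⟩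
          simp [linePr_rep, linePr_perp hpq.symm, smul_smul, inv_mul_cancel₀ hn]
        · refine ⟨-((c : ℂ) - d)⁻¹ • q.rep, ?_⟩
          simp [linePr_rep, linePr_perp hpq, smul_smul, mul_inv_cancel₀ hn]
    have hli : LinearIndependent ℂ ![p.rep, q.rep] := by
      refine linearIndependent_of_ne_zero_of_inner_eq_zero ?_ ?_
      · intro i; fin_cases i
        · exact p.rep_nonzero
        · exact q.rep_nonzero
      · intro i j hij
        fin_cases i <;> fin_cases j
        · exact absurd rfl hij
        · exact hpq
        · exact hpq.symm
        · exact absurd rfl hij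
    have : FiniteDimensional ℂ (Submodule.span ℂ (Set.range ![p.rep, q.rep])) :=
      FiniteDimensional.span_of_finite ℂ (Set.finite_range _)
    rw [LinearMap.rank, hr, ← Module.finrank_eq_rank, finrank_span_eq_card hli]
    simp

end

/-! ### Commutative adjacency is the swap of two eigenlines -/

theorem no_three_orthogonal {R : Submodule ℂ H} [FiniteDimensional ℂ R]
    (hR : Module.finrank ℂ R = 2) {x y z : H} (hx : x ∈ R) (hy : y ∈ R) (hz : z ∈ R)
    (hx0 : x ≠ 0) (hy0 : y ≠ 0) (hz0 : z ≠ 0) (hxy : ⟪x, y⟫_ℂ = 0) (hxz : ⟪x, z⟫_ℂ = 0)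
    (hyz : ⟪y, z⟫_ℂ = 0) : False := by
  have hli : LinearIndependent ℂ ![x, y, z] := by
    refine linearIndependent_of_ne_zero_of_inner_eq_zero ?_ ?_
    · intro i; fin_cases i
      · exact hx0
      · exact hy0
      · exact hz0
    · intro i j hij
      fin_cases i <;> fin_cases j <;> first
        | exact absurd rfl hij
        | exact hxy
        | exact hxz
        | exact hyz
        | exact inner_eq_zero_symm.1 hxy
        | exact inner_eq_zero_symm.1 hxz
        | exact inner_eq_zero_symm.1 hyz
  have hle : Submodule.span ℂ (Set.range ![x, y, z]) ≤ R := by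
    rw [Submodule.span_le]
    rintro _ ⟨i, rfl⟩
    fin_cases i
    · exact hx
    · exact hy
    · exact hz
  have h1 := Submodule.finrank_mono hle
  rw [finrank_span_eq_card hli, hR] at h1
  simp at h1

theorem exists_real_eigenvector {A : H →L[ℂ] H} (hA : IsSelfAdjoint A) {R : Submodule ℂ H}
    [FiniteDimensional ℂ R] (hR : R ≠ ⊥) (hAR : ∀ v ∈ R, A v ∈ R) :
    ∃ x ∈ R, x ≠ 0 ∧ ∃ c : ℝ, A x = (c : ℂ) • x := by
  have : Nontrivial R := Submodule.nontrivial_iff_ne_bot.2 hR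
  obtain ⟨μ, hμ⟩ := Module.End.exists_eigenvalue ((A : H →ₗ[ℂ] H).restrict hAR)
  obtain ⟨x, hx, hx0⟩ := hμ.exists_hasEigenvector
  have h1 : A x = μ • (x : H) := congrArg Subtype.val (Module.End.mem_eigenspace_iff.1 hx)
  have h2 : ((μ.re : ℝ) : ℂ) = μ := by
    have h := (hA.isSymmetric.restrict_invariant hAR).conj_eigenvalue_eq_self hμ
    exact Complex.conj_eq_iff_re.1 h
  exact ⟨x, x.2, by simpa using hx0, μ.re, by rw [h2, h1]⟩

theorem exists_joint_eigenvector {A B : H →L[ℂ] H} (hA : IsSelfAdjoint A) (hB : IsSelfAdjoint B)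
    (hAB : A * B = B * A) {R : Submodule ℂ H} [FiniteDimensional ℂ R] (hR : R ≠ ⊥)
    (hAR : ∀ v ∈ R, A v ∈ R) (hBR : ∀ v ∈ R, B v ∈ R) :
    ∃ x ∈ R, x ≠ 0 ∧ ∃ c d : ℝ, A x = (c : ℂ) • x ∧ B x = (d : ℂ) • x := by
  obtain ⟨x, hxR, hx0, c, hc⟩ := exists_real_eigenvector hA hR hAR
  have hS : FiniteDimensional ℂ (R ⊓ eigSpace A c : Submodule ℂ H) :=
    Submodule.finiteDimensional_of_le inf_le_left
  have hS0 : R ⊓ eigSpace A c ≠ ⊥ := by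
    intro h
    apply hx0
    have : x ∈ R ⊓ eigSpace A c := ⟨hxR, mem_eigSpace.2 hc⟩
    rw [h] at this
    simpa using this
  have hBS : ∀ v ∈ R ⊓ eigSpace A c, B v ∈ R ⊓ eigSpace A c := by
    rintro v ⟨hvR, hv⟩
    refine ⟨hBR v hvR, mem_eigSpace.2 ?_⟩
    have hv' := mem_eigSpace.1 hv
    have h1 : A (B v) = B (A v) := congrArg (fun L : H →L[ℂ] H => L v) hAB
    rw [h1, hv', map_smul]
  obtain ⟨y, ⟨hyR, hy⟩, hy0, d, hd⟩ := exists_real_eigenvector hB hS0 hBS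
  exact ⟨y, hyR, hy0, c, d, mem_eigSpace.1 hy, hd⟩

/-- If `A` and `B` agree on the orthogonal complement of two common eigenvectors, then equality of
multiplicities forces a nonzero eigenvalue of `A` that is lost on the first vector to reappear on
the second. -/
theorem eigenvalue_reappears {A B : H →L[ℂ] H} (hB : IsSelfAdjoint B)
    (hAf : FiniteRank A) {c c' d' : ℝ}
    (hrank : Module.rank ℂ (eigSpace A c) = Module.rank ℂ (eigSpace B c)) {x y : H} (hx0 : x ≠ 0)
    (hx : A x = (c : ℂ) • x) (hx' : B x = (c' : ℂ) • x) (hy' : B y = (d' : ℂ) • y)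
    (hw : ∀ w, ⟪x, w⟫_ℂ = 0 → ⟪y, w⟫_ℂ = 0 → A w = B w) (hc : c ≠ 0) (hcc : c ≠ c') : d' = c := by
  by_contra hne
  have : FiniteDimensional ℂ (eigSpace A c) := finiteDimensional_eigSpace hAf hc
  have hle : eigSpace B c ≤ eigSpace A c := by
    intro v hv
    rw [mem_eigSpace] at hv ⊢
    rw [hw v (inner_eq_zero_of_eigenvalue_ne hB hcc.symm hx' hv)
      (inner_eq_zero_of_eigenvalue_ne hB hne hy' hv), hv]
  have heq : eigSpace B c = eigSpace A c := by
    refine Submodule.eq_of_le_of_finrank_eq hle ?_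
    rw [Module.finrank, Module.finrank, hrank]
  have hxm : x ∈ eigSpace B c := by rw [heq, mem_eigSpace]; exact hx
  have h1 : (c' : ℂ) • x = (c : ℂ) • x := by rw [← hx', mem_eigSpace.1 hxm]
  exact hcc (by exact_mod_cast (smul_left_injective ℂ hx0 h1).symm)

theorem ext_of_lines {A B : H →L[ℂ] H} {p q : ℙ ℂ H} (hpq : Perp p q) (hp : A p.rep = B p.rep)
    (hq : A q.rep = B q.rep)
    (hw : ∀ w, ⟪p.rep, w⟫_ℂ = 0 → ⟪q.rep, w⟫_ℂ = 0 → A w = B w) : A = B := by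
  ext v
  obtain ⟨a, ha⟩ := linePr_smul_rep p v
  obtain ⟨b, hb⟩ := linePr_smul_rep q v
  have h1 := hw (v - linePr p v - linePr q v)
    (by rw [inner_sub_right, inner_sub_right, inner_rep_linePr, hb, inner_smul_right, hpq]; simp)
    (by rw [inner_sub_right, inner_sub_right, inner_rep_linePr, ha, inner_smul_right, hpq.symm]
        simp)
  have hv : v = (v - linePr p v - linePr q v) + linePr p v + linePr q v := by abel
  rw [hv, map_add, map_add, map_add, map_add, h1, ha, hb, map_smul, map_smul, map_smul, map_smul,
    hp, hq]

/-- The difference of commutatively adjacent operators is diagonal in an orthonormal pair of common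
eigenvectors, and conjugacy forces the two eigenvalues to be exchanged. -/
theorem CommAdj.exists_swap {T A B : H →L[ℂ] H} (hT : IsSelfAdjoint T) (hTf : FiniteRank T)
    (hA : A ∈ conjClass T) (hB : B ∈ conjClass T) (h : CommAdj A B) : ∃ p q, Swap A B p q := by
  obtain ⟨hcomm, hrk⟩ := h
  have hAs := isSelfAdjoint_of_mem hT hA
  have hBs := isSelfAdjoint_of_mem hT hB
  set D := A - B with hD
  have hDs : IsSelfAdjoint D := hAs.sub hBs
  set R := LinearMap.range (D : H →ₗ[ℂ] H) with hR
  have hrk' : Module.rank ℂ R = 2 := hrk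
  have hfin : FiniteDimensional ℂ R := by
    rw [FiniteDimensional, ← Module.rank_lt_aleph0_iff, hrk']
    exact Cardinal.natCast_lt_aleph0 (n := 2)
  have hfr : Module.finrank ℂ R = 2 := by
    rw [Module.finrank, hrk']; simp
  have hAR : ∀ v ∈ R, A v ∈ R := by
    rintro _ ⟨v, rfl⟩
    refine ⟨A v, ?_⟩
    have h1 : A (B v) = B (A v) := congrArg (fun L : H →L[ℂ] H => L v) hcomm
    change D (A v) = A (D v)
    simp [hD, h1]
  have hBR : ∀ v ∈ R, B v ∈ R := by
    rintro _ ⟨v, rfl⟩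
    refine ⟨B v, ?_⟩
    have h1 : A (B v) = B (A v) := congrArg (fun L : H →L[ℂ] H => L v) hcomm
    change D (B v) = B (D v)
    simp [hD, h1]
  have hR0 : R ≠ ⊥ := by
    intro h0
    rw [h0] at hfr
    simp at hfr
  obtain ⟨x, hxR, hx0, α, α', hAx, hBx⟩ := exists_joint_eigenvector hAs hBs hcomm hR0 hAR hBR
  have hinv : ∀ {L : H →L[ℂ] H} {k : ℝ}, IsSelfAdjoint L → L x = (k : ℂ) • x →
      ∀ v, ⟪x, v⟫_ℂ = 0 → ⟪x, L v⟫_ℂ = 0 := by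
    intro L k hL hLx v hv
    have h1 : ⟪L x, v⟫_ℂ = ⟪x, L v⟫_ℂ := hL.isSymmetric x v
    rw [← h1, hLx, inner_smul_left, hv, mul_zero]
  let S : Submodule ℂ H := R ⊓ (ℂ ∙ x)ᗮ
  have hmS : ∀ v, v ∈ S ↔ v ∈ R ∧ ⟪x, v⟫_ℂ = 0 := fun v => by
    simp only [S, Submodule.mem_inf, Submodule.mem_orthogonal_singleton_iff_inner_right]
  have hSfin : FiniteDimensional ℂ S := Submodule.finiteDimensional_of_le inf_le_left
  have hS0 : S ≠ ⊥ := by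
    intro h0
    have hle : R ≤ ℂ ∙ x := by
      intro v hv
      have h1 : v - (ℂ ∙ x).starProjection v ∈ S := by
        rw [hmS]
        refine ⟨R.sub_mem hv ?_, ?_⟩
        · rw [Submodule.starProjection_singleton]
          exact R.smul_mem _ hxR
        · exact inner_eq_zero_symm.1 (Submodule.starProjection_inner_eq_zero v x
            (Submodule.mem_span_singleton_self x))
      rw [h0, Submodule.mem_bot, sub_eq_zero] at h1
      rw [h1]
      exact Submodule.starProjection_apply_mem _ _
    have h2 := Submodule.finrank_mono hle
    rw [hfr, finrank_span_singleton hx0] at h2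
    omega
  obtain ⟨y, hyS, hy0, β, β', hAy, hBy⟩ := exists_joint_eigenvector hAs hBs hcomm hS0
    (fun v hv => by
      rw [hmS] at hv ⊢; exact ⟨hAR v hv.1, hinv hAs hAx v hv.2⟩)
    (fun v hv => by
      rw [hmS] at hv ⊢; exact ⟨hBR v hv.1, hinv hBs hBx v hv.2⟩)
  obtain ⟨hyR, hxy⟩ := (hmS y).1 hyS
  have hw : ∀ w, ⟪x, w⟫_ℂ = 0 → ⟪y, w⟫_ℂ = 0 → A w = B w := by
    intro w hxw hyw
    by_contra hne
    have hDw : D w ≠ 0 := by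
      simpa [hD, sub_eq_zero] using hne
    refine no_three_orthogonal hfr hxR hyR ⟨w, rfl⟩ hx0 hy0 hDw hxy ?_ ?_
    · change ⟪x, A w - B w⟫_ℂ = 0
      rw [inner_sub_right, hinv hAs hAx w hxw, hinv hBs hBx w hxw, sub_zero]
    · have h1 : ⟪A y, w⟫_ℂ = ⟪y, A w⟫_ℂ := hAs.isSymmetric y w
      have h2 : ⟪B y, w⟫_ℂ = ⟪y, B w⟫_ℂ := hBs.isSymmetric y w
      change ⟪y, A w - B w⟫_ℂ = 0
      rw [inner_sub_right, ← h1, ← h2, hAy, hBy, inner_smul_left, inner_smul_left, hyw]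
      simp
  have hnk : ∀ {z : H} {k k' : ℝ}, z ∈ R → z ≠ 0 → A z = (k : ℂ) • z → B z = (k' : ℂ) • z →
      k ≠ k' := by
    rintro z k k' hzR hz0 hz hz' rfl
    obtain ⟨v, hv⟩ := hzR
    apply hz0
    have h1 : ⟪D v, z⟫_ℂ = ⟪v, D z⟫_ℂ := hDs.isSymmetric v z
    have h2 : D z = 0 := by simp [hD, hz, hz']
    have h3 : D v = z := hv
    rw [h2, h3, inner_zero_right] at h1
    exact inner_self_eq_zero.1 h1
  have hαα := hnk hxR hx0 hAx hBx
  have hββ := hnk hyR hy0 hAy hBy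
  have hrank : ∀ c, Module.rank ℂ (eigSpace A c) = Module.rank ℂ (eigSpace B c) := fun c => by
    rw [rank_eigSpace_of_mem hA, rank_eigSpace_of_mem hB]
  have hAf := finiteRank_of_mem hTf hA
  have hBf := finiteRank_of_mem hTf hB
  have k1 : α ≠ 0 → β' = α := fun h0 =>
    eigenvalue_reappears hBs hAf (hrank α) hx0 hAx hBx hBy hw h0 hαα
  have k2 : β ≠ 0 → α' = β := fun h0 =>
    eigenvalue_reappears hBs hAf (hrank β) hy0 hAy hBy hBx (fun w h1 h2 => hw w h2 h1) h0 hββ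
  have k3 : α' ≠ 0 → β = α' := fun h0 =>
    eigenvalue_reappears hAs hBf (hrank α').symm hx0 hBx hAx hAy
      (fun w h1 h2 => (hw w h1 h2).symm) h0 hαα.symm
  have k4 : β' ≠ 0 → α = β' := fun h0 =>
    eigenvalue_reappears hAs hBf (hrank β').symm hy0 hBy hAy hAx
      (fun w h1 h2 => (hw w h2 h1).symm) h0 hββ.symm
  have e1 : β' = α := by
    by_cases h0 : α = 0
    · by_contra h1
      exact h1 (k4 (fun h2 => h1 (h2.trans h0.symm))).symm
    · exact k1 h0
  have e2 : α' = β := by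
    by_cases h0 : β = 0
    · by_contra h1
      exact h1 (k3 (fun h2 => h1 (h2.trans h0.symm))).symm
    · exact k2 h0
  subst e1 e2
  have hpq : Perp (Projectivization.mk ℂ x hx0) (Projectivization.mk ℂ y hy0) :=
    (perp_mk_mk hx0 hy0).2 hxy
  have hp : EigLine A (Projectivization.mk ℂ x hx0) β' := (eigLine_mk hx0).2 hAx
  have hq : EigLine A (Projectivization.mk ℂ y hy0) α' := (eigLine_mk hy0).2 hAy
  have hp' : EigLine B (Projectivization.mk ℂ x hx0) α' := (eigLine_mk hx0).2 hBx
  have hq' : EigLine B (Projectivization.mk ℂ y hy0) β' := (eigLine_mk hy0).2 hBy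
  refine ⟨Projectivization.mk ℂ x hx0, Projectivization.mk ℂ y hy0, β', α', hαα, hp, hq, ?_⟩
  obtain ⟨a, ha, hxa⟩ := exists_rep_mk x hx0
  obtain ⟨b, hb, hyb⟩ := exists_rep_mk y hy0
  refine ext_of_lines hpq ?_ ?_ ?_
  · rw [show B _ = _ from hp']
    simp only [add_apply, smul_apply, sub_apply, linePr_rep, linePr_perp hpq.symm,
      show A _ = _ from hp]
    module
  · rw [show B _ = _ from hq']
    simp only [add_apply, smul_apply, sub_apply, linePr_rep, linePr_perp hpq,
      show A _ = _ from hq]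
    module
  · intro w hxw hyw
    have h1 : ⟪x, w⟫_ℂ = 0 := by
      rw [hxa, inner_smul_left] at hxw
      simpa [ha] using hxw
    have h2 : ⟪y, w⟫_ℂ = 0 := by
      rw [hyb, inner_smul_left] at hyw
      simpa [hb] using hyw
    simp [linePr_eq_zero hxw, linePr_eq_zero hyw, hw w h1 h2]

/-! ### Adjacency among the neighbours of an operator -/

section

variable {A B C : H →L[ℂ] H} {p q r s x y : ℙ ℂ H} {c d e : ℝ}

theorem Swap.op_ne (hA : IsSelfAdjoint A) (h : Swap A B p q) : A ≠ B := by
  rintro rfl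
  have h1 := (h.commAdj hA).2
  rw [sub_self] at h1
  simp at h1

theorem Swap.no_three (hA : IsSelfAdjoint A) (h : Swap A B x y) {k₁ k₂ k₃ : ℂ} (hk₁ : k₁ ≠ 0)
    (hk₂ : k₂ ≠ 0) (hk₃ : k₃ ≠ 0) (hp : (A - B) p.rep = k₁ • p.rep)
    (hq : (A - B) q.rep = k₂ • q.rep) (hr : (A - B) r.rep = k₃ • r.rep) (hpq : Perp p q)
    (hpr : Perp p r) (hqr : Perp q r) : False := by
  have hrk : Module.rank ℂ (LinearMap.range ((A - B : H →L[ℂ] H) : H →ₗ[ℂ] H)) = 2 :=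
    (h.commAdj hA).2
  have hfin : FiniteDimensional ℂ (LinearMap.range ((A - B : H →L[ℂ] H) : H →ₗ[ℂ] H)) := by
    rw [FiniteDimensional, ← Module.rank_lt_aleph0_iff, hrk]
    exact Cardinal.natCast_lt_aleph0 (n := 2)
  have hm : ∀ {t : ℙ ℂ H} {k : ℂ}, k ≠ 0 → (A - B) t.rep = k • t.rep →
      t.rep ∈ LinearMap.range ((A - B : H →L[ℂ] H) : H →ₗ[ℂ] H) := by
    intro t k hk ht
    refine ⟨k⁻¹ • t.rep, ?_⟩
    change (A - B) (k⁻¹ • t.rep) = t.rep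
    rw [map_smul, ht, smul_smul, inv_mul_cancel₀ hk, one_smul]
  exact no_three_orthogonal (by rw [Module.finrank, hrk]; simp) (hm hk₁ hp) (hm hk₂ hq) (hm hk₃ hr)
    p.rep_nonzero q.rep_nonzero r.rep_nonzero hpq hpr hqr

/-- If two neighbours of `A` commute, the lines of their swaps are pairwise equal or orthogonal. -/
theorem Swap.eq_or_perp_of_commute (hA : IsSelfAdjoint A) (h : Swap A B p q) (h' : Swap A C r s)
    (hBC : B * C = C * B) : p = r ∨ p = s ∨ (Perp r p ∧ Perp s p) := by
  have hpq := h.perp hA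
  have hrs := h'.perp hA
  obtain ⟨c, d, hcd, hp, hq, rfl⟩ := h
  obtain ⟨c', d', hcd', hr, hs, rfl⟩ := h'
  have hn : (c : ℂ) - d ≠ 0 := sub_ne_zero.2 (by exact_mod_cast hcd)
  have hn' : (c' : ℂ) - d' ≠ 0 := sub_ne_zero.2 (by exact_mod_cast hcd')
  have e1 : (linePr q - linePr p) * (linePr s - linePr r)
      = (linePr s - linePr r) * (linePr q - linePr p) := by
    have hAr := commute_linePr hA hr
    have hAs := commute_linePr hA hs
    have hAp := commute_linePr hA hp
    have hAq := commute_linePr hA hq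
    have h1 : A * (linePr s - linePr r) = (linePr s - linePr r) * A := by
      rw [mul_sub, sub_mul, hAr, hAs]
    have h2 : A * (linePr q - linePr p) = (linePr q - linePr p) * A := by
      rw [mul_sub, sub_mul, hAp, hAq]
    simp only [add_mul, mul_add, smul_mul_assoc, mul_smul_comm, h1, h2] at hBC
    have h3 : (((c : ℂ) - d) * ((c' : ℂ) - d')) •
        ((linePr q - linePr p) * (linePr s - linePr r))
        = (((c : ℂ) - d) * ((c' : ℂ) - d')) •
        ((linePr s - linePr r) * (linePr q - linePr p)) := by
      rw [← sub_eq_zero] at hBC ⊢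
      rw [← hBC]
      module
    exact smul_right_injective _ (mul_ne_zero hn hn') h3
  set w := linePr s p.rep - linePr r p.rep with hw
  have e2 : linePr q w - linePr p w = -w := by
    have := congrArg (fun L : H →L[ℂ] H => L p.rep) e1
    simp only [mul_apply_eq_comp, sub_apply, linePr_rep, linePr_perp hpq.symm, zero_sub,
      map_neg] at this
    rw [← hw] at this
    rw [this]
  obtain ⟨a, ha⟩ := linePr_smul_rep p w
  have e3 : ⟪q.rep, w⟫_ℂ = 0 := by
    have := congrArg (fun v => ⟪q.rep, v⟫_ℂ) e2
    simp only [inner_sub_right, inner_rep_linePr, ha, inner_smul_right, inner_neg_right] at this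
    rw [hpq.symm] at this
    linear_combination this / 2
  have e4 : w = a • p.rep := by
    rw [linePr_eq_zero e3, zero_sub, neg_inj] at e2
    rw [← e2, ha]
  by_cases ha0 : a = 0
  · right; right
    rw [ha0, zero_smul, hw, sub_eq_zero] at e4
    exact perp_of_linePr_eq hrs e4
  · rcases eq_or_eq_of_linePr_sub hrs ha0 e4 with h | h
    · exact Or.inl h
    · exact Or.inr (Or.inl h)

theorem Swap.perp_of_common (hA : IsSelfAdjoint A) (hB : IsSelfAdjoint B) (h : Swap A B p q)
    (h' : Swap A C p s) (hBC : Swap B C x y) (hq : EigLine A q d) : Perp q s ∧ EigLine A s d := by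
  have hne := hBC.op_ne hB
  have hqs : q ≠ s := by
    rintro rfl
    exact hne (h.op_unique h')
  have hpq := h.perp hA
  have hps := h'.perp hA
  have hperp : Perp q s := by
    rcases h.symm.eq_or_perp_of_commute hA h' (hBC.commAdj hB).1 with h1 | h1 | h1
    · exact absurd h1 hpq.ne.symm
    · exact absurd h1 hqs
    · exact h1.2.symm
  refine ⟨hperp, ?_⟩
  obtain ⟨c, d', hcd, hp, hq', rfl⟩ := h
  obtain rfl := hq.unique hq'
  obtain ⟨c', d', hcd', hp', hs, rfl⟩ := h'
  obtain rfl := hp.unique hp'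
  have hn : (c : ℂ) - d ≠ 0 := sub_ne_zero.2 (by exact_mod_cast hcd)
  have hn' : -((c : ℂ) - d') ≠ 0 := neg_ne_zero.2 (sub_ne_zero.2 (by exact_mod_cast hcd'))
  by_contra hsd
  have hdd : d ≠ d' := by
    rintro rfl
    exact hsd hs
  have hm : (d : ℂ) - d' ≠ 0 := sub_ne_zero.2 (by exact_mod_cast hdd)
  refine hBC.no_three hB (p := p) (q := q) (r := s) hm hn hn' ?_ ?_ ?_ hpq hps hperp
  · simp only [add_apply, smul_apply, sub_apply, linePr_rep, linePr_perp hpq.symm,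
      linePr_perp hps.symm]
    module
  · simp only [add_apply, smul_apply, sub_apply, linePr_rep, linePr_perp hpq,
      linePr_perp hperp.symm]
    module
  · simp only [add_apply, smul_apply, sub_apply, linePr_rep, linePr_perp hps,
      linePr_perp hperp]
    module

/-- Two neighbours of `A` are adjacent only if their swaps share a line and the remaining two lines
are orthogonal and belong to the same eigenvalue. -/
theorem Swap.exists_common (hA : IsSelfAdjoint A) (hB : IsSelfAdjoint B) (h : Swap A B p q)
    (h' : Swap A C r s) (hBC : Swap B C x y) :
    ∃ z l m e, Swap A B l z ∧ Swap A C m z ∧ Perp l m ∧ EigLine A l e ∧ EigLine A m e := by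
  have hcom := (hBC.commAdj hB).1
  -- once a common line is known, the previous lemma gives the rest
  have core : ∀ {z l m : ℙ ℂ H}, Swap A B l z → Swap A C m z →
      ∃ z l m e, Swap A B l z ∧ Swap A C m z ∧ Perp l m ∧ EigLine A l e ∧ EigLine A m e := by
    intro z l m h1 h2
    obtain ⟨e, _, _, hl, _, _⟩ := id h1
    obtain ⟨h3, h4⟩ := h1.symm.perp_of_common hA hB h2.symm hBC hl
    exact ⟨z, l, m, e, h1, h2, h3, hl, h4⟩
  rcases h.eq_or_perp_of_commute hA h' hcom with rfl | rfl | ⟨hrp, hsp⟩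
  · exact core h.symm h'.symm
  · exact core h.symm h'
  rcases h.symm.eq_or_perp_of_commute hA h' hcom with rfl | rfl | ⟨hrq, hsq⟩
  · exact core h h'.symm
  · exact core h h'
  exfalso
  have hpq := h.perp hA
  have hrs := h'.perp hA
  obtain ⟨c, d, hcd, hp, hq, rfl⟩ := h
  obtain ⟨c', d', hcd', hr, hs, rfl⟩ := h'
  have hn : (c : ℂ) - d ≠ 0 := sub_ne_zero.2 (by exact_mod_cast hcd)
  have hn' : ((c' : ℂ) - d') ≠ 0 := sub_ne_zero.2 (by exact_mod_cast hcd')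
  refine hBC.no_three hB (p := p) (q := q) (r := r) (neg_ne_zero.2 hn) hn hn' ?_ ?_ ?_ hpq
    hrp.symm hrq.symm
  · simp only [add_apply, smul_apply, sub_apply, linePr_rep, linePr_perp hpq.symm,
      linePr_perp hrp, linePr_perp hsp]
    module
  · simp only [add_apply, smul_apply, sub_apply, linePr_rep, linePr_perp hpq,
      linePr_perp hrq, linePr_perp hsq]
    module
  · simp only [add_apply, smul_apply, sub_apply, linePr_rep, linePr_perp hrs.symm,
      linePr_perp hrp.symm, linePr_perp hrq.symm]
    module

end

/-! ### Eigenlines and dimensions of eigenspaces -/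

section

variable {A : H →L[ℂ] H} {p q r : ℙ ℂ H} {c : ℝ}

/-- The pencil of lines spanned by two lines contains a third one. -/
theorem exists_third_line {l m : ℙ ℂ H} (hlm : l ≠ m) : ∃ n : ℙ ℂ H, n ≠ l ∧ n ≠ m ∧
    (∀ r, Perp r l → Perp r m → Perp r n) ∧
    ∀ (A : H →L[ℂ] H) (c : ℝ), EigLine A l c → EigLine A m c → EigLine A n c := by
  have h0 : l.rep + m.rep ≠ 0 := by
    intro h
    exact hlm (eq_of_smul_rep (a := -1) (by rw [neg_one_smul]; exact eq_neg_of_add_eq_zero_left h))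
  refine ⟨Projectivization.mk ℂ _ h0, ?_, ?_, ?_, ?_⟩
  · intro h
    obtain ⟨a, ha, hr⟩ := exists_rep_mk _ h0
    rw [h] at hr
    have h1 : a • m.rep = (1 - a) • l.rep := by
      rw [sub_smul, one_smul, eq_sub_iff_add_eq, add_comm, ← smul_add, ← hr]
    apply hlm
    refine (eq_of_smul_rep (a := a⁻¹ * (1 - a)) ?_).symm
    rw [mul_smul, ← h1, smul_smul, inv_mul_cancel₀ ha, one_smul]
  · intro h
    obtain ⟨a, ha, hr⟩ := exists_rep_mk _ h0
    rw [h] at hr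
    have h1 : a • l.rep = (1 - a) • m.rep := by
      rw [sub_smul, one_smul, eq_sub_iff_add_eq, ← smul_add, ← hr]
    apply hlm
    refine eq_of_smul_rep (a := a⁻¹ * (1 - a)) ?_
    rw [mul_smul, ← h1, smul_smul, inv_mul_cancel₀ ha, one_smul]
  · intro r h1 h2
    rw [perp_mk_right, inner_add_right, h1, h2, add_zero]
  · intro A c h1 h2
    rw [eigLine_mk, map_add, h1, h2, smul_add]

theorem eigSpace_ne_bot_of_eigLine (h : EigLine A p c) : eigSpace A c ≠ ⊥ := by
  intro h0
  have h1 : p.rep ∈ eigSpace A c := mem_eigSpace.2 h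
  rw [h0] at h1
  exact p.rep_nonzero (by simpa using h1)

theorem exists_eigLine (h : eigSpace A c ≠ ⊥) : ∃ p, EigLine A p c := by
  obtain ⟨x, hx, hx0⟩ := Submodule.exists_mem_ne_zero_of_ne_bot h
  exact ⟨_, (eigLine_mk hx0).2 (mem_eigSpace.1 hx)⟩

/-- In an eigenspace of dimension greater than `n` there is an eigenline orthogonal to `n` given
vectors. -/
theorem exists_eigLine_inner {n : ℕ} (h : (n : Cardinal) < Module.rank ℂ (eigSpace A c))
    (x : Fin n → H) : ∃ p, EigLine A p c ∧ ∀ i, ⟪x i, p.rep⟫_ℂ = 0 := by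
  let L : eigSpace A c →ₗ[ℂ] (Fin n → ℂ) :=
    LinearMap.pi fun i => (innerSL ℂ (x i) : H →ₗ[ℂ] ℂ) ∘ₗ (eigSpace A c).subtype
  by_cases hL : LinearMap.ker L = ⊥
  · exfalso
    have h1 := LinearMap.lift_rank_le_of_injective L (LinearMap.ker_eq_bot.1 hL)
    rw [rank_fin_fun] at h1
    have h2 : Cardinal.lift.{0} (Module.rank ℂ (eigSpace A c)) ≤ (n : Cardinal) := by
      simpa using h1
    rw [Cardinal.lift_id'] at h2
    exact absurd h2 (not_le.2 h)
  · obtain ⟨v, hv, hv0⟩ := Submodule.exists_mem_ne_zero_of_ne_bot hL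
    have hv0' : (v : H) ≠ 0 := by simpa using hv0
    refine ⟨Projectivization.mk ℂ (v : H) hv0', (eigLine_mk hv0').2 (mem_eigSpace.1 v.2), ?_⟩
    intro i
    obtain ⟨a, -, ha⟩ := exists_rep_mk (v : H) hv0'
    have h1 : ⟪x i, (v : H)⟫_ℂ = 0 := congrFun (LinearMap.mem_ker.1 hv) i
    rw [ha, inner_smul_right, h1, mul_zero]

theorem perp_unique_of_rank_two (h : Module.rank ℂ (eigSpace A c) = 2) (hp : EigLine A p c)
    (hq : EigLine A q c) (hr : EigLine A r c) (hpq : Perp p q) (hpr : Perp p r) : q = r := by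
  by_contra hqr
  have hfin : FiniteDimensional ℂ (eigSpace A c) := by
    rw [FiniteDimensional, ← Module.rank_lt_aleph0_iff, h]
    exact Cardinal.natCast_lt_aleph0 (n := 2)
  have hne : r.rep - linePr q r.rep ≠ 0 := by
    intro h0
    obtain ⟨a, ha⟩ := linePr_smul_rep q r.rep
    rw [ha, sub_eq_zero] at h0
    exact hqr (eq_of_smul_rep h0).symm
  obtain ⟨a, ha⟩ := linePr_smul_rep q r.rep
  refine no_three_orthogonal (R := eigSpace A c) (by rw [Module.finrank, h]; simp)
    (mem_eigSpace.2 hp) (mem_eigSpace.2 hq)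
    (sub_mem (mem_eigSpace.2 hr) (ha ▸ Submodule.smul_mem _ _ (mem_eigSpace.2 hq)))
    p.rep_nonzero q.rep_nonzero hne hpq ?_ ?_
  · rw [inner_sub_right, ha, inner_smul_right, hpq, hpr]; simp
  · rw [inner_sub_right, inner_rep_linePr, sub_self]

end

/-! ### The graph in terms of swaps -/

/-- The eigenvalue `c` has multiplicity different from two; among the eigenvalues of an admissible
operator this means multiplicity at least three. -/
def Big (T : H →L[ℂ] H) (c : ℝ) : Prop := Module.rank ℂ (eigSpace T c) ≠ 2

section

variable {T : H →L[ℂ] H} (hT : Admissible T) {A B C D : conjClass T} {p q r s : ℙ ℂ H} {c d e : ℝ}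
include hT

theorem Admissible.sa (A : conjClass T) : IsSelfAdjoint (A : H →L[ℂ] H) :=
  isSelfAdjoint_of_mem hT.selfAdjoint A.2

theorem Admissible.fr (A : conjClass T) : FiniteRank (A : H →L[ℂ] H) :=
  finiteRank_of_mem hT.finiteRank A.2

theorem adj_iff : (commGraph T).Adj A B ↔ ∃ p q, Swap (A : H →L[ℂ] H) B p q := by
  constructor
  · intro h
    exact CommAdj.exists_swap hT.selfAdjoint hT.finiteRank A.2 B.2 h
  · rintro ⟨p, q, h⟩
    exact h.commAdj (hT.sa A)

theorem exists_vertex (hcd : c ≠ d) (hp : EigLine (A : H →L[ℂ] H) p c)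
    (hq : EigLine (A : H →L[ℂ] H) q d) : ∃ B : conjClass T, Swap (A : H →L[ℂ] H) B p q := by
  obtain ⟨B, hB⟩ := exists_swap hcd hp hq
  exact ⟨⟨B, conjClass_trans A.2 (hB.mem_conjClass (hT.sa A))⟩, hB⟩

theorem one_lt_rank (hp : EigLine (A : H →L[ℂ] H) p c) :
    1 < Module.rank ℂ (eigSpace (A : H →L[ℂ] H) c) := by
  have h1 := eigSpace_ne_bot_of_eigLine hp
  have h2 := rank_eigSpace_of_mem A.2 c
  rw [h2]
  apply hT.one_lt
  intro h0
  rw [h0, rank_bot] at h2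
  exact h1 (Submodule.rank_eq_zero.1 h2)

theorem exists_perp (hp : EigLine (A : H →L[ℂ] H) p c) :
    ∃ q, EigLine (A : H →L[ℂ] H) q c ∧ Perp p q := by
  obtain ⟨q, hq, h⟩ := exists_eigLine_inner (n := 1) (by simpa using one_lt_rank hT hp)
    (fun _ => p.rep)
  exact ⟨q, hq, h 0⟩

theorem Big.exists_perp (hc : Big T c) (hp : EigLine (A : H →L[ℂ] H) p c)
    (v w : ℙ ℂ H) : ∃ r, EigLine (A : H →L[ℂ] H) r c ∧ Perp v r ∧ Perp w r := by
  have h1 := one_lt_rank hT hp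
  have h2 : (2 : Cardinal) ≤ Module.rank ℂ (eigSpace (A : H →L[ℂ] H) c) :=
    Cardinal.two_le_iff_one_lt.2 h1
  have h3 : (2 : Cardinal) < Module.rank ℂ (eigSpace (A : H →L[ℂ] H) c) := by
    refine lt_of_le_of_ne h2 fun h => hc ?_
    rw [h, rank_eigSpace_of_mem A.2]
  obtain ⟨r, hr, h⟩ := exists_eigLine_inner (n := 2) (by exact_mod_cast h3) ![v.rep, w.rep]
  exact ⟨r, hr, h 0, h 1⟩

theorem perp_unique (hc : ¬ Big T c) (hp : EigLine (A : H →L[ℂ] H) p c)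
    (hq : EigLine (A : H →L[ℂ] H) q c) (hr : EigLine (A : H →L[ℂ] H) r c) (hpq : Perp p q)
    (hpr : Perp p r) : q = r :=
  perp_unique_of_rank_two (by rw [rank_eigSpace_of_mem A.2]; exact not_not.1 hc) hp hq hr hpq hpr

theorem eq_of_not_big (hc : ¬ Big T c) (hd : ¬ Big T d) : c = d :=
  hT.rank_two_unique c d (not_not.1 hc) (not_not.1 hd)

theorem exists_eigLine_of (A : conjClass T) (h : eigSpace T c ≠ ⊥) :
    ∃ p, EigLine (A : H →L[ℂ] H) p c := by
  apply exists_eigLine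
  intro h0
  have h2 := rank_eigSpace_of_mem A.2 c
  rw [h0, rank_bot] at h2
  exact h (Submodule.rank_eq_zero.1 h2.symm)

theorem EigLine.exists_in (hp : EigLine (A : H →L[ℂ] H) p c) (B : conjClass T) :
    ∃ q, EigLine (B : H →L[ℂ] H) q c := by
  apply exists_eigLine
  intro h0
  have h2 := rank_eigSpace_of_mem A.2 c
  rw [← rank_eigSpace_of_mem B.2 c, h0, rank_bot] at h2
  exact eigSpace_ne_bot_of_eigLine hp (Submodule.rank_eq_zero.1 h2)

theorem exists_eigLine_ne (A : conjClass T) (c : ℝ) :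
    ∃ d q, d ≠ c ∧ EigLine (A : H →L[ℂ] H) q d := by
  obtain ⟨d, e, hde, hd, he⟩ := hT.exists_ne
  by_cases h : d = c
  · obtain ⟨q, hq⟩ := exists_eigLine_of hT A he
    exact ⟨e, q, fun h' => hde (h.trans h'.symm), hq⟩
  · obtain ⟨q, hq⟩ := exists_eigLine_of hT A hd
    exact ⟨d, q, h, hq⟩

theorem vertex_unique (h : Swap (A : H →L[ℂ] H) B p q) (h' : Swap (A : H →L[ℂ] H) C p q) : B = C :=
  Subtype.ext (h.op_unique h')

/-- The neighbours of `A` adjacent to the neighbour obtained by swapping `p` and `q`. -/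
theorem adj_nbr_iff (hB : Swap (A : H →L[ℂ] H) B p q) (hp : EigLine (A : H →L[ℂ] H) p c)
    (hq : EigLine (A : H →L[ℂ] H) q d) :
    ((commGraph T).Adj A C ∧ (commGraph T).Adj B C) ↔
      (∃ l, Swap (A : H →L[ℂ] H) C l q ∧ Perp p l ∧ EigLine (A : H →L[ℂ] H) l c) ∨
      (∃ l, Swap (A : H →L[ℂ] H) C p l ∧ Perp q l ∧ EigLine (A : H →L[ℂ] H) l d) := by
  rw [adj_iff hT, adj_iff hT]
  constructor
  · rintro ⟨⟨r, s, h1⟩, ⟨x, y, h2⟩⟩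
    obtain ⟨z, l, m, e, k1, k2, k3, k4, k5⟩ := hB.exists_common (hT.sa A) (hT.sa B) h1 h2
    rcases hB.lines_eq (hT.sa A) k1 with ⟨rfl, rfl⟩ | ⟨rfl, rfl⟩
    · obtain rfl := hp.unique k4
      exact Or.inl ⟨m, k2, k3, k5⟩
    · obtain rfl := hq.unique k4
      exact Or.inr ⟨m, k2.symm, k3, k5⟩
  · rintro (⟨l, h1, h2, h3⟩ | ⟨l, h1, h2, h3⟩)
    · exact ⟨⟨l, q, h1⟩, ⟨p, l, hB.symm.trans_of_perp (hT.sa A) h1.symm hp h3 h2⟩⟩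
    · exact ⟨⟨p, l, h1⟩, ⟨q, l, hB.trans_of_perp (hT.sa A) h1 hq h3 h2⟩⟩

end

/-! ### Directions at a vertex -/

/-- Exactly two neighbours of `A` are adjacent to both `B` and `C`. This relation is preserved by
automorphisms. -/
def TwoCommon {T : H →L[ℂ] H} (A B C : conjClass T) : Prop :=
  ∃ D E, D ≠ E ∧ ∀ F, ((commGraph T).Adj A F ∧ (commGraph T).Adj B F ∧ (commGraph T).Adj C F) ↔
    (F = D ∨ F = E)

section

variable {T : H →L[ℂ] H} {A B C D : conjClass T} {p q r s : ℙ ℂ H} {c d e : ℝ}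

theorem TwoCommon.map (f : commGraph T ≃g commGraph T) (h : TwoCommon A B C) :
    TwoCommon (f A) (f B) (f C) := by
  obtain ⟨D, E, hDE, h⟩ := h
  refine ⟨f D, f E, f.injective.ne hDE, fun F => ?_⟩
  obtain ⟨F, rfl⟩ := f.surjective F
  rw [f.map_adj_iff, f.map_adj_iff, f.map_adj_iff, h, f.injective.eq_iff, f.injective.eq_iff]

theorem twoCommon_map_iff (f : commGraph T ≃g commGraph T) :
    TwoCommon (f A) (f B) (f C) ↔ TwoCommon A B C :=
  ⟨fun h => by simpa using h.map f.symm, fun h => h.map f⟩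

/-- The common neighbours of `{p, q}` and `{r, q}` are the pairs `{l, q}` with `l` orthogonal to `p`
and `r`; as soon as there are two of them, a third line in their span gives another one. -/
theorem not_twoCommon_of_same (hT : Admissible T) (hB : Swap (A : H →L[ℂ] H) B p q)
    (hC : Swap (A : H →L[ℂ] H) C r q) (hpr : p ≠ r) (hp : EigLine (A : H →L[ℂ] H) p c)
    (hr : EigLine (A : H →L[ℂ] H) r c) : ¬ TwoCommon A B C := by
  rintro ⟨D, E, hDE, h⟩
  have hA := hT.sa A
  obtain ⟨c', d, hcd, hp', hq, -⟩ := id hB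
  obtain rfl := hp.unique hp'
  have key : ∀ F, ((commGraph T).Adj A F ∧ (commGraph T).Adj B F ∧ (commGraph T).Adj C F) ↔
      ∃ l, Swap (A : H →L[ℂ] H) F l q ∧ Perp p l ∧ Perp r l ∧ EigLine (A : H →L[ℂ] H) l c := by
    intro F
    constructor
    · rintro ⟨h1, h2, h3⟩
      have k1 := (adj_nbr_iff hT hB hp hq).1 ⟨h1, h2⟩
      have k2 := (adj_nbr_iff hT hC hr hq).1 ⟨h1, h3⟩
      rcases k1 with ⟨l, a1, a2, a3⟩ | ⟨l, a1, a2, a3⟩ <;>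
      rcases k2 with ⟨m, b1, b2, b3⟩ | ⟨m, b1, b2, b3⟩ <;>
      rcases a1.lines_eq hA b1 with ⟨e1, e2⟩ | ⟨e1, e2⟩
      · subst e1; exact ⟨l, a1, a2, b2, a3⟩
      · exact absurd ((e1 ▸ a3 : EigLine (A : H →L[ℂ] H) q c).unique hq) hcd
      · exact absurd e2 b2.ne
      · subst e1; exact absurd (a3.unique b3) hcd
      · exact absurd e2.symm a2.ne
      · subst e1; exact absurd (hp.unique hq) hcd
      · exact absurd e1 hpr
      · subst e1; exact absurd (hp.unique b3) hcd
    · rintro ⟨l, h1, h2, h3, h4⟩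
      have k1 := (adj_nbr_iff hT hB hp hq).2 (Or.inl ⟨l, h1, h2, h4⟩)
      have k2 := (adj_nbr_iff hT hC hr hq).2 (Or.inl ⟨l, h1, h3, h4⟩)
      exact ⟨k1.1, k1.2, k2.2⟩
  obtain ⟨l, l1, l2, l3, l4⟩ := (key D).1 ((h D).2 (Or.inl rfl))
  obtain ⟨m, m1, m2, m3, m4⟩ := (key E).1 ((h E).2 (Or.inr rfl))
  have hlm : l ≠ m := by
    rintro rfl
    exact hDE (vertex_unique hT l1 m1)
  obtain ⟨n, hnl, hnm, hn, hn'⟩ := exists_third_line hlm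
  have n4 := hn' _ c l4 m4
  obtain ⟨F, hF⟩ := exists_vertex hT hcd n4 hq
  have hn4 : n ≠ q := by rintro rfl; exact hcd (n4.unique hq)
  rcases (h F).1 ((key F).2 ⟨n, hF, hn p l2 m2, hn r l3 m3, n4⟩) with rfl | rfl
  · rcases hF.lines_eq hA l1 with ⟨e1, e2⟩ | ⟨e1, e2⟩ <;> grind
  · rcases hF.lines_eq hA m1 with ⟨e1, e2⟩ | ⟨e1, e2⟩ <;> grind

/-- The common neighbours of `{r, q}` and `{p, s}` are `{p, q}` and `{r, s}`. -/
theorem twoCommon_of_diff (hT : Admissible T) (hB : Swap (A : H →L[ℂ] H) B r q)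
    (hC : Swap (A : H →L[ℂ] H) C p s) (hpr : Perp p r) (hqs : Perp q s)
    (hp : EigLine (A : H →L[ℂ] H) p c) (hr : EigLine (A : H →L[ℂ] H) r c)
    (hq : EigLine (A : H →L[ℂ] H) q d) (hs : EigLine (A : H →L[ℂ] H) s d) :
    TwoCommon A B C := by
  have hA := hT.sa A
  have hcd : c ≠ d := (hB.eq hr hq).1
  obtain ⟨D, hD⟩ := exists_vertex hT hcd hp hq
  obtain ⟨E, hE⟩ := exists_vertex hT hcd hr hs
  have hne : ∀ {l m}, EigLine (A : H →L[ℂ] H) l c → EigLine (A : H →L[ℂ] H) m d → l ≠ m := by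
    rintro l m h1 h2 rfl
    exact hcd (h1.unique h2)
  have hpr' := hpr.ne
  have hqs' := hqs.ne
  refine ⟨D, E, ?_, fun F => ⟨?_, ?_⟩⟩
  · rintro rfl
    have := hne hp hs
    rcases hD.lines_eq hA hE with ⟨e1, e2⟩ | ⟨e1, e2⟩ <;> grind
  · rintro ⟨h1, h2, h3⟩
    have k1 := (adj_nbr_iff hT hB hr hq).1 ⟨h1, h2⟩
    have k2 := (adj_nbr_iff hT hC hp hs).1 ⟨h1, h3⟩
    rcases k1 with ⟨l, a1, a2, a3⟩ | ⟨l, a1, a2, a3⟩ <;>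
    rcases k2 with ⟨m, b1, b2, b3⟩ | ⟨m, b1, b2, b3⟩ <;>
    rcases a1.lines_eq hA b1 with ⟨e1, e2⟩ | ⟨e1, e2⟩
    · exact absurd e2 hqs'
    · exact absurd e1 (hne a3 hs)
    · subst e1; exact Or.inl (vertex_unique hT a1 hD)
    · exact absurd e1 (hne a3 b3)
    · subst e2; exact Or.inr (vertex_unique hT a1 hE)
    · exact absurd e1 (hne hr hs)
    · exact absurd e1.symm hpr'
    · exact absurd e1 (hne hr b3)
  · rintro (rfl | rfl)
    · have k1 := (adj_nbr_iff hT hB hr hq).2 (Or.inl ⟨p, hD, hpr.symm, hp⟩)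
      have k2 := (adj_nbr_iff hT hC hp hs).2 (Or.inr ⟨q, hD, hqs.symm, hq⟩)
      exact ⟨k1.1, k1.2, k2.2⟩
    · have k1 := (adj_nbr_iff hT hB hr hq).2 (Or.inr ⟨s, hE, hqs, hs⟩)
      have k2 := (adj_nbr_iff hT hC hp hs).2 (Or.inl ⟨r, hE, hpr, hr⟩)
      exact ⟨k1.1, k1.2, k2.2⟩

end

/-! ### Automorphisms preserve directions -/

section

variable {T : H →L[ℂ] H} {A B C D E : conjClass T} {p p' p'' q q' r s x x' y y' z : ℙ ℂ H}
  {c d e k k' : ℝ}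

theorem perp_of_adj_common (hT : Admissible T) (hB : Swap (A : H →L[ℂ] H) B p q)
    (hC : Swap (A : H →L[ℂ] H) C r q) (hBC : (commGraph T).Adj B C)
    (hp : EigLine (A : H →L[ℂ] H) p c) : Perp p r ∧ EigLine (A : H →L[ℂ] H) r c := by
  obtain ⟨x, y, h⟩ := (adj_iff hT).1 hBC
  exact hB.symm.perp_of_common (hT.sa A) (hT.sa B) hC.symm h hp

theorem adj_of_common (hT : Admissible T) (hB : Swap (A : H →L[ℂ] H) B p q)
    (hC : Swap (A : H →L[ℂ] H) C r q) (hpr : Perp p r)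
    (hp : EigLine (A : H →L[ℂ] H) p c) (hr : EigLine (A : H →L[ℂ] H) r c) :
    (commGraph T).Adj B C :=
  (adj_iff hT).2 ⟨_, _, hB.symm.trans_of_perp (hT.sa A) hC.symm hp hr hpr⟩

variable (f : commGraph T ≃g commGraph T)

/-- Neighbours of `A` that differ in different lines are sent to such neighbours. -/
theorem map_diff (hT : Admissible T) (hB : Swap (A : H →L[ℂ] H) B p q)
    (hC : Swap (A : H →L[ℂ] H) C p' q) (hD : Swap (A : H →L[ℂ] H) D p q')
    (hpp : Perp p p') (hqq : Perp q q')
    (hp : EigLine (A : H →L[ℂ] H) p c) (hp' : EigLine (A : H →L[ℂ] H) p' c)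
    (hq : EigLine (A : H →L[ℂ] H) q d) (hq' : EigLine (A : H →L[ℂ] H) q' d)
    (hfB : Swap (f A : H →L[ℂ] H) (f B) x y) (hfC : Swap (f A : H →L[ℂ] H) (f C) x' y) :
    ∃ y₂ e, Swap (f A : H →L[ℂ] H) (f D) x y₂ ∧ Perp y y₂ ∧ EigLine (f A : H →L[ℂ] H) y e ∧
      EigLine (f A : H →L[ℂ] H) y₂ e := by
  have hBC := adj_of_common hT hB hC hpp hp hp'
  have hBD := adj_of_common hT hB.symm hD.symm hqq hq hq'
  have hT2 : TwoCommon A C D := twoCommon_of_diff hT hC hD hpp hqq hp hp' hq hq'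
  have hAD : (commGraph T).Adj A D := (adj_iff hT).2 ⟨_, _, hD⟩
  obtain ⟨k, e, hke, hx, hy, -⟩ := id hfB
  obtain ⟨hxx, hx'⟩ := perp_of_adj_common hT hfB hfC (f.map_adj_iff.2 hBC) hx
  rcases (adj_nbr_iff hT hfB hx hy).1 ⟨f.map_adj_iff.2 hAD, f.map_adj_iff.2 hBD⟩ with
    ⟨l, h1, h2, h3⟩ | ⟨l, h1, h2, h3⟩
  · exfalso
    refine not_twoCommon_of_same hT hfC h1 ?_ hx' h3 ((twoCommon_map_iff f).2 hT2)
    rintro rfl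
    have hCD : C = D := f.injective (vertex_unique hT hfC h1)
    subst hCD
    have := hpp.ne
    have := hqq.ne
    rcases hC.lines_eq (hT.sa A) hD with ⟨e1, e2⟩ | ⟨e1, e2⟩
    · grind
    · exact hB.ne (hT.sa A) e2.symm
  · exact ⟨l, e, h1, h2, hy, h3⟩

/-- Neighbours of `A` that differ only in lines of one eigenspace are sent to such neighbours. -/
theorem map_same (hT : Admissible T) (hB : Swap (A : H →L[ℂ] H) B p q)
    (hC : Swap (A : H →L[ℂ] H) C p' q) (hD : Swap (A : H →L[ℂ] H) D p'' q)
    (hpp' : Perp p p') (hpp'' : Perp p p'')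
    (hp : EigLine (A : H →L[ℂ] H) p c) (hp' : EigLine (A : H →L[ℂ] H) p' c)
    (hp'' : EigLine (A : H →L[ℂ] H) p'' c)
    (hfB : Swap (f A : H →L[ℂ] H) (f B) x y) (hfC : Swap (f A : H →L[ℂ] H) (f C) x' y)
    (hx : EigLine (f A : H →L[ℂ] H) x k) :
    ∃ x₂, Swap (f A : H →L[ℂ] H) (f D) x₂ y ∧ Perp x x₂ ∧ EigLine (f A : H →L[ℂ] H) x₂ k := by
  have hBC := adj_of_common hT hB hC hpp' hp hp'
  have hBD := adj_of_common hT hB hD hpp'' hp hp''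
  have hAD : (commGraph T).Adj A D := (adj_iff hT).2 ⟨_, _, hD⟩
  obtain ⟨k', e, hke, hxk, hy, -⟩ := id hfB
  obtain rfl := hx.unique hxk
  obtain ⟨hxx, hx'⟩ := perp_of_adj_common hT hfB hfC (f.map_adj_iff.2 hBC) hx
  by_cases hne : p' = p''
  · subst hne
    obtain rfl := vertex_unique hT hC hD
    exact ⟨x', hfC, hxx, hx'⟩
  rcases (adj_nbr_iff hT hfB hx hy).1 ⟨f.map_adj_iff.2 hAD, f.map_adj_iff.2 hBD⟩ with
    ⟨l, h1, h2, h3⟩ | ⟨l, h1, h2, h3⟩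
  · exact ⟨l, h1, h2, h3⟩
  · exfalso
    exact not_twoCommon_of_same hT hC hD hne hp' hp''
      ((twoCommon_map_iff f).1 (twoCommon_of_diff hT hfC h1 hxx h2 hx hx' hy h3))

/-- The swaps of `q` with the eigenlines for `c` are sent to swaps of one line `y` with eigenlines
for `k`; the line `y` is said to govern the fibre over `q`. -/
def IsFiber (A : conjClass T) (q : ℙ ℂ H) (c : ℝ) (y : ℙ ℂ H) (k : ℝ) : Prop :=
  (∃ e, e ≠ k ∧ EigLine (f A : H →L[ℂ] H) y e) ∧
  ∀ p (B : conjClass T), EigLine (A : H →L[ℂ] H) p c → Swap (A : H →L[ℂ] H) B p q →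
    ∃ x, EigLine (f A : H →L[ℂ] H) x k ∧ Swap (f A : H →L[ℂ] H) (f B) x y

theorem exists_isFiber (hT : Admissible T) (hc : Big T c) (hq : EigLine (A : H →L[ℂ] H) q d)
    (hcd : c ≠ d) (hp : EigLine (A : H →L[ℂ] H) p c) : ∃ y k, IsFiber f A q c y k := by
  obtain ⟨p', hp', hpp'⟩ := exists_perp hT hp
  obtain ⟨B, hB⟩ := exists_vertex hT hcd hp hq
  obtain ⟨C, hC⟩ := exists_vertex hT hcd hp' hq
  have hBC := adj_of_common hT hB hC hpp' hp hp'
  have hAB : (commGraph T).Adj A B := (adj_iff hT).2 ⟨_, _, hB⟩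
  have hAC : (commGraph T).Adj A C := (adj_iff hT).2 ⟨_, _, hC⟩
  obtain ⟨x₀, y₀, hfB⟩ := (adj_iff hT).1 (f.map_adj_iff.2 hAB)
  obtain ⟨x₁, y₁, hfC⟩ := (adj_iff hT).1 (f.map_adj_iff.2 hAC)
  obtain ⟨x₂, y₂, hfBC⟩ := (adj_iff hT).1 (f.map_adj_iff.2 hBC)
  obtain ⟨y, x, x', k, hB', hC', hxx, hx, hx'⟩ :=
    hfB.exists_common (hT.sa _) (hT.sa _) hfC hfBC
  obtain ⟨k', e, hke, hxk, hy, -⟩ := id hB'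
  obtain rfl := hx.unique hxk
  refine ⟨y, k, ⟨e, hke.symm, hy⟩, fun r D hr hD => ?_⟩
  -- the orthogonality graph of the eigenspace has diameter two
  obtain ⟨s, hs, hps, hrs⟩ := hc.exists_perp hT hp p r
  obtain ⟨E, hE⟩ := exists_vertex hT hcd hs hq
  obtain ⟨xs, hfE, hxxs, hxs⟩ := map_same f hT hB hC hE hpp' hps hp hp' hs hB' hC' hx
  obtain ⟨xr, hfD, -, hxr⟩ := map_same f hT hE hB hD hps.symm hrs.symm hs hp hr hfE hB' hxs
  exact ⟨xr, hxr, hfD⟩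

variable {f}

/-- The lines governing the fibres over orthogonal eigenlines for the same eigenvalue are orthogonal
eigenlines for the same eigenvalue, and the partners in the two fibres are equal. -/
theorem IsFiber.perp (hT : Admissible T) (hF : IsFiber f A q c y k) (hF' : IsFiber f A q' c y' k')
    (hqq : Perp q q') (hq : EigLine (A : H →L[ℂ] H) q d) (hq' : EigLine (A : H →L[ℂ] H) q' d)
    (hp : EigLine (A : H →L[ℂ] H) p c)
    (hB : Swap (A : H →L[ℂ] H) B p q) (hD : Swap (A : H →L[ℂ] H) D p q')
    (hfB : Swap (f A : H →L[ℂ] H) (f B) x y) (hfD : Swap (f A : H →L[ℂ] H) (f D) x' y') :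
    x = x' ∧ Perp y y' ∧ ∃ e, EigLine (f A : H →L[ℂ] H) y e ∧ EigLine (f A : H →L[ℂ] H) y' e := by
  have hcd := (hB.eq hp hq).1
  obtain ⟨p', hp', hpp⟩ := exists_perp hT hp
  obtain ⟨C, hC⟩ := exists_vertex hT hcd hp' hq
  obtain ⟨C', hC'⟩ := exists_vertex hT hcd hp' hq'
  obtain ⟨x₁, -, hfC⟩ := hF.2 p' C hp' hC
  obtain ⟨x₁', -, hfC'⟩ := hF'.2 p' C' hp' hC'
  obtain ⟨y₂, e, h1, h2, h3, h4⟩ := map_diff f hT hB hC hD hpp hqq hp hp' hq hq' hfB hfC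
  obtain ⟨y₃, e', h1', h2', h3', h4'⟩ :=
    map_diff f hT hD hC' hB hpp hqq.symm hp hp' hq' hq hfD hfC'
  have hA := hT.sa (f A)
  have n1 := h2.ne
  have n2 := h2'.ne
  have n3 := hfB.ne hA
  have n4 := hfD.ne hA
  have e1 : x = x' ∧ y₂ = y' := by
    rcases h1.lines_eq hA hfD with ⟨a1, a2⟩ | ⟨a1, a2⟩
    · exact ⟨a1, a2⟩
    · rcases h1'.lines_eq hA hfB with ⟨b1, b2⟩ | ⟨b1, b2⟩ <;> grind
  obtain ⟨rfl, rfl⟩ := e1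
  exact ⟨rfl, h2, e, h3, h4⟩

/-- For a two-dimensional eigenspace the image eigenspace has no further lines orthogonal to `y`. -/
theorem IsFiber.eq_of_perp (hT : Admissible T) (hd : ¬ Big T d) (hF : IsFiber f A q c y k)
    (hF' : IsFiber f A q' c y' k') (hqq : Perp q q') (hq : EigLine (A : H →L[ℂ] H) q d)
    (hq' : EigLine (A : H →L[ℂ] H) q' d) (hcd : c ≠ d) (hp : EigLine (A : H →L[ℂ] H) p c)
    (hyz : Perp y z) (hy : EigLine (f A : H →L[ℂ] H) y e) (hz : EigLine (f A : H →L[ℂ] H) z e) :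
    z = y' := by
  have hA := hT.sa (f A)
  obtain ⟨B, hB⟩ := exists_vertex hT hcd hp hq
  obtain ⟨D, hD⟩ := exists_vertex hT hcd hp hq'
  obtain ⟨x, hx, hfB⟩ := hF.2 p B hp hB
  obtain ⟨x', hx', hfD⟩ := hF'.2 p D hp hD
  obtain ⟨rfl, -, -⟩ := hF.perp hT hF' hqq hq hq' hp hB hD hfB hfD
  have hke := (hfB.eq hx hy).1
  obtain ⟨W, hW⟩ := exists_vertex hT hke hx hz
  obtain ⟨E, rfl⟩ := f.surjective W
  have h1 : (commGraph T).Adj A E := f.map_adj_iff.1 ((adj_iff hT).2 ⟨_, _, hW⟩)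
  have h2 : (commGraph T).Adj B E :=
    f.map_adj_iff.1 (adj_of_common hT hfB.symm hW.symm hyz hy hz)
  rcases (adj_nbr_iff hT hB hp hq).1 ⟨h1, h2⟩ with ⟨l, a1, a2, a3⟩ | ⟨l, a1, a2, a3⟩
  · obtain ⟨x₂, -, h3⟩ := hF.2 l E a3 a1
    have n1 := hyz.ne
    have n2 := hfB.ne hA
    rcases h3.lines_eq hA hW with ⟨b1, b2⟩ | ⟨b1, b2⟩ <;> grind
  · obtain rfl := perp_unique hT hd hq a3 hq' a2 hqq
    obtain rfl := vertex_unique hT hD a1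
    rcases hW.lines_eq hA hfD with ⟨b1, b2⟩ | ⟨b1, b2⟩
    · exact b2
    · exact absurd b1 (hfD.ne hA)

theorem IsFiber.not_big (hT : Admissible T) (hd : ¬ Big T d) (hF : IsFiber f A q c y k)
    (hF' : IsFiber f A q' c y' k') (hqq : Perp q q') (hq : EigLine (A : H →L[ℂ] H) q d)
    (hq' : EigLine (A : H →L[ℂ] H) q' d) (hcd : c ≠ d) (hp : EigLine (A : H →L[ℂ] H) p c)
    (hy : EigLine (f A : H →L[ℂ] H) y e) : ¬ Big T e := by
  intro he
  obtain ⟨z, hz, h1, h2⟩ := he.exists_perp hT hy y y'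
  exact h2.ne (hF.eq_of_perp hT hd hF' hqq hq hq' hcd hp h1 hy hz).symm

/-- After swapping `p` and `q`, the fibre over `p` is governed by the partner of the line
governing the fibre over `q`. -/
theorem IsFiber.swap (hT : Admissible T) (hF : IsFiber f A q c y k)
    (hp : EigLine (A : H →L[ℂ] H) p c) (hC : Swap (A : H →L[ℂ] H) C p q)
    (hF' : IsFiber f C p c y' k') (hfC : Swap (f A : H →L[ℂ] H) (f C) x y) : y' = x := by
  have hA := hT.sa A
  have hfA := hT.sa (f A)
  have hfCs := hT.sa (f C)
  obtain ⟨p', hp', hpp⟩ := exists_perp hT hp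
  obtain ⟨c', d, hcd, hpc, hq, -⟩ := id hC
  obtain rfl := hp.unique hpc
  obtain ⟨C', hC'⟩ := exists_vertex hT hcd hp' hq
  obtain ⟨x', hx', hfC'⟩ := hF.2 p' C' hp' hC'
  have hCC : Swap (C : H →L[ℂ] H) C' p p' := hC.symm.trans_of_perp hA hC'.symm hp hp' hpp
  have hadj := adj_of_common hT hC hC' hpp hp hp'
  obtain ⟨e, _, _, hx, -, -⟩ := id hfC
  obtain ⟨hxx, hxe⟩ := perp_of_adj_common hT hfC hfC' (f.map_adj_iff.2 hadj) hx
  have hfCC : Swap (f C : H →L[ℂ] H) (f C') x x' :=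
    hfC.symm.trans_of_perp hfA hfC'.symm hx hxe hxx
  have hq2 : EigLine (C : H →L[ℂ] H) q c := hC.eigLine_right hA hp
  have hp2 : EigLine (C : H →L[ℂ] H) p' c := hC.eigLine_of_perp hp' hpp (hC'.perp hA).symm
  obtain ⟨x₂, -, h2⟩ := hF'.2 q A hq2 (hC.rev hA).symm
  obtain ⟨x₃, -, h3⟩ := hF'.2 p' C' hp2 hCC.symm
  have n1 := hfC'.ne hfA
  rcases h2.lines_eq hfCs (hfC.rev hfA) with ⟨a1, a2⟩ | ⟨a1, a2⟩ <;>
  rcases h3.lines_eq hfCs hfCC with ⟨b1, b2⟩ | ⟨b1, b2⟩ <;> grind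

/-- The line governing a fibre does not change when a line orthogonal to `p` in a two-dimensional
eigenspace is swapped away. -/
theorem IsFiber.eq_of_swap (hT : Admissible T) (hc : Big T c) (hd : ¬ Big T d)
    (hp : EigLine (A : H →L[ℂ] H) p d) (hq : EigLine (A : H →L[ℂ] H) q d) (hpq : Perp p q)
    (hs : EigLine (A : H →L[ℂ] H) s c) (hB : Swap (A : H →L[ℂ] H) B s q)
    (hF : IsFiber f A p c y k) (hF' : IsFiber f B p c y' k') : y = y' := by
  have hA := hT.sa A
  have hfA := hT.sa (f A)
  have hcd := (hB.eq hs hq).1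
  have hps : Perp p s := hp.perp hA hcd.symm hs
  obtain ⟨w, k₁, hFq⟩ := exists_isFiber f hT hc hq hcd hs
  obtain ⟨t, ht⟩ := hs.exists_in hT B
  have hsB : EigLine (B : H →L[ℂ] H) s d := hB.eigLine_left hA hq
  have hpB : EigLine (B : H →L[ℂ] H) p d := hB.eigLine_of_perp hp hps.symm hpq.symm
  obtain ⟨y₃, k₂, hFs⟩ := exists_isFiber f hT hc hsB hcd ht
  obtain ⟨x, hx, hfB⟩ := hFq.2 s B hs hB
  obtain rfl := hFq.swap hT hs hB hFs hfB
  obtain ⟨D, hD⟩ := exists_vertex hT hcd hs hp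
  obtain ⟨x₁, hx₁, hfD⟩ := hF.2 s D hs hD
  obtain ⟨rfl, hyw, e, hy, hw⟩ := hF.perp hT hFq hpq hp hq hs hD hB hfD hfB
  have h1 : EigLine (f B : H →L[ℂ] H) x₁ e := hfB.eigLine_left hfA hw
  have h2 : EigLine (f B : H →L[ℂ] H) y e :=
    hfB.eigLine_of_perp hy (hfD.perp hfA) hyw.symm
  exact hFs.eq_of_perp hT hd hF' hps.symm hsB hpB hcd ht (hfD.perp hfA) h1 h2

/-- The projections on two orthogonal lines of a two-dimensional eigenspace add up to the projection
on this eigenspace, whichever lines are taken. -/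
theorem linePr_add_eq (hT : Admissible T) (hd : ¬ Big T d) {q₁ q₁' : ℙ ℂ H}
    (hq : EigLine (A : H →L[ℂ] H) q d) (hq' : EigLine (A : H →L[ℂ] H) q' d)
    (hq₁ : EigLine (A : H →L[ℂ] H) q₁ d) (hq₁' : EigLine (A : H →L[ℂ] H) q₁' d)
    (hqq : Perp q q') (hqq₁ : Perp q₁ q₁') :
    linePr q + linePr q' = linePr q₁ + linePr q₁' := by
  have key : ∀ {a b r : ℙ ℂ H}, EigLine (A : H →L[ℂ] H) a d → EigLine (A : H →L[ℂ] H) b d →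
      EigLine (A : H →L[ℂ] H) r d → Perp a b → linePr a r.rep + linePr b r.rep = r.rep := by
    intro a b r ha hb hr hab
    by_contra hne
    set v := r.rep - (linePr a r.rep + linePr b r.rep) with hv
    have hv0 : v ≠ 0 := fun h => hne (sub_eq_zero.1 h).symm
    obtain ⟨α, hα⟩ := linePr_smul_rep a r.rep
    obtain ⟨β, hβ⟩ := linePr_smul_rep b r.rep
    have h1 : Perp a (Projectivization.mk ℂ v hv0) := by
      rw [perp_mk_right, hv, inner_sub_right, inner_add_right, inner_rep_linePr, hβ,
        inner_smul_right, hab]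
      simp
    have h2 : Perp b (Projectivization.mk ℂ v hv0) := by
      rw [perp_mk_right, hv, inner_sub_right, inner_add_right, inner_rep_linePr, hα,
        inner_smul_right, hab.symm]
      simp
    have h3 : EigLine (A : H →L[ℂ] H) (Projectivization.mk ℂ v hv0) d := by
      rw [eigLine_mk, hv, hα, hβ, map_sub, map_add, map_smul, map_smul, hr, ha, hb]
      module
    exact h2.ne (perp_unique hT hd ha hb h3 hab h1)
  refine ext_of_lines hqq ?_ ?_ ?_
  · rw [add_apply, add_apply, key hq₁ hq₁' hq hqq₁, key hq hq' hq hqq]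
  · rw [add_apply, add_apply, key hq₁ hq₁' hq' hqq₁, key hq hq' hq' hqq]
  · intro w h1 h2
    have h3 : ∀ {r : ℙ ℂ H}, EigLine (A : H →L[ℂ] H) r d → linePr r w = 0 := by
      intro r hr
      apply linePr_eq_zero
      obtain ⟨α, hα⟩ := linePr_smul_rep q r.rep
      obtain ⟨β, hβ⟩ := linePr_smul_rep q' r.rep
      rw [← key hq hq' hr hqq, inner_add_left, hα, hβ, inner_smul_left, inner_smul_left, h1, h2]
      simp
    rw [add_apply, add_apply, h3 hq, h3 hq', h3 hq₁, h3 hq₁']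

/-- The partner of the line governing a fibre depends only on the eigenline swapped with it. This is
the one place where vertices at distance two from `A` are used: in a two-dimensional eigenspace the
orthogonality relation of lines is not connected. -/
theorem IsFiber.partner_eq (hT : Admissible T) (hc : Big T c) (hd : ¬ Big T d) {q₁ x₁ y₁ : ℙ ℂ H}
    {k₁ : ℝ} (hq : EigLine (A : H →L[ℂ] H) q d) (hq₁ : EigLine (A : H →L[ℂ] H) q₁ d)
    (hp : EigLine (A : H →L[ℂ] H) p c) (hB : Swap (A : H →L[ℂ] H) B p q)
    (hC : Swap (A : H →L[ℂ] H) C p q₁) (hF : IsFiber f A q c y k) (hF₁ : IsFiber f A q₁ c y₁ k₁)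
    (hfB : Swap (f A : H →L[ℂ] H) (f B) x y) (hfC : Swap (f A : H →L[ℂ] H) (f C) x₁ y₁) :
    x = x₁ := by
  have hA := hT.sa A
  obtain ⟨q', hq', hqq⟩ := exists_perp hT hq
  obtain ⟨q₁', hq₁', hqq₁⟩ := exists_perp hT hq₁
  obtain ⟨s, hs, hps⟩ := exists_perp hT hp
  have hcd := (hB.eq hp hq).1
  have aux : ∀ {q q'} {B : conjClass T}, EigLine (A : H →L[ℂ] H) q d →
      EigLine (A : H →L[ℂ] H) q' d → Perp q q' → Swap (A : H →L[ℂ] H) B p q →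
      EigLine (B : H →L[ℂ] H) s c ∧ EigLine (B : H →L[ℂ] H) q' d ∧
      EigLine (B : H →L[ℂ] H) p d := by
    intro q q' B hq hq' hqq hB
    exact ⟨hB.eigLine_of_perp hs hps (hq.perp hA hcd.symm hs),
      hB.eigLine_of_perp hq' (hp.perp hA hcd hq') hqq, hB.eigLine_left hA hq⟩
  obtain ⟨sB, qB, pB⟩ := aux hq hq' hqq hB
  obtain ⟨sC, qC, pC⟩ := aux hq₁ hq₁' hqq₁ hC
  obtain ⟨B', hB'⟩ := exists_vertex hT hcd sB qB
  obtain ⟨C', hC'⟩ := exists_vertex hT hcd sC qC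
  -- exchanging `p` and `q`, then `s` and `q'`, replaces the plane of `q` and `q'` by that of `p`
  -- and `s`, and therefore has the same result for any other orthogonal basis of the former plane
  have hBC : B' = C' := by
    apply Subtype.ext
    rw [(hB'.eq sB qB).2, (hC'.eq sC qC).2, (hB.eq hp hq).2, (hC.eq hp hq₁).2]
    have h1 := linePr_add_eq hT hd hq hq' hq₁ hq₁' hqq hqq₁
    have h2 : linePr q' = linePr q₁ + linePr q₁' - linePr q := by rw [← h1]; abel
    rw [h2]
    module
  subst hBC
  obtain ⟨t, ht⟩ := hp.exists_in hT B'
  have pB' : EigLine (B' : H →L[ℂ] H) p d :=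
    hB'.eigLine_of_perp pB hps.symm (hp.perp hA hcd hq').symm
  obtain ⟨y₂, k₂, hF₂⟩ := exists_isFiber f hT hc pB' hcd ht
  obtain ⟨y₃, k₃, hF₃⟩ := exists_isFiber f hT hc pB hcd sB
  obtain ⟨y₄, k₄, hF₄⟩ := exists_isFiber f hT hc pC hcd sC
  have e1 := hF.swap hT hp hB hF₃ hfB
  have e2 := hF₁.swap hT hp hC hF₄ hfC
  have e3 := hF₃.eq_of_swap hT hc hd pB qB (hp.perp hA hcd hq') sB hB' hF₂
  have e4 := hF₄.eq_of_swap hT hc hd pC qC (hp.perp hA hcd hq₁') sC hC' hF₂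
  rw [← e1, ← e2, e3, e4]

/-! ### The line maps of a pair of eigenspaces -/

variable (f) in
/-- `φ` describes the action of `f` on the swaps of eigenlines of `A` for `c` with eigenlines
for `d`; the images are eigenlines of `f A` for `c'` and `d'`. -/
structure PairMap (A : conjClass T) (c d : ℝ) (φ : ℙ ℂ H → ℙ ℂ H) (c' d' : ℝ) : Prop where
  ne : c' ≠ d'
  left : ∀ p, EigLine (A : H →L[ℂ] H) p c → EigLine (f A : H →L[ℂ] H) (φ p) c'
  right : ∀ q, EigLine (A : H →L[ℂ] H) q d → EigLine (f A : H →L[ℂ] H) (φ q) d'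
  map : ∀ p q (B : conjClass T), EigLine (A : H →L[ℂ] H) p c → EigLine (A : H →L[ℂ] H) q d →
    Swap (A : H →L[ℂ] H) B p q → Swap (f A : H →L[ℂ] H) (f B) (φ p) (φ q)

theorem PairMap.symm {φ : ℙ ℂ H → ℙ ℂ H} {c' d' : ℝ} (h : PairMap f A c d φ c' d') :
    PairMap f A d c φ d' c' :=
  ⟨h.ne.symm, h.right, h.left, fun p q B hp hq hB => (h.map q p B hq hp hB.symm).symm⟩

theorem exists_pairMap_big_big (hT : Admissible T) (hc : Big T c) (hd : Big T d) (hcd : c ≠ d)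
    (hp : EigLine (A : H →L[ℂ] H) p c) (hq : EigLine (A : H →L[ℂ] H) q d) :
    ∃ φ c' d', PairMap f A c d φ c' d' := by
  classical
  have hA := hT.sa (f A)
  have h1 : ∀ r, ∃ y k, EigLine (A : H →L[ℂ] H) r d → IsFiber f A r c y k := fun r => by
    by_cases hr : EigLine (A : H →L[ℂ] H) r d
    · obtain ⟨y, k, h⟩ := exists_isFiber f hT hc hr hcd hp
      exact ⟨y, k, fun _ => h⟩
    · exact ⟨r, c, fun h => absurd h hr⟩
  have h2 : ∀ r, ∃ y k, EigLine (A : H →L[ℂ] H) r c → IsFiber f A r d y k := fun r => by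
    by_cases hr : EigLine (A : H →L[ℂ] H) r c
    · obtain ⟨y, k, h⟩ := exists_isFiber f hT hd hr hcd.symm hq
      exact ⟨y, k, fun _ => h⟩
    · exact ⟨r, c, fun h => absurd h hr⟩
  choose y k hy using h1
  choose x m hx using h2
  have key : ∀ r s (B : conjClass T), EigLine (A : H →L[ℂ] H) r c → EigLine (A : H →L[ℂ] H) s d →
      Swap (A : H →L[ℂ] H) B r s → Swap (f A : H →L[ℂ] H) (f B) (x r) (y s) ∧
      EigLine (f A : H →L[ℂ] H) (x r) (k s) ∧ EigLine (f A : H →L[ℂ] H) (y s) (m r) := by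
    intro r s B hr hs hB
    obtain ⟨r', hr', hrr⟩ := exists_perp hT hr
    obtain ⟨s', hs', hss⟩ := exists_perp hT hs
    obtain ⟨C, hC⟩ := exists_vertex hT hcd hr' hs
    obtain ⟨D, hD⟩ := exists_vertex hT hcd hr hs'
    obtain ⟨a, ha, hfB⟩ := (hy s hs).2 r B hr hB
    obtain ⟨a', ha', hfC⟩ := (hy s hs).2 r' C hr' hC
    obtain ⟨y₂, e, h3, h4, h5, h6⟩ := map_diff f hT hB hC hD hrr hss hr hr' hs hs' hfB hfC
    obtain ⟨b, hb, hfB'⟩ := (hx r hr).2 s B hs hB.symm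
    obtain ⟨b', hb', hfD⟩ := (hx r hr).2 s' D hs' hD.symm
    have n1 := h4.ne
    have n2 := hfB.ne hA
    have e1 : x r = a ∧ b = y s := by
      rcases hfB'.lines_eq hA hfB with ⟨a1, a2⟩ | ⟨a1, a2⟩
      · rcases hfD.lines_eq hA h3 with ⟨b1, b2⟩ | ⟨b1, b2⟩ <;> grind
      · exact ⟨a2, a1⟩
    obtain ⟨rfl, rfl⟩ := e1
    exact ⟨hfB, ha, hb⟩
  have hyx : ∀ r s, EigLine (A : H →L[ℂ] H) r c → EigLine (A : H →L[ℂ] H) s d →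
      EigLine (f A : H →L[ℂ] H) (x r) (k s) ∧ EigLine (f A : H →L[ℂ] H) (y s) (m r) := by
    intro r s hr hs
    obtain ⟨B, hB⟩ := exists_vertex hT hcd hr hs
    exact (key r s B hr hs hB).2
  have hne : ∀ {r}, EigLine (A : H →L[ℂ] H) r d → ¬ EigLine (A : H →L[ℂ] H) r c :=
    fun h3 h4 => hcd (h4.unique h3)
  refine ⟨fun r => if EigLine (A : H →L[ℂ] H) r c then x r else y r, k q, m p, ?_, ?_, ?_, ?_⟩
  · obtain ⟨B, hB⟩ := exists_vertex hT hcd hp hq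
    obtain ⟨h3, h4, h5⟩ := key p q B hp hq hB
    exact (h3.eq h4 h5).1
  · intro r hr
    rw [if_pos hr]
    exact (hyx r q hr hq).1
  · intro s hs
    rw [if_neg (hne hs)]
    exact (hyx p s hp hs).2
  · intro r s B hr hs hB
    rw [if_pos hr, if_neg (hne hs)]
    exact (key r s B hr hs hB).1

theorem exists_pairMap_big_small (hT : Admissible T) (hc : Big T c) (hd : ¬ Big T d) (hcd : c ≠ d)
    (hp : EigLine (A : H →L[ℂ] H) p c) (hq : EigLine (A : H →L[ℂ] H) q d) :
    ∃ φ c' d', PairMap f A c d φ c' d' := by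
  classical
  have h1 : ∀ r, ∃ y k, EigLine (A : H →L[ℂ] H) r d → IsFiber f A r c y k := fun r => by
    by_cases hr : EigLine (A : H →L[ℂ] H) r d
    · obtain ⟨y, k, h⟩ := exists_isFiber f hT hc hr hcd hp
      exact ⟨y, k, fun _ => h⟩
    · exact ⟨r, c, fun h => absurd h hr⟩
  choose y k hy using h1
  have h2 : ∀ r, ∃ x, EigLine (A : H →L[ℂ] H) r c → EigLine (f A : H →L[ℂ] H) x (k q) ∧
      ∃ B : conjClass T, Swap (A : H →L[ℂ] H) B r q ∧
        Swap (f A : H →L[ℂ] H) (f B) x (y q) := fun r => by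
    by_cases hr : EigLine (A : H →L[ℂ] H) r c
    · obtain ⟨B, hB⟩ := exists_vertex hT hcd hr hq
      obtain ⟨x, hx, h⟩ := (hy q hq).2 r B hr hB
      exact ⟨x, fun _ => ⟨hx, B, hB, h⟩⟩
    · exact ⟨r, fun h => absurd h hr⟩
  choose x hx using h2
  obtain ⟨⟨m, hmk, hm⟩, -⟩ := hy q hq
  have hnb : ∀ {s e}, EigLine (A : H →L[ℂ] H) s d → EigLine (f A : H →L[ℂ] H) (y s) e →
      ¬ Big T e := by
    intro s e hs he
    obtain ⟨s', hs', hss⟩ := exists_perp hT hs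
    exact (hy s hs).not_big hT hd (hy s' hs') hss hs hs' hcd hp he
  have hne : ∀ {r}, EigLine (A : H →L[ℂ] H) r d → ¬ EigLine (A : H →L[ℂ] H) r c :=
    fun h3 h4 => hcd (h4.unique h3)
  refine ⟨fun r => if EigLine (A : H →L[ℂ] H) r c then x r else y r, k q, m, hmk.symm, ?_, ?_, ?_⟩
  · intro r hr
    rw [if_pos hr]
    exact (hx r hr).1
  · intro s hs
    rw [if_neg (hne hs)]
    obtain ⟨⟨e, -, he⟩, -⟩ := hy s hs
    rwa [eq_of_not_big hT (hnb hq hm) (hnb hs he)]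
  · intro r s B hr hs hB
    rw [if_pos hr, if_neg (hne hs)]
    obtain ⟨z, hz, h⟩ := (hy s hs).2 r B hr hB
    obtain ⟨-, C, hC, hfC⟩ := hx r hr
    rw [← (hy s hs).partner_eq hT hc hd hs hq hr hB hC (hy q hq) h hfC]
    exact h

theorem exists_pairMap (f : commGraph T ≃g commGraph T) (hT : Admissible T) (hcd : c ≠ d)
    (hp : EigLine (A : H →L[ℂ] H) p c) (hq : EigLine (A : H →L[ℂ] H) q d) :
    ∃ φ c' d', PairMap f A c d φ c' d' := by
  by_cases hc : Big T c
  · by_cases hd : Big T d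
    · exact exists_pairMap_big_big hT hc hd hcd hp hq
    · exact exists_pairMap_big_small hT hc hd hcd hp hq
  · by_cases hd : Big T d
    · obtain ⟨φ, c', d', h⟩ := exists_pairMap_big_small (f := f) hT hd hc hcd.symm hq hp
      exact ⟨φ, d', c', h.symm⟩
    · exact absurd (eq_of_not_big hT hc hd) hcd

end

/-! ### Common neighbours of swaps in different pairs of eigenspaces -/

/-- `A` and `B` have the same eigenlines for `m`. -/
def SameEig (A B : H →L[ℂ] H) (m : ℝ) : Prop := ∀ l, EigLine A l m ↔ EigLine B l m

section

variable {T : H →L[ℂ] H} {A B C D E W W' : conjClass T} {p p' q q' r s : ℙ ℂ H}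
  {c d e g m m' m'' : ℝ}

theorem SameEig.symm {A B : H →L[ℂ] H} (h : SameEig A B m) : SameEig B A m := fun l => (h l).symm

theorem SameEig.trans {A B C : H →L[ℂ] H} (h : SameEig A B m) (h' : SameEig B C m) :
    SameEig A C m := fun l => (h l).trans (h' l)

/-- One eigenspace need not be compared, since it is determined by the others. -/
theorem eq_of_sameEig (hT : Admissible T) (c : ℝ)
    (h : ∀ m, m ≠ c → SameEig (A : H →L[ℂ] H) B m) : A = B := by
  refine Subtype.ext (eq_of_eigSpace (hT.sa A) (hT.fr A) (hT.sa B) (hT.fr B) c ?_)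
  intro d hd x
  by_cases hx : x = 0
  · simp [hx]
  · rw [← eigLine_mk hx, ← eigLine_mk hx, h d hd]

theorem Swap.sameEig (hT : Admissible T) (h : Swap (A : H →L[ℂ] H) B p q)
    (hp : EigLine (A : H →L[ℂ] H) p c) (hq : EigLine (A : H →L[ℂ] H) q d) (hmc : m ≠ c)
    (hmd : m ≠ d) : SameEig (B : H →L[ℂ] H) A m :=
  fun _ => h.eigLine_iff_of_ne (hT.sa A) (hT.sa B) hp hq hmc hmd

/-- A swap leaves all but two eigenspaces unchanged, hence one of any three. -/
theorem sameEig_of_adj (hT : Admissible T) (h : (commGraph T).Adj A B) (h1 : m ≠ m')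
    (h2 : m ≠ m'') (h3 : m' ≠ m'') :
    SameEig (B : H →L[ℂ] H) A m ∨ SameEig (B : H →L[ℂ] H) A m' ∨
      SameEig (B : H →L[ℂ] H) A m'' := by
  obtain ⟨p, q, hs⟩ := (adj_iff hT).1 h
  obtain ⟨c, d, hcd, hp, hq, -⟩ := id hs
  have k := fun m => hs.sameEig hT hp hq (m := m)
  by_cases a1 : m = c
  · by_cases a2 : m' = d
    · exact Or.inr (Or.inr (k m'' (by grind) (by grind)))
    · exact Or.inr (Or.inl (k m' (by grind) a2))
  · by_cases a2 : m = d
    · by_cases a3 : m' = c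
      · exact Or.inr (Or.inr (k m'' (by grind) (by grind)))
      · exact Or.inr (Or.inl (k m' a3 (by grind)))
    · exact Or.inl (k m a1 a2)

/-- A line of the eigenspace for `c` which is orthogonal to all eigenlines for `c` orthogonal to `p`
is `p`. -/
theorem eq_of_forall_perp {A : H →L[ℂ] H} (hp : EigLine A p c) (hr : EigLine A r c)
    (h : ∀ l, EigLine A l c → Perp p l → Perp l r) : r = p := by
  by_contra hne
  obtain ⟨a, ha⟩ := linePr_smul_rep p r.rep
  have hv0 : r.rep - linePr p r.rep ≠ 0 := by
    intro h0
    rw [ha, sub_eq_zero] at h0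
    exact hne (eq_of_smul_rep h0)
  have h1 : ⟪p.rep, r.rep - linePr p r.rep⟫_ℂ = 0 := by
    rw [inner_sub_right, inner_rep_linePr, sub_self]
  have h2 := (h (Projectivization.mk ℂ _ hv0) ?_ ?_).symm
  · rw [perp_mk_right] at h2
    apply hv0
    rw [← inner_self_eq_zero (𝕜 := ℂ)]
    nth_rewrite 1 [ha]
    rw [inner_sub_left, h2, inner_smul_left, h1, mul_zero, sub_zero]
  · rw [eigLine_mk, ha, map_sub, map_smul, hp, hr]
    module
  · rw [perp_mk_right]; exact h1

/-- The propositional core of the analysis of common neighbours for three eigenvalues. `Pᵢ` and `Qᵢ`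
stand for agreement with the first and the second neighbour on the `i`-th eigenspace. -/
theorem common_nbr_logic₃ {P₁ P₂ P₃ Q₁ Q₂ Q₃ : Prop} (n1 : ¬ (P₁ ∧ Q₁)) (n2 : ¬ (P₂ ∧ Q₂))
    (n3 : ¬ (P₃ ∧ Q₃)) (f2 : ¬ (Q₁ ∧ P₃)) (f3 : ¬ (P₁ ∧ Q₂)) (f4 : ¬ (P₁ ∧ Q₃)) (f5 : ¬ (Q₁ ∧ P₂))
    (b1 : P₁ ∨ P₂ ∨ P₃) (b2 : Q₁ ∨ Q₂ ∨ Q₃) :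
    ¬ P₁ ∧ ¬ Q₁ ∧ ((P₂ ∧ Q₃) ∨ (P₃ ∧ Q₂)) := by
  tauto

/-- The propositional core of the analysis of common neighbours for four eigenvalues. -/
theorem common_nbr_logic₄ {P₁ P₂ P₃ P₄ Q₁ Q₂ Q₃ Q₄ : Prop} (n1 : ¬ (P₁ ∧ Q₁)) (n2 : ¬ (P₂ ∧ Q₂))
    (n3 : ¬ (P₃ ∧ Q₃)) (n4 : ¬ (P₄ ∧ Q₄)) (f1 : ¬ (P₁ ∧ Q₂)) (f2 : ¬ (P₂ ∧ Q₁))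
    (a1 : P₂ ∨ P₃ ∨ P₄) (a2 : Q₁ ∨ Q₂ ∨ Q₃) (a3 : Q₁ ∨ Q₂ ∨ Q₄)
    (a4 : P₁ ∨ P₃ ∨ P₄) (a5 : P₁ ∨ P₂ ∨ P₃) (a6 : P₁ ∨ P₂ ∨ P₄) (a7 : Q₁ ∨ Q₃ ∨ Q₄)
    (a8 : Q₂ ∨ Q₃ ∨ Q₄) :
    (P₃ ∧ P₄ ∧ Q₁ ∧ Q₂ ∧ ¬ P₁ ∧ ¬ P₂) ∨ (P₁ ∧ P₂ ∧ Q₃ ∧ Q₄ ∧ ¬ P₃ ∧ ¬ P₄) := by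
  by_cases h1 : P₁
  · have hQ1 : ¬ Q₁ := fun h => n1 ⟨h1, h⟩
    have hQ2 : ¬ Q₂ := fun h => f1 ⟨h1, h⟩
    have hQ3 : Q₃ := (a2.resolve_left hQ1).resolve_left hQ2
    have hQ4 : Q₄ := (a3.resolve_left hQ1).resolve_left hQ2
    have h3 : ¬ P₃ := fun h => n3 ⟨h, hQ3⟩
    have h4 : ¬ P₄ := fun h => n4 ⟨h, hQ4⟩
    exact Or.inr ⟨h1, a1.resolve_right (not_or.2 ⟨h3, h4⟩), hQ3, hQ4, h3, h4⟩
  · have h2 : ¬ P₂ := by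
      intro h
      have hQ1 : ¬ Q₁ := fun h' => f2 ⟨h, h'⟩
      have hQ2 : ¬ Q₂ := fun h' => n2 ⟨h, h'⟩
      rcases a4.resolve_left h1 with h3 | h4
      · exact n3 ⟨h3, (a2.resolve_left hQ1).resolve_left hQ2⟩
      · exact n4 ⟨h4, (a3.resolve_left hQ1).resolve_left hQ2⟩
    have h3 : P₃ := (a5.resolve_left h1).resolve_left h2
    have h4 : P₄ := (a6.resolve_left h1).resolve_left h2
    have hQ : ¬ (Q₃ ∨ Q₄) := not_or.2 ⟨fun h => n3 ⟨h3, h⟩, fun h => n4 ⟨h4, h⟩⟩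
    exact Or.inl ⟨h3, h4, a7.resolve_right hQ, a8.resolve_right hQ, h1, h2⟩

/-- What a common neighbour `W ≠ A` of two neighbours of `A` looks like when the two swaps involve
one common and two different eigenvalues, but no common line: it agrees with `B` for `d`, with `C`
for `e`, and with `A` for all further eigenvalues except `c`. -/
theorem sameEig_of_common_adj (hT : Admissible T) (hB : Swap (A : H →L[ℂ] H) B p q)
    (hC : Swap (A : H →L[ℂ] H) C r s) (hp : EigLine (A : H →L[ℂ] H) p c)
    (hq : EigLine (A : H →L[ℂ] H) q d) (hr : EigLine (A : H →L[ℂ] H) r c)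
    (hs : EigLine (A : H →L[ℂ] H) s e) (hde : d ≠ e) (hpr : p ≠ r)
    (hBW : (commGraph T).Adj B W) (hCW : (commGraph T).Adj C W) (hW : W ≠ A) :
    SameEig (W : H →L[ℂ] H) B d ∧ SameEig (W : H →L[ℂ] H) C e ∧
      ∀ m, m ≠ c → m ≠ d → m ≠ e → SameEig (W : H →L[ℂ] H) A m := by
  have hA := hT.sa A
  have hWs := hT.sa W
  have hcd := (hB.eq hp hq).1
  have hce := (hC.eq hr hs).1
  have hBA := fun m => hB.sameEig hT hp hq (m := m)
  have hCA := fun m => hC.sameEig hT hr hs (m := m)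
  have kB := fun m m' m'' => sameEig_of_adj hT hBW (m := m) (m' := m') (m'' := m'')
  have kC := fun m m' m'' => sameEig_of_adj hT hCW (m := m) (m' := m') (m'' := m'')
  have n1 : ¬ (SameEig (W : H →L[ℂ] H) B c ∧ SameEig (W : H →L[ℂ] H) C c) := by
    rintro ⟨h1, h2⟩
    have h3 := (h2 q).1 ((h1 q).2 (hB.eigLine_right hA hp))
    have h4 := ((hCA d hcd.symm hde) q).2 hq
    exact hcd (h3.unique h4)
  have n2 : ¬ (SameEig (W : H →L[ℂ] H) B d ∧ SameEig (W : H →L[ℂ] H) C d) := by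
    rintro ⟨h1, h2⟩
    have h3 := (h2 p).1 ((h1 p).2 (hB.eigLine_left hA hq))
    have h4 := ((hCA d hcd.symm hde) p).1 h3
    exact hcd (hp.unique h4)
  have n3 : ¬ (SameEig (W : H →L[ℂ] H) B e ∧ SameEig (W : H →L[ℂ] H) C e) := by
    rintro ⟨h1, h2⟩
    have h3 := (h1 r).1 ((h2 r).2 (hC.eigLine_left hA hs))
    have h4 := ((hBA e hce.symm hde.symm) r).1 h3
    exact hce (hr.unique h4)
  have f2 : ¬ (SameEig (W : H →L[ℂ] H) C c ∧ SameEig (W : H →L[ℂ] H) B e) := by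
    rintro ⟨h1, h2⟩
    have h3 := (h1 s).2 (hC.eigLine_right hA hr)
    have h4 := (h2 s).2 (((hBA e hce.symm hde.symm) s).2 hs)
    exact hce (h3.unique h4)
  have f3 : ¬ (SameEig (W : H →L[ℂ] H) B c ∧ SameEig (W : H →L[ℂ] H) C d) := by
    rintro ⟨h1, h2⟩
    have h3 := (h1 q).2 (hB.eigLine_right hA hp)
    have h4 := (h2 q).2 (((hCA d hcd.symm hde) q).2 hq)
    exact hcd (h3.unique h4)
  have f4 : ¬ (SameEig (W : H →L[ℂ] H) B c ∧ SameEig (W : H →L[ℂ] H) C e) := by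
    rintro ⟨h1, h2⟩
    have h3 := (h2 r).2 (hC.eigLine_left hA hs)
    refine hpr (eq_of_forall_perp hp hr fun l hl hpl => ?_).symm
    have h4 := (h1 l).2 (hB.eigLine_of_perp hl hpl (hq.perp hA hcd.symm hl))
    exact h4.perp hWs hce h3
  have f5 : ¬ (SameEig (W : H →L[ℂ] H) C c ∧ SameEig (W : H →L[ℂ] H) B d) := by
    rintro ⟨h1, h2⟩
    have h3 := (h2 p).2 (hB.eigLine_left hA hq)
    refine hpr (eq_of_forall_perp hr hp fun l hl hpl => ?_)
    have h4 := (h1 l).2 (hC.eigLine_of_perp hl hpl (hs.perp hA hce.symm hl))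
    exact h4.perp hWs hcd h3
  have b1 := kB c d e hcd hce hde
  have b2 := kC c d e hcd hce hde
  obtain ⟨nP, nQ, hor⟩ := common_nbr_logic₃ n1 n2 n3 f2 f3 f4 f5 b1 b2
  have off : ∀ m, m ≠ c → m ≠ d → m ≠ e → SameEig (W : H →L[ℂ] H) A m := by
    intro m h1 h2 h3
    have c1 := kB m c d h1 h2 hcd
    have c2 := kC m c d h1 h2 hcd
    rcases c1 with d1 | d1 | d1
    · exact d1.trans (hBA m h1 h2)
    · exact absurd d1 nP
    rcases c2 with d2 | d2 | d2
    · exact d2.trans (hCA m h1 h3)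
    · exact absurd d2 nQ
    · exact absurd ⟨d1, d2⟩ n2
  rcases hor with hor | ⟨h1, h2⟩
  · exact ⟨hor.1, hor.2, off⟩
  · exfalso
    apply hW
    refine eq_of_sameEig hT c fun m hm => ?_
    by_cases hmd : m = d
    · subst hmd; exact h2.trans (hCA m hcd.symm hde)
    by_cases hme : m = e
    · subst hme; exact h1.trans (hBA m hce.symm hde.symm)
    exact off m hm hmd hme

/-- The analogous statement for swaps that involve four different eigenvalues. -/
theorem sameEig_of_common_adj_disjoint (hT : Admissible T) (hB : Swap (A : H →L[ℂ] H) B p q)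
    (hC : Swap (A : H →L[ℂ] H) C r s) (hp : EigLine (A : H →L[ℂ] H) p c)
    (hq : EigLine (A : H →L[ℂ] H) q d) (hr : EigLine (A : H →L[ℂ] H) r e)
    (hs : EigLine (A : H →L[ℂ] H) s g) (hce : c ≠ e) (hcg : c ≠ g) (hde : d ≠ e) (hdg : d ≠ g)
    (hBW : (commGraph T).Adj B W) (hCW : (commGraph T).Adj C W) (hW : W ≠ A) :
    SameEig (W : H →L[ℂ] H) B d ∧ SameEig (W : H →L[ℂ] H) C e ∧ SameEig (W : H →L[ℂ] H) C g ∧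
      ∀ m, m ≠ c → m ≠ d → m ≠ e → m ≠ g → SameEig (W : H →L[ℂ] H) A m := by
  have hA := hT.sa A
  have hcd := (hB.eq hp hq).1
  have heg := (hC.eq hr hs).1
  have hBA := fun m => hB.sameEig hT hp hq (m := m)
  have hCA := fun m => hC.sameEig hT hr hs (m := m)
  have kB := fun m m' m'' => sameEig_of_adj hT hBW (m := m) (m' := m') (m'' := m'')
  have kC := fun m m' m'' => sameEig_of_adj hT hCW (m := m) (m' := m') (m'' := m'')
  have hBp := hB.eigLine_left hA hq
  have hBq := hB.eigLine_right hA hp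
  have hCr := hC.eigLine_left hA hs
  have hCs := hC.eigLine_right hA hr
  have hCp := ((hCA c hce hcg) p).2 hp
  have hCq := ((hCA d hde hdg) q).2 hq
  have hBr := ((hBA e hce.symm hde.symm) r).2 hr
  have hBs := ((hBA g hcg.symm hdg.symm) s).2 hs
  have n1 : ¬ (SameEig (W : H →L[ℂ] H) B c ∧ SameEig (W : H →L[ℂ] H) C c) := fun ⟨h1, h2⟩ =>
    hcd (((h2 q).1 ((h1 q).2 hBq)).unique hCq)
  have n2 : ¬ (SameEig (W : H →L[ℂ] H) B d ∧ SameEig (W : H →L[ℂ] H) C d) := fun ⟨h1, h2⟩ =>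
    hcd.symm (((h2 p).1 ((h1 p).2 hBp)).unique hCp)
  have n3 : ¬ (SameEig (W : H →L[ℂ] H) B e ∧ SameEig (W : H →L[ℂ] H) C e) := fun ⟨h1, h2⟩ =>
    heg (((h1 s).1 ((h2 s).2 hCs)).unique hBs)
  have n4 : ¬ (SameEig (W : H →L[ℂ] H) B g ∧ SameEig (W : H →L[ℂ] H) C g) := fun ⟨h1, h2⟩ =>
    heg.symm (((h1 r).1 ((h2 r).2 hCr)).unique hBr)
  have f1 : ¬ (SameEig (W : H →L[ℂ] H) B c ∧ SameEig (W : H →L[ℂ] H) C d) := fun ⟨h1, h2⟩ =>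
    hcd (((h1 q).2 hBq).unique ((h2 q).2 hCq))
  have f2 : ¬ (SameEig (W : H →L[ℂ] H) B d ∧ SameEig (W : H →L[ℂ] H) C c) := fun ⟨h1, h2⟩ =>
    hcd.symm (((h1 p).2 hBp).unique ((h2 p).2 hCp))
  have a1 := kB d e g hde hdg heg
  have a2 := kC c d e hcd hce hde
  have a3 := kC c d g hcd hcg hdg
  have a4 := kB c e g hce hcg heg
  have a5 := kB c d e hcd hce hde
  have a6 := kB c d g hcd hcg hdg
  have a7 := kC c e g hce hcg heg
  have a8 := kC d e g hde hdg heg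
  rcases common_nbr_logic₄ n1 n2 n3 n4 f1 f2 a1 a2 a3 a4 a5 a6 a7 a8 with
    ⟨h1, h2, h3, h4, nc, nd⟩ | ⟨h1, h2, h3, h4, ne, ng⟩
  · exfalso
    apply hW
    refine eq_of_sameEig hT c fun m hm => ?_
    by_cases hmd : m = d
    · subst hmd; exact h4.trans (hCA m hde hdg)
    rcases kB m c d hm hmd hcd with h6 | h6 | h6
    · exact h6.trans (hBA m hm hmd)
    · exact absurd h6 nc
    · exact absurd h6 nd
  · refine ⟨h2, h3, h4, fun m k1 k2 k3 k4 => ?_⟩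
    rcases kB m e g k3 k4 heg with h6 | h6 | h6
    · exact h6.trans (hBA m k1 k2)
    · exact absurd h6 ne
    · exact absurd h6 ng

/-- If two neighbours of `A` that swap lines of different pairs of eigenspaces have two common
neighbours besides `A`, then the two swaps share a line. -/
theorem share_of_two_common (hT : Admissible T) (hB : Swap (A : H →L[ℂ] H) B p q)
    (hC : Swap (A : H →L[ℂ] H) C r s) (hp : EigLine (A : H →L[ℂ] H) p c)
    (hq : EigLine (A : H →L[ℂ] H) q d) (hr : EigLine (A : H →L[ℂ] H) r e)
    (hs : EigLine (A : H →L[ℂ] H) s g) (h1 : ¬ (c = e ∧ d = g)) (h2 : ¬ (c = g ∧ d = e))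
    (hBW : (commGraph T).Adj B W) (hCW : (commGraph T).Adj C W) (hW : W ≠ A)
    (hBW' : (commGraph T).Adj B W') (hCW' : (commGraph T).Adj C W') (hW' : W' ≠ A)
    (hWW : W ≠ W') : p = r ∨ p = s ∨ q = r ∨ q = s := by
  have core : ∀ {p q r s : ℙ ℂ H} {c d e : ℝ}, Swap (A : H →L[ℂ] H) B p q →
      Swap (A : H →L[ℂ] H) C r s → EigLine (A : H →L[ℂ] H) p c → EigLine (A : H →L[ℂ] H) q d →
      EigLine (A : H →L[ℂ] H) r c → EigLine (A : H →L[ℂ] H) s e → d ≠ e → p = r := by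
    intro p q r s c d e hB hC hp hq hr hs hde
    by_contra hpr
    obtain ⟨a1, a2, a3⟩ := sameEig_of_common_adj hT hB hC hp hq hr hs hde hpr hBW hCW hW
    obtain ⟨b1, b2, b3⟩ := sameEig_of_common_adj hT hB hC hp hq hr hs hde hpr hBW' hCW' hW'
    refine hWW (eq_of_sameEig hT c fun m hm => ?_)
    by_cases hmd : m = d
    · subst hmd; exact a1.trans b1.symm
    by_cases hme : m = e
    · subst hme; exact a2.trans b2.symm
    exact (a3 m hm hmd hme).trans (b3 m hm hmd hme).symm
  by_cases k1 : c = e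
  · subst k1
    exact Or.inl (core hB hC hp hq hr hs (fun h => h1 ⟨rfl, h⟩))
  by_cases k2 : c = g
  · subst k2
    exact Or.inr (Or.inl (core hB hC.symm hp hq hs hr (fun h => h2 ⟨rfl, h⟩)))
  by_cases k3 : d = e
  · subst k3
    exact Or.inr (Or.inr (Or.inl (core hB.symm hC hq hp hr hs (fun h => h2 ⟨h, rfl⟩))))
  by_cases k4 : d = g
  · subst k4
    exact Or.inr (Or.inr (Or.inr (core hB.symm hC.symm hq hp hs hr (fun h => h1 ⟨h, rfl⟩))))
  exfalso
  obtain ⟨a1, a2, a3, a4⟩ :=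
    sameEig_of_common_adj_disjoint hT hB hC hp hq hr hs k1 k2 k3 k4 hBW hCW hW
  obtain ⟨b1, b2, b3, b4⟩ :=
    sameEig_of_common_adj_disjoint hT hB hC hp hq hr hs k1 k2 k3 k4 hBW' hCW' hW'
  refine hWW (eq_of_sameEig hT c fun m hm => ?_)
  by_cases hmd : m = d
  · subst hmd; exact a1.trans b1.symm
  by_cases hme : m = e
  · subst hme; exact a2.trans b2.symm
  by_cases hmg : m = g
  · subst hmg; exact a3.trans b3.symm
  exact (a4 m hm hmd hme hmg).trans (b4 m hm hmd hme hmg).symm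

/-- Two swaps sharing the line `p` have two common neighbours besides `A`: the cyclic permutations
of `p`, `q`, `s`. -/
theorem exists_two_common (hT : Admissible T) (hB : Swap (A : H →L[ℂ] H) B p q)
    (hC : Swap (A : H →L[ℂ] H) C p s) (hp : EigLine (A : H →L[ℂ] H) p c)
    (hq : EigLine (A : H →L[ℂ] H) q d) (hs : EigLine (A : H →L[ℂ] H) s e) (hde : d ≠ e) :
    ∃ W W', (commGraph T).Adj B W ∧ (commGraph T).Adj C W ∧ (commGraph T).Adj B W' ∧
      (commGraph T).Adj C W' ∧ W ≠ A ∧ W' ≠ A ∧ W ≠ W' := by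
  have hA := hT.sa A
  have hcd := (hB.eq hp hq).1
  have hce := (hC.eq hp hs).1
  have hpq := hB.perp hA
  have hps := hC.perp hA
  have hqs := hq.perp hA hde hs
  have pB : EigLine (B : H →L[ℂ] H) p d := hB.eigLine_left hA hq
  have qB : EigLine (B : H →L[ℂ] H) q c := hB.eigLine_right hA hp
  have sB : EigLine (B : H →L[ℂ] H) s e := hB.eigLine_of_perp hs hps hqs
  have pC : EigLine (C : H →L[ℂ] H) p e := hC.eigLine_left hA hs
  have sC : EigLine (C : H →L[ℂ] H) s c := hC.eigLine_right hA hp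
  have qC : EigLine (C : H →L[ℂ] H) q d := hC.eigLine_of_perp hq hpq hqs.symm
  obtain ⟨W, hW⟩ := exists_vertex hT hce qB sB
  obtain ⟨W₁, hW₁⟩ := exists_vertex hT hde.symm pC qC
  obtain ⟨W', hW'⟩ := exists_vertex hT hde pB sB
  obtain ⟨W₁', hW₁'⟩ := exists_vertex hT hcd sC qC
  have e1 : W = W₁ := by
    apply Subtype.ext
    rw [(hW.eq qB sB).2, (hW₁.eq pC qC).2, (hB.eq hp hq).2, (hC.eq hp hs).2]
    module
  have e2 : W' = W₁' := by
    apply Subtype.ext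
    rw [(hW'.eq pB sB).2, (hW₁'.eq sC qC).2, (hB.eq hp hq).2, (hC.eq hp hs).2]
    module
  subst e1 e2
  have pW : EigLine (W : H →L[ℂ] H) p d := hW.eigLine_of_perp pB hpq.symm hps.symm
  have pW' : EigLine (W' : H →L[ℂ] H) p e := hW'.eigLine_left (hT.sa B) sB
  refine ⟨W, W', (adj_iff hT).2 ⟨_, _, hW⟩, (adj_iff hT).2 ⟨_, _, hW₁⟩,
    (adj_iff hT).2 ⟨_, _, hW'⟩, (adj_iff hT).2 ⟨_, _, hW₁'⟩, ?_, ?_, ?_⟩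
  · rintro rfl; exact hcd (hp.unique pW)
  · rintro rfl; exact hce (hp.unique pW')
  · rintro rfl; exact hde (pW.unique pW')

/-! ### The line map at a vertex -/

variable {f : commGraph T ≃g commGraph T} {φ ψ : ℙ ℂ H → ℙ ℂ H} {c₁ d₁ c₂ e₂ : ℝ}

theorem PairMap.map_ne (hT : Admissible T) (h : PairMap f A c d φ c₁ d₁) (hcd : c ≠ d)
    (hp : EigLine (A : H →L[ℂ] H) p c)
    (hq : EigLine (A : H →L[ℂ] H) q d) (hq' : EigLine (A : H →L[ℂ] H) q' d) (hqq : q ≠ q') :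
    φ q ≠ φ q' := by
  intro h0
  obtain ⟨B, hB⟩ := exists_vertex hT hcd hp hq
  obtain ⟨C, hC⟩ := exists_vertex hT hcd hp hq'
  have h1 := h.map p q B hp hq hB
  have h2 := h.map p q' C hp hq' hC
  rw [← h0] at h2
  obtain rfl := f.injective (vertex_unique hT h1 h2)
  rcases hB.lines_eq (hT.sa A) hC with ⟨a1, a2⟩ | ⟨a1, a2⟩
  · exact hqq a2
  · exact hB.ne (hT.sa A) a2.symm

/-- Different pairs of eigenvalues are sent to different pairs of eigenvalues. -/
theorem PairMap.types_ne (hT : Admissible T) (h : PairMap f A c d φ c₁ d₁)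
    (h' : PairMap f A c e ψ c₂ e₂) (hcd : c ≠ d) (hce : c ≠ e) (hde : d ≠ e)
    (hp : EigLine (A : H →L[ℂ] H) p c) (hq : EigLine (A : H →L[ℂ] H) q d)
    (hs : EigLine (A : H →L[ℂ] H) s e) :
    ¬ (c₁ = c₂ ∧ d₁ = e₂) ∧ ¬ (c₁ = e₂ ∧ d₁ = c₂) := by
  have hA := hT.sa A
  obtain ⟨B, hB⟩ := exists_vertex hT hcd hp hq
  obtain ⟨C, hC⟩ := exists_vertex hT hce hp hs
  have hfB := h.map p q B hp hq hB
  have hfC := h'.map p s C hp hs hC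
  obtain ⟨χ, k, l, hχ⟩ := exists_pairMap (A := f A) f.symm hT h.ne (h.left p hp) (h.right q hq)
  have b1 := hχ.map _ _ _ (h.left p hp) (h.right q hq) hfB
  have b2 := hχ.left _ (h.left p hp)
  have b3 := hχ.right _ (h.right q hq)
  have fin : ∀ {x y}, EigLine (f.symm (f A) : H →L[ℂ] H) x k →
      EigLine (f.symm (f A) : H →L[ℂ] H) y l →
      Swap (f.symm (f A) : H →L[ℂ] H) (f.symm (f C)) x y → False := by
    intro x y hx hy hxy
    rw [f.symm_apply_apply] at hx hy hxy b1 b2 b3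
    rw [f.symm_apply_apply] at hxy b1
    have m1 : (k = c ∧ l = d) ∨ (k = d ∧ l = c) := by
      rcases b1.lines_eq hA hB with ⟨a1, a2⟩ | ⟨a1, a2⟩ <;> rw [a1] at b2 <;> rw [a2] at b3
      · exact Or.inl ⟨b2.unique hp, b3.unique hq⟩
      · exact Or.inr ⟨b2.unique hq, b3.unique hp⟩
    have m2 : (k = c ∧ l = e) ∨ (k = e ∧ l = c) := by
      rcases hxy.lines_eq hA hC with ⟨a1, a2⟩ | ⟨a1, a2⟩ <;> rw [a1] at hx <;> rw [a2] at hy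
      · exact Or.inl ⟨hx.unique hp, hy.unique hs⟩
      · exact Or.inr ⟨hx.unique hs, hy.unique hp⟩
    grind
  constructor
  · rintro ⟨rfl, rfl⟩
    exact fin (hχ.left _ (h'.left p hp)) (hχ.right _ (h'.right s hs))
      (hχ.map _ _ _ (h'.left p hp) (h'.right s hs) hfC)
  · rintro ⟨rfl, rfl⟩
    exact fin (hχ.left _ (h'.right s hs)) (hχ.right _ (h'.left p hp))
      (hχ.map _ _ _ (h'.right s hs) (h'.left p hp) hfC.symm)

/-- The line maps of two pairs of eigenspaces agree on a common eigenspace. -/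
theorem PairMap.eq (hT : Admissible T) (h : PairMap f A c d φ c₁ d₁)
    (h' : PairMap f A c e ψ c₂ e₂) (hcd : c ≠ d) (hce : c ≠ e)
    (hp : EigLine (A : H →L[ℂ] H) p c) (hq : EigLine (A : H →L[ℂ] H) q d)
    (hs : EigLine (A : H →L[ℂ] H) s e) : φ p = ψ p := by
  have hA := hT.sa A
  have hfA := hT.sa (f A)
  obtain ⟨q', hq', hqq⟩ := exists_perp hT hq
  have hφq := h.map_ne hT hcd hp hq hq' hqq.ne
  by_cases hde : d = e
  · subst hde
    have hψq := h'.map_ne hT hcd hp hq hq' hqq.ne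
    obtain ⟨B, hB⟩ := exists_vertex hT hcd hp hq
    obtain ⟨C, hC⟩ := exists_vertex hT hcd hp hq'
    have a1 := h.map p q B hp hq hB
    have a2 := h.map p q' C hp hq' hC
    have a3 := h'.map p q B hp hq hB
    have a4 := h'.map p q' C hp hq' hC
    rcases a1.lines_eq hfA a3 with ⟨b1, b2⟩ | ⟨b1, b2⟩ <;>
    rcases a2.lines_eq hfA a4 with ⟨b3, b4⟩ | ⟨b3, b4⟩ <;> grind
  · obtain ⟨s', hs', hss⟩ := exists_perp hT hs
    have hψs := h'.map_ne hT hce hp hs hs' hss.ne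
    obtain ⟨t1, t2⟩ := h.types_ne hT h' hcd hce hde hp hq hs
    have share : ∀ {q s}, EigLine (A : H →L[ℂ] H) q d → EigLine (A : H →L[ℂ] H) s e →
        φ p = ψ p ∨ φ p = ψ s ∨ φ q = ψ p ∨ φ q = ψ s := by
      intro q s hq hs
      obtain ⟨B, hB⟩ := exists_vertex hT hcd hp hq
      obtain ⟨C, hC⟩ := exists_vertex hT hce hp hs
      obtain ⟨W, W', k1, k2, k3, k4, k5, k6, k7⟩ := exists_two_common hT hB hC hp hq hs hde
      exact share_of_two_common hT (h.map p q B hp hq hB) (h'.map p s C hp hs hC) (h.left p hp)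
        (h.right q hq) (h'.left p hp) (h'.right s hs) t1 t2 (f.map_adj_iff.2 k1)
        (f.map_adj_iff.2 k2) (f.injective.ne k5) (f.map_adj_iff.2 k3) (f.map_adj_iff.2 k4)
        (f.injective.ne k6) (f.injective.ne k7)
    have u : ∀ {x y : ℙ ℂ H} {a b : ℝ}, EigLine (f A : H →L[ℂ] H) x a →
        EigLine (f A : H →L[ℂ] H) y b → x = y → a = b := by
      rintro x y a b hx hy rfl
      exact hx.unique hy
    have P1 := h.left p hp
    have Q1 := h.right q hq
    have Q2 := h.right q' hq'
    have R1 := h'.left p hp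
    have S1 := h'.right s hs
    have S2 := h'.right s' hs'
    have s1 := share hq hs
    have s2 := share hq hs'
    have s3 := share hq' hs
    have s4 := share hq' hs'
    have n1 := h.ne
    have n2 := h'.ne
    have u1 := u P1 R1
    have u2 := u P1 S1
    have u3 := u P1 S2
    have u4 := u Q1 R1
    have u5 := u Q1 S1
    have u6 := u Q1 S2
    have u7 := u Q2 R1
    have u8 := u Q2 S1
    have u9 := u Q2 S2
    grind

/-- `φ` describes the action of `f` on all swaps of eigenlines of `A`, and maps the eigenlines of
one eigenspace into one eigenspace. -/
structure LineMap (f : commGraph T ≃g commGraph T) (A : conjClass T) (φ : ℙ ℂ H → ℙ ℂ H) :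
    Prop where
  map : ∀ p q (B : conjClass T), Swap (A : H →L[ℂ] H) B p q →
    Swap (f A : H →L[ℂ] H) (f B) (φ p) (φ q)
  eig : ∀ c, ∃ c', ∀ p, EigLine (A : H →L[ℂ] H) p c → EigLine (f A : H →L[ℂ] H) (φ p) c'

theorem exists_lineMap (f : commGraph T ≃g commGraph T) (hT : Admissible T) (A : conjClass T) :
    ∃ φ, LineMap f A φ := by
  have h1 : ∀ p, ∃ x, ∀ c, EigLine (A : H →L[ℂ] H) p c → ∃ d φ c₁ d₁ q, c ≠ d ∧
      EigLine (A : H →L[ℂ] H) q d ∧ PairMap f A c d φ c₁ d₁ ∧ x = φ p := by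
    intro p
    by_cases h : ∃ c, EigLine (A : H →L[ℂ] H) p c
    · obtain ⟨c, hp⟩ := h
      obtain ⟨d, q, hdc, hq⟩ := exists_eigLine_ne hT A c
      obtain ⟨φ, c₁, d₁, hφ⟩ := exists_pairMap f hT hdc.symm hp hq
      refine ⟨φ p, fun c' hc' => ?_⟩
      obtain rfl := hp.unique hc'
      exact ⟨d, φ, c₁, d₁, q, hdc.symm, hq, hφ, rfl⟩
    · exact ⟨p, fun c hc => absurd ⟨c, hc⟩ h⟩
  choose x hx using h1
  have key : ∀ {p q c d φ c₁ d₁}, c ≠ d → EigLine (A : H →L[ℂ] H) p c →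
      EigLine (A : H →L[ℂ] H) q d → PairMap f A c d φ c₁ d₁ → x p = φ p := by
    intro p q c d φ c₁ d₁ hcd hp hq hφ
    obtain ⟨e, ψ, c₂, e₂, s, hce, hs, hψ, he⟩ := hx p c hp
    rw [he]
    exact hψ.eq hT hφ hce hcd hp hs hq
  refine ⟨x, ?_, ?_⟩
  · intro p q B hB
    obtain ⟨c, d, hcd, hp, hq, -⟩ := id hB
    obtain ⟨φ, c₁, d₁, hφ⟩ := exists_pairMap f hT hcd hp hq
    rw [key hcd hp hq hφ, key hcd.symm hq hp hφ.symm]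
    exact hφ.map p q B hp hq hB
  · intro c
    by_cases h : ∃ p, EigLine (A : H →L[ℂ] H) p c
    · obtain ⟨p, hp⟩ := h
      obtain ⟨d, q, hdc, hq⟩ := exists_eigLine_ne hT A c
      obtain ⟨φ, c₁, d₁, hφ⟩ := exists_pairMap f hT hdc.symm hp hq
      refine ⟨c₁, fun r hr => ?_⟩
      rw [key hdc.symm hr hq hφ]
      exact hφ.left r hr
    · exact ⟨c, fun r hr => absurd ⟨r, hr⟩ h⟩

end

/-! ### Comparing the line maps at different vertices -/

section

variable {T : H →L[ℂ] H} {A B C D E : conjClass T} {p p' q q' r s x y : ℙ ℂ H}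
  {c c' d e g : ℝ} {f : commGraph T ≃g commGraph T} {φ ψ : ℙ ℂ H → ℙ ℂ H}

theorem LineMap.perp (hT : Admissible T) (h : LineMap f A φ) (hp : EigLine (A : H →L[ℂ] H) p c)
    (hp' : EigLine (A : H →L[ℂ] H) p' c') (hpp : Perp p p') : Perp (φ p) (φ p') := by
  by_cases hcc : c = c'
  · subst hcc
    obtain ⟨d, q, hdc, hq⟩ := exists_eigLine_ne hT A c
    obtain ⟨B, hB⟩ := exists_vertex hT hdc.symm hp hq
    obtain ⟨C, hC⟩ := exists_vertex hT hdc.symm hp' hq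
    obtain ⟨k, hk⟩ := h.eig c
    exact (perp_of_adj_common hT (h.map p q B hB) (h.map p' q C hC)
      (f.map_adj_iff.2 (adj_of_common hT hB hC hpp hp hp')) (hk p hp)).1
  · obtain ⟨B, hB⟩ := exists_vertex hT hcc hp hp'
    exact (h.map p p' B hB).perp (hT.sa _)

/-- The line maps at `A` and at its neighbour `{p, q}` agree on `q` and on the lines `q'` orthogonal
to `q` in the same eigenspace: the neighbour `{p, q'}` of `A` is the neighbour `{q, q'}` of `B`. -/
theorem LineMap.eq_of_swap_aux (hT : Admissible T) (hA : LineMap f A φ) (hB : LineMap f B ψ)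
    (h : Swap (A : H →L[ℂ] H) B p q) (hp : EigLine (A : H →L[ℂ] H) p c)
    (hq : EigLine (A : H →L[ℂ] H) q d) (hq' : EigLine (A : H →L[ℂ] H) q' d) (hqq : Perp q q') :
    φ q = ψ q ∧ φ q' = ψ q' := by
  have hsA := hT.sa A
  have hcd := (h.eq hp hq).1
  obtain ⟨C, hC⟩ := exists_vertex hT hcd hp hq'
  obtain ⟨k, hk⟩ := hA.eig d
  have h1 := (hA.map p q B h).trans_of_perp (hT.sa _) (hA.map p q' C hC) (hk q hq) (hk q' hq')
    (hA.perp hT hq hq' hqq)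
  have h2 := hB.map q q' C (h.trans_of_perp hsA hC hq hq' hqq)
  have h3 := (hA.map p q B h).rev (hT.sa _)
  have h4 := hB.map p q A (h.rev hsA)
  have h5 : ψ p ≠ ψ q' := (hB.perp hT (h.eigLine_left hsA hq)
    (h.eigLine_of_perp hq' (hC.perp hsA) hqq) (hC.perp hsA)).ne
  rcases h1.lines_eq (hT.sa _) h2 with a | ⟨a1, a2⟩
  · exact a
  · rcases h3.lines_eq (hT.sa _) h4 with ⟨b1, b2⟩ | ⟨b1, b2⟩
    · exact absurd (h2.ne (hT.sa _)) (by rw [← a1, ← b2]; simp)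
    · exact absurd (b2.symm.trans a1) h5

/-- The line maps at `A` and at a vertex obtained by a swap agree on the eigenlines of `A` which
stay eigenlines. For a third eigenspace, the swap is replaced by a path of three swaps all of which
involve the line in question. -/
theorem LineMap.eq_of_swap (hT : Admissible T) (hA : LineMap f A φ) (hB : LineMap f B ψ)
    (h : Swap (A : H →L[ℂ] H) B x y) (hp : EigLine (A : H →L[ℂ] H) p e)
    (hpxy : p = x ∨ p = y ∨ (Perp x p ∧ Perp y p)) : φ p = ψ p := by
  have hsA := hT.sa A
  have ends : ∀ {A B : conjClass T} {x y : ℙ ℂ H} {φ ψ : ℙ ℂ H → ℙ ℂ H}, LineMap f A φ →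
      LineMap f B ψ → Swap (A : H →L[ℂ] H) B x y → φ y = ψ y := by
    intro A B x y φ ψ hA hB h
    obtain ⟨c, d, hcd, hx, hy, -⟩ := id h
    obtain ⟨y', hy', hyy⟩ := exists_perp hT hy
    exact (hA.eq_of_swap_aux hT hB h hx hy hy' hyy).1
  rcases hpxy with rfl | rfl | ⟨h1, h2⟩
  · exact ends hA hB h.symm
  · exact ends hA hB h
  obtain ⟨c, d, hcd, hx, hy, -⟩ := id h
  by_cases hed : e = d
  · subst hed
    exact (hA.eq_of_swap_aux hT hB h hx hy hp h2).2
  by_cases hec : e = c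
  · subst hec
    exact (hA.eq_of_swap_aux hT hB h.symm hy hx hp h1).2
  obtain ⟨D, hD⟩ := exists_vertex hT hec hp hx
  have pB : EigLine (B : H →L[ℂ] H) p e := h.eigLine_of_perp hp h1 h2
  have xB : EigLine (B : H →L[ℂ] H) x d := h.eigLine_left hsA hy
  have pD : EigLine (D : H →L[ℂ] H) p c := hD.eigLine_left hsA hx
  have yD : EigLine (D : H →L[ℂ] H) y d := hD.eigLine_of_perp hy h2.symm (h.perp hsA)
  obtain ⟨E, hE⟩ := exists_vertex hT hed pB xB
  obtain ⟨E', hE'⟩ := exists_vertex hT hcd pD yD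
  -- `E` arises from `A` by a cyclic permutation of `p`, `x` and `y`
  obtain rfl : E = E' := by
    apply Subtype.ext
    rw [(hE.eq pB xB).2, (hE'.eq pD yD).2, (hD.eq hp hx).2, (h.eq hx hy).2]
    module
  obtain ⟨φD, hφD⟩ := exists_lineMap f hT D
  obtain ⟨φE, hφE⟩ := exists_lineMap f hT E
  rw [ends hA hφD hD.symm, ends hφD hφE hE'.symm, ends hB hφE hE.symm]

/-! ### Paths of swaps keeping an eigenline -/

/-- `B` arises from `A` by a sequence of swaps throughout which `p` is an eigenline; in each step,
`p` is one of the swapped lines or orthogonal to both. -/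
def Linked (p : ℙ ℂ H) : conjClass T → conjClass T → Prop :=
  Relation.ReflTransGen fun A B => (∃ c, EigLine (A : H →L[ℂ] H) p c) ∧
    ∃ x y, Swap (A : H →L[ℂ] H) B x y ∧ (p = x ∨ p = y ∨ (Perp x p ∧ Perp y p))

theorem Swap.linked (h : Swap (A : H →L[ℂ] H) B x y) (hp : EigLine (A : H →L[ℂ] H) p c)
    (hpxy : p = x ∨ p = y ∨ (Perp x p ∧ Perp y p)) : Linked p A B :=
  Relation.ReflTransGen.single ⟨⟨c, hp⟩, x, y, h, hpxy⟩

theorem Swap.exists_eigLine (hT : Admissible T) (h : Swap (A : H →L[ℂ] H) B x y)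
    (hp : EigLine (A : H →L[ℂ] H) p c) (hpxy : p = x ∨ p = y ∨ (Perp x p ∧ Perp y p)) :
    ∃ d, EigLine (B : H →L[ℂ] H) p d := by
  obtain ⟨k, l, -, hx, hy, -⟩ := id h
  rcases hpxy with rfl | rfl | ⟨h1, h2⟩
  · exact ⟨_, h.eigLine_left (hT.sa A) hy⟩
  · exact ⟨_, h.eigLine_right (hT.sa A) hx⟩
  · exact ⟨_, h.eigLine_of_perp hp h1 h2⟩

/-- A line map is determined on the eigenlines of `A`. -/
theorem LineMap.unique (hT : Admissible T) (hA : LineMap f A φ) (hA' : LineMap f A ψ)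
    (hp : EigLine (A : H →L[ℂ] H) p c) : φ p = ψ p := by
  obtain ⟨d, q, hdc, hq⟩ := exists_eigLine_ne hT A c
  obtain ⟨q', hq', hqq⟩ := exists_perp hT hq
  obtain ⟨B, hB⟩ := exists_vertex hT hdc.symm hp hq
  obtain ⟨C, hC⟩ := exists_vertex hT hdc.symm hp hq'
  have h1 := (hA'.perp hT hq hq' hqq).ne
  rcases (hA.map p q B hB).lines_eq (hT.sa _) (hA'.map p q B hB) with ⟨a1, a2⟩ | ⟨a1, a2⟩
  · exact a1
  rcases (hA.map p q' C hC).lines_eq (hT.sa _) (hA'.map p q' C hC) with ⟨b1, b2⟩ | ⟨b1, b2⟩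
  · exact b1
  · exact absurd (a1.symm.trans b1) h1

theorem LineMap.eq_of_linked (hT : Admissible T) (h : Linked p A B)
    (hp : EigLine (A : H →L[ℂ] H) p c) (hA : LineMap f A φ) (hB : LineMap f B ψ) : φ p = ψ p := by
  induction h generalizing ψ with
  | refl => exact hA.unique hT hB hp
  | tail _ h2 ih =>
    obtain ⟨⟨d, hd⟩, x, y, h, hpxy⟩ := h2
    obtain ⟨χ, hχ⟩ := exists_lineMap f hT _
    rw [ih hχ]
    exact hχ.eq_of_swap hT hB h hd hpxy

theorem LineMap.symm_apply (hT : Admissible T) (hA : LineMap f A φ) (hψ : LineMap f.symm (f A) ψ)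
    (hp : EigLine (A : H →L[ℂ] H) p c) : ψ (φ p) = p := by
  obtain ⟨d, q, hdc, hq⟩ := exists_eigLine_ne hT A c
  obtain ⟨q', hq', hqq⟩ := exists_perp hT hq
  have key : ∀ {q}, EigLine (A : H →L[ℂ] H) q d → ψ (φ p) = p ∨ ψ (φ p) = q := by
    intro q hq
    obtain ⟨B, hB⟩ := exists_vertex hT hdc.symm hp hq
    have h1 := hB.lines_eq (hT.sa _) (r := ψ (φ p)) (s := ψ (φ q))
      (by simpa using hψ.map _ _ _ (hA.map p q B hB))
    grind
  have := hqq.ne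
  have h1 := key hq
  have h2 := key hq'
  grind

/-! ### Connectedness of the set of vertices with a given eigenline -/

variable {u v w z : H}

theorem perp_of_inner {x : H} (hx : x ≠ 0) (h : ⟪p.rep, x⟫_ℂ = 0) :
    Perp (Projectivization.mk ℂ x hx) p :=
  ((perp_mk_right hx).2 h).symm

theorem inner_rep_mk {x : H} (hx : x ≠ 0) (h : ⟪x, v⟫_ℂ = 0) :
    ⟪(Projectivization.mk ℂ x hx).rep, v⟫_ℂ = 0 := by
  obtain ⟨a, -, ha⟩ := exists_rep_mk x hx
  rw [ha, inner_smul_left, h, mul_zero]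

theorem EigLine.inner_eq_zero (hp : EigLine (A : H →L[ℂ] H) p c) (hT : Admissible T) (hcd : c ≠ d)
    (hv : (A : H →L[ℂ] H) v = (d : ℂ) • v) : ⟪p.rep, v⟫_ℂ = 0 :=
  inner_eq_zero_of_eigenvalue_ne (hT.sa A) hcd hp hv

/-- Two eigenvectors of `A` for different eigenvalues `c`, `e` can be replaced by two orthogonal
combinations, one of which is their sum: this takes two swaps, both involving an auxiliary eigenline
for `e`. -/
theorem exists_linked_add (hT : Admissible T) (hp : EigLine (A : H →L[ℂ] H) p g) (hce : c ≠ e)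
    (hu : (A : H →L[ℂ] H) u = (c : ℂ) • u) (hz : (A : H →L[ℂ] H) z = (e : ℂ) • z) (hu0 : u ≠ 0)
    (hz0 : z ≠ 0) (hpu : ⟪p.rep, u⟫_ℂ = 0) (hpz : ⟪p.rep, z⟫_ℂ = 0) :
    ∃ B : conjClass T, Linked p A B ∧ (B : H →L[ℂ] H) (u + z) = (c : ℂ) • (u + z) ∧
      ∀ v, ⟪u, v⟫_ℂ = 0 → ⟪z, v⟫_ℂ = 0 → (B : H →L[ℂ] H) v = (A : H →L[ℂ] H) v := by
  have hsA := hT.sa A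
  have huz : ⟪u, z⟫_ℂ = 0 := inner_eq_zero_of_eigenvalue_ne hsA hce hu hz
  have huz0 : u + z ≠ 0 := by
    intro h
    have h1 : ⟪u, u + z⟫_ℂ = 0 := by rw [h, inner_zero_right]
    rw [inner_add_right, huz, add_zero, inner_self_eq_zero] at h1
    exact hu0 h1
  set x := Projectivization.mk ℂ u hu0 with hx
  set y := Projectivization.mk ℂ (u + z) huz0 with hy
  have hxc : EigLine (A : H →L[ℂ] H) x c := (eigLine_mk hu0).2 hu
  have hze : EigLine (A : H →L[ℂ] H) (Projectivization.mk ℂ z hz0) e := (eigLine_mk hz0).2 hz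
  -- if `p` belongs to the eigenspace for `e`, it serves as the auxiliary line
  obtain ⟨t, ht, htz, hpt⟩ : ∃ t, EigLine (A : H →L[ℂ] H) t e ∧ ⟪t.rep, z⟫_ℂ = 0 ∧
      (p = t ∨ Perp t p) := by
    by_cases hg : g = e
    · subst hg; exact ⟨p, hp, hpz, Or.inl rfl⟩
    · obtain ⟨t, ht, h⟩ := exists_perp hT hze
      exact ⟨t, ht, (perp_mk_right hz0).1 h.symm, Or.inr ((hp.perp hsA hg ht).symm)⟩
  have htu : ⟪t.rep, u⟫_ℂ = 0 := ht.inner_eq_zero hT hce.symm hu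
  have hpx : Perp x p := perp_of_inner hu0 hpu
  have hpy : Perp y p := perp_of_inner huz0 (by rw [inner_add_right, hpu, hpz, add_zero])
  have hty : Perp t y := (perp_mk_right huz0).2 (by rw [inner_add_right, htu, htz, add_zero])
  obtain ⟨B, hB⟩ := exists_vertex hT hce hxc ht
  have hpB : p = x ∨ p = t ∨ (Perp x p ∧ Perp t p) := by grind
  obtain ⟨g', hpg⟩ := hB.exists_eigLine hT hp hpB
  have htB : EigLine (B : H →L[ℂ] H) t c := hB.eigLine_right hsA hxc
  have hyB : EigLine (B : H →L[ℂ] H) y e := by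
    rw [hy, eigLine_mk, map_add, (eigLine_mk hu0).1 (hB.eigLine_left hsA ht)]
    rw [hB.apply_of_inner (inner_rep_mk hu0 huz) htz, hz, smul_add]
  obtain ⟨C, hC⟩ := exists_vertex hT hce htB hyB
  refine ⟨C, (hB.linked hp hpB).trans (hC.linked hpg (by grind)), ?_, ?_⟩
  · exact (eigLine_mk huz0).1 (hC.eigLine_right (hT.sa B) htB)
  · intro v h1 h2
    have h3 : linePr x v = 0 := linePr_eq_zero (inner_rep_mk hu0 h1)
    have h4 : linePr y v = 0 := 
      linePr_eq_zero (inner_rep_mk huz0 (by rw [inner_add_left, h1, h2, add_zero]))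
    rw [(hC.eq htB hyB).2, (hB.eq hxc ht).2]
    simp only [add_apply, smul_apply, sub_apply, h3, h4]
    module

/-- A vector `w` with a nonzero component in the eigenspace for `c` can be moved into this
eigenspace, keeping all eigenvectors orthogonal to `w`. -/
theorem exists_linked_of_component (hT : Admissible T) (n : ℕ) (A : conjClass T)
    (hp : EigLine (A : H →L[ℂ] H) p g) (φ : ℝ →₀ H)
    (hφ : ∀ d, (A : H →L[ℂ] H) (φ d) = (d : ℂ) • φ d) (hw : φ.sum (fun _ x => x) = w)
    (hc : φ c ≠ 0) (hpw : ⟪p.rep, w⟫_ℂ = 0) (hn : φ.support.card = n + 1) :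
    ∃ B : conjClass T, Linked p A B ∧ (B : H →L[ℂ] H) w = (c : ℂ) • w ∧
      ∀ (d : ℝ) v, (A : H →L[ℂ] H) v = (d : ℂ) • v → ⟪v, w⟫_ℂ = 0 →
        (B : H →L[ℂ] H) v = (d : ℂ) • v := by
  classical
  induction n generalizing A φ g with
  | zero =>
    obtain ⟨e, he⟩ := Finset.card_eq_one.1 hn
    have hce : c = e := by
      have : c ∈ φ.support := Finsupp.mem_support_iff.2 hc
      rw [he] at this
      simpa using this
    subst hce
    have : w = φ c := by rw [← hw, Finsupp.sum, he, Finset.sum_singleton]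
    subst this
    exact ⟨A, Relation.ReflTransGen.refl, hφ c, fun _ _ h _ => h⟩
  | succ n ih =>
    have hsA := hT.sa A
    obtain ⟨e, he, hec⟩ := Finset.exists_mem_ne (by omega) c (s := φ.support)
    have he0 : φ e ≠ 0 := Finsupp.mem_support_iff.1 he
    -- an eigenvector orthogonal to `w` is orthogonal to all components of `w`
    have hcomp : ∀ {d : ℝ} {v : H}, (A : H →L[ℂ] H) v = (d : ℂ) • v → ⟪v, w⟫_ℂ = 0 →
        ∀ k, ⟪v, φ k⟫_ℂ = 0 := by
      intro d v hv h k
      by_cases hk : d = k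
      · subst hk; rwa [← inner_decomp hsA hφ hv, hw]
      · exact inner_eq_zero_of_eigenvalue_ne hsA hk hv (hφ k)
    obtain ⟨B, hAB, hB1, hB2⟩ := exists_linked_add hT hp hec.symm (hφ c) (hφ e) hc he0
      (hcomp hp hpw c) (hcomp hp hpw e)
    have hkeep : ∀ (d : ℝ) (v : H), (A : H →L[ℂ] H) v = (d : ℂ) • v → ⟪v, w⟫_ℂ = 0 →
        (B : H →L[ℂ] H) v = (d : ℂ) • v := by
      intro d v hv h
      rw [hB2 v (inner_eq_zero_symm.1 (hcomp hv h c)) (inner_eq_zero_symm.1 (hcomp hv h e)), hv]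
    have hne : φ c + φ e ≠ 0 := by
      intro h
      have h1 : ⟪φ c, φ c + φ e⟫_ℂ = 0 := by rw [h, inner_zero_right]
      rw [inner_add_right, inner_eq_zero_of_eigenvalue_ne hsA hec.symm (hφ c) (hφ e), add_zero,
        inner_self_eq_zero] at h1
      exact hc h1
    set χ : ℝ →₀ H := (φ.erase e).update c (φ c + φ e) with hχ
    have hχc : χ c = φ c + φ e := by simp [hχ]
    have hχe : χ e = 0 := by simp [hχ, hec]
    have hχk : ∀ k, k ≠ c → k ≠ e → χ k = φ k := fun k h1 h2 => by
      simp [hχ, Function.update, h1, h2, Finsupp.erase]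
    have hsupp : χ.support = φ.support.erase e := by
      ext k
      rw [Finset.mem_erase, Finsupp.mem_support_iff, Finsupp.mem_support_iff]
      by_cases h1 : k = c
      · subst h1; rw [hχc]; exact ⟨fun _ => ⟨hec.symm, hc⟩, fun _ => hne⟩
      by_cases h2 : k = e
      · subst h2; simp [hχe]
      · rw [hχk k h1 h2]; simp [h2]
    have hcs : c ∈ φ.support.erase e :=
      Finset.mem_erase.2 ⟨hec.symm, Finsupp.mem_support_iff.2 hc⟩
    have hχB : ∀ k, (B : H →L[ℂ] H) (χ k) = (k : ℂ) • χ k := by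
      intro k
      by_cases h1 : k = c
      · subst h1; rw [hχc]; exact hB1
      by_cases h2 : k = e
      · subst h2; rw [hχe, map_zero, smul_zero]
      · rw [hχk k h1 h2, hB2 _ (inner_eq_zero_of_eigenvalue_ne hsA (Ne.symm h1) (hφ c) (hφ k))
          (inner_eq_zero_of_eigenvalue_ne hsA (Ne.symm h2) (hφ e) (hφ k)), hφ k]
    have hχw : χ.sum (fun _ x => x) = w := by
      rw [← hw, Finsupp.sum, Finsupp.sum, hsupp, ← Finset.add_sum_erase _ _ hcs,
        ← Finset.add_sum_erase _ _ he,
        ← Finset.add_sum_erase _ _ hcs, hχc]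
      rw [← add_assoc, add_comm (φ c)]
      congr 1
      refine Finset.sum_congr rfl fun k hk => ?_
      simp only [Finset.mem_erase] at hk
      exact hχk k hk.1 hk.2.1
    obtain ⟨C, hBC, hC1, hC2⟩ := ih B (hkeep g _ hp hpw) χ hχB hχw (by rw [hχc]; exact hne)
      (by rw [hsupp, Finset.card_erase_of_mem he, hn]; omega)
    exact ⟨C, hAB.trans hBC, hC1, fun d v hv h => hC2 d v (hkeep d v hv h) h⟩

/-- Any vector `w` can be moved into the eigenspace for `c` at the cost of an eigenvector `u` for
`c`, keeping all eigenvectors orthogonal to `w` and `u`. -/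
theorem exists_linked_eigenvector (hT : Admissible T) (hp : EigLine (A : H →L[ℂ] H) p g)
    (hu : (A : H →L[ℂ] H) u = (c : ℂ) • u) (hu0 : u ≠ 0) (hpu : ⟪p.rep, u⟫_ℂ = 0) (hw0 : w ≠ 0)
    (hpw : ⟪p.rep, w⟫_ℂ = 0) :
    ∃ B : conjClass T, Linked p A B ∧ (B : H →L[ℂ] H) w = (c : ℂ) • w ∧
      ∀ (d : ℝ) v, (A : H →L[ℂ] H) v = (d : ℂ) • v → ⟪v, w⟫_ℂ = 0 → ⟪v, u⟫_ℂ = 0 →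
        (B : H →L[ℂ] H) v = (d : ℂ) • v := by
  have hsA := hT.sa A
  have main : ∀ {A : conjClass T} {g : ℝ} {φ : ℝ →₀ H}, EigLine (A : H →L[ℂ] H) p g →
      (∀ d, (A : H →L[ℂ] H) (φ d) = (d : ℂ) • φ d) → φ.sum (fun _ x => x) = w → φ c ≠ 0 →
      ∃ B : conjClass T, Linked p A B ∧ (B : H →L[ℂ] H) w = (c : ℂ) • w ∧
      ∀ (d : ℝ) v, (A : H →L[ℂ] H) v = (d : ℂ) • v → ⟪v, w⟫_ℂ = 0 →
        (B : H →L[ℂ] H) v = (d : ℂ) • v := by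
    intro A g φ hp hφ hw hc
    obtain ⟨n, hn⟩ := Nat.exists_eq_succ_of_ne_zero (n := φ.support.card)
      (Finset.card_ne_zero_of_mem (Finsupp.mem_support_iff.2 hc))
    exact exists_linked_of_component hT n A hp φ hφ hw hc hpw hn
  obtain ⟨φ, hφ, hw⟩ := exists_decomp hsA (hT.fr A) w
  -- if `w` has no component in the eigenspace for `c`, swap `u` with another component of `w`
  by_cases hc : φ c = 0
  · obtain ⟨e, he⟩ : ∃ e, φ e ≠ 0 := by
      by_contra! h
      exact hw0 (by rw [← hw, Finsupp.sum]; exact Finset.sum_eq_zero fun k _ => h k)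
    have hce : c ≠ e := by rintro rfl; exact he hc
    have hwe : ∀ {d : ℝ} {v : H}, (A : H →L[ℂ] H) v = (d : ℂ) • v → ⟪v, w⟫_ℂ = 0 →
        ⟪v, φ e⟫_ℂ = 0 := by
      intro d v hv h
      by_cases hk : d = e
      · subst hk; rwa [← inner_decomp hsA hφ hv, hw]
      · exact inner_eq_zero_of_eigenvalue_ne hsA hk hv (hφ e)
    have hx := (eigLine_mk hu0).2 hu
    have hy := (eigLine_mk he).2 (hφ e)
    obtain ⟨B, hB⟩ := exists_vertex hT hce hx hy
    have hpe := hwe hp hpw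
    have hkeep : ∀ (d : ℝ) (v : H), (A : H →L[ℂ] H) v = (d : ℂ) • v → ⟪v, w⟫_ℂ = 0 → ⟪v, u⟫_ℂ = 0 →
        (B : H →L[ℂ] H) v = (d : ℂ) • v := by
      intro d v hv h1 h2
      rw [hB.apply_of_inner, hv]
      · exact inner_rep_mk hu0 (inner_eq_zero_symm.1 h2)
      · exact inner_rep_mk he (inner_eq_zero_symm.1 (hwe hv h1))
    obtain ⟨χ, hχ, hwχ⟩ := exists_decomp (hT.sa B) (hT.fr B) w
    have hχc : χ c ≠ 0 := by
      intro h0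
      have h1 := inner_decomp (hT.sa B) hχ ((eigLine_mk he).1 (hB.eigLine_right hsA hx))
      rw [h0, inner_zero_right, hwχ, ← hw, inner_decomp hsA hφ (hφ e)] at h1
      exact he (inner_self_eq_zero.1 h1)
    obtain ⟨C, hBC, h1, h2⟩ := main (hkeep g _ hp hpw hpu) hχ hwχ hχc
    exact ⟨C, (hB.linked hp (Or.inr (Or.inr ⟨perp_of_inner hu0 hpu, perp_of_inner he hpe⟩))).trans
      hBC, h1, fun d v hv k1 k2 => h2 d v (hkeep d v hv k1 k2) k1⟩
  · obtain ⟨B, h1, h2, h3⟩ := main hp hφ hw hc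
    exact ⟨B, h1, h2, fun d v hv k1 _ => h3 d v hv k1⟩

end

section

variable {T : H →L[ℂ] H} {A B C D E : conjClass T} {p p' q q' r s x y : ℙ ℂ H}
  {c c' d e g : ℝ} {f : commGraph T ≃g commGraph T} {φ ψ : ℙ ℂ H → ℙ ℂ H}

theorem exists_mem_orthogonal_of_lt {K L : Submodule ℂ H} [K.HasOrthogonalProjection] (h : K < L) :
    ∃ y ∈ L, y ≠ 0 ∧ ∀ v ∈ K, ⟪v, y⟫_ℂ = 0 := by
  obtain ⟨z, hz, hzK⟩ := Set.exists_of_ssubset h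
  refine ⟨z - K.starProjection z, L.sub_mem hz (h.le (K.starProjection_apply_mem z)), ?_, ?_⟩
  · intro h0
    rw [sub_eq_zero] at h0
    exact hzK (h0 ▸ K.starProjection_apply_mem z)
  · exact fun v hv => K.sub_starProjection_mem_orthogonal z v hv

theorem finrank_eigSpace (A B : conjClass T) (c : ℝ) :
    Module.finrank ℂ (eigSpace (A : H →L[ℂ] H) c) =
      Module.finrank ℂ (eigSpace (B : H →L[ℂ] H) c) := by
  rw [Module.finrank, Module.finrank, rank_eigSpace_of_mem A.2, rank_eigSpace_of_mem B.2]

/-- Vertices with the eigenline `p` for the same eigenvalue are linked: while `A ≠ B`, some common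
part of two eigenspaces for the same nonzero eigenvalue can be enlarged without making another one
smaller. -/
theorem linked_of_same (hT : Admissible T) (hA : EigLine (A : H →L[ℂ] H) p g)
    (hB : EigLine (B : H →L[ℂ] H) p g) : Linked p A B := by
  set S := hT.finite.toFinset.erase 0 with hS
  have hmemS : ∀ {c}, c ∈ S ↔ c ≠ 0 ∧ eigSpace T c ≠ ⊥ := fun {c} => by simp [hS]
  set m : conjClass T → ℕ := fun A => ∑ c ∈ S, Module.finrank ℂ
    (eigSpace (A : H →L[ℂ] H) c ⊓ eigSpace (B : H →L[ℂ] H) c : Submodule ℂ H) with hm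
  set M := ∑ c ∈ S, Module.finrank ℂ (eigSpace (B : H →L[ℂ] H) c) with hM
  have hmM : ∀ A, m A ≤ M := by
    intro A
    refine Finset.sum_le_sum fun c hc => ?_
    have := finiteDimensional_eigSpace (hT.fr B) (hmemS.1 hc).1
    exact Submodule.finrank_mono inf_le_right
  induction hn : M - m A using Nat.strong_induction_on generalizing A with
  | _ n ih =>
    by_cases hall : ∀ c : ℝ, c ≠ 0 → eigSpace (B : H →L[ℂ] H) c ≤ eigSpace (A : H →L[ℂ] H) c
    · obtain rfl : A = B := by
        refine Subtype.ext (eq_of_eigSpace (hT.sa A) (hT.fr A) (hT.sa B) (hT.fr B) 0 ?_)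
        intro c hc v
        have := finiteDimensional_eigSpace (hT.fr A) hc
        rw [← mem_eigSpace, ← mem_eigSpace,
          Submodule.eq_of_le_of_finrank_eq (hall c hc) (finrank_eigSpace B A c)]
      exact Relation.ReflTransGen.refl
    push Not at hall
    obtain ⟨c, hc, hnle⟩ := hall
    have fA := finiteDimensional_eigSpace (hT.fr A) hc
    have fB := finiteDimensional_eigSpace (hT.fr B) hc
    set K := eigSpace (A : H →L[ℂ] H) c ⊓ eigSpace (B : H →L[ℂ] H) c with hK
    have fK : FiniteDimensional ℂ K := Submodule.finiteDimensional_of_le inf_le_left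
    have hKB : K < eigSpace (B : H →L[ℂ] H) c :=
      lt_of_le_of_ne inf_le_right fun h => hnle (inf_eq_right.1 h)
    have hKA : K < eigSpace (A : H →L[ℂ] H) c := by
      refine lt_of_le_of_ne inf_le_left fun h => ?_
      have h1 := Submodule.finrank_lt_finrank_of_lt hKB
      rw [h, finrank_eigSpace A B] at h1
      exact lt_irrefl _ h1
    obtain ⟨w, hw, hw0, hwK⟩ := exists_mem_orthogonal_of_lt hKB
    obtain ⟨u, hu, hu0, huK⟩ := exists_mem_orthogonal_of_lt hKA
    have horth : ∀ {d : ℝ} {v : H}, (A : H →L[ℂ] H) v = (d : ℂ) • v →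
        (B : H →L[ℂ] H) v = (d : ℂ) • v → ⟪v, w⟫_ℂ = 0 ∧ ⟪v, u⟫_ℂ = 0 := by
      intro d v h1 h2
      by_cases hdc : d = c
      · subst hdc
        have : v ∈ K := ⟨mem_eigSpace.2 h1, mem_eigSpace.2 h2⟩
        exact ⟨hwK v this, huK v this⟩
      · exact ⟨inner_eq_zero_of_eigenvalue_ne (hT.sa B) hdc h2 (mem_eigSpace.1 hw),
          inner_eq_zero_of_eigenvalue_ne (hT.sa A) hdc h1 (mem_eigSpace.1 hu)⟩
    obtain ⟨hpw, hpu⟩ := horth hA hB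
    obtain ⟨A', hAA', hA'w, hkeep⟩ :=
      exists_linked_eigenvector hT hA (mem_eigSpace.1 hu) hu0 hpu hw0 hpw
    have hle : ∀ d : ℝ, (eigSpace (A : H →L[ℂ] H) d ⊓ eigSpace (B : H →L[ℂ] H) d : Submodule ℂ H) ≤
        eigSpace (A' : H →L[ℂ] H) d ⊓ eigSpace (B : H →L[ℂ] H) d := by
      rintro d v ⟨h1, h2⟩
      have h3 := horth (mem_eigSpace.1 h1) (mem_eigSpace.1 h2)
      exact ⟨mem_eigSpace.2 (hkeep d v (mem_eigSpace.1 h1) h3.1 h3.2), h2⟩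
    have hlt : m A < m A' := by
      refine Finset.sum_lt_sum (fun d hd => ?_) ⟨c, hmemS.2 ⟨hc, ?_⟩, ?_⟩
      · have := finiteDimensional_eigSpace (hT.fr B) (hmemS.1 hd).1
        exact Submodule.finrank_mono (hle d)
      · intro h0
        have h1 := rank_eigSpace_of_mem B.2 c
        rw [h0, rank_bot] at h1
        have h2 := Submodule.rank_eq_zero.1 h1
        rw [h2] at hw
        exact hw0 (by simpa using hw)
      · refine Submodule.finrank_lt_finrank_of_lt (lt_of_le_of_ne (hle c) fun h => hw0 ?_)
        have h1 : w ∈ eigSpace (A' : H →L[ℂ] H) c ⊓ eigSpace (B : H →L[ℂ] H) c :=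
          ⟨mem_eigSpace.2 hA'w, hw⟩
        rw [← h] at h1
        exact inner_self_eq_zero.1 (hwK w h1)
    have := hmM A'
    exact hAA'.trans (ih (M - m A') (by omega) (hkeep g _ hA hpw hpu) rfl)

theorem linked_of_eigLine (hT : Admissible T) (hA : EigLine (A : H →L[ℂ] H) p c)
    (hB : EigLine (B : H →L[ℂ] H) p d) : Linked p A B := by
  by_cases hcd : c = d
  · subst hcd; exact linked_of_same hT hA hB
  obtain ⟨q, hq⟩ := hB.exists_in hT A
  obtain ⟨C, hC⟩ := exists_vertex hT hcd hA hq
  exact (hC.linked hA (Or.inl rfl)).trans (linked_of_same hT (hC.eigLine_left (hT.sa A) hq) hB)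

theorem exists_big (hT : Admissible T) : ∃ e, eigSpace T e ≠ ⊥ ∧ Big T e := by
  obtain ⟨c, d, hcd, hc, hd⟩ := hT.exists_ne
  by_cases h : Big T c
  · exact ⟨c, hc, h⟩
  · exact ⟨d, hd, by_contra fun h' => hcd (eq_of_not_big hT h h')⟩

theorem exists_eigLine_perp (hT : Admissible T) (A : conjClass T) (p q : ℙ ℂ H) :
    ∃ r c, EigLine (A : H →L[ℂ] H) r c ∧ Perp p r ∧ Perp q r := by
  obtain ⟨e, he, heT⟩ := exists_big hT
  obtain ⟨l, hl⟩ := exists_eigLine_of hT A he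
  obtain ⟨r, hr, h1, h2⟩ := heT.exists_perp hT hl p q
  exact ⟨r, e, hr, h1, h2⟩

theorem mem_conjClass_self (T : H →L[ℂ] H) : T ∈ conjClass T := ⟨1, one_mem _, by simp⟩

theorem exists_vertex_eigLine_of_perp (hT : Admissible T) (hp : EigLine (A : H →L[ℂ] H) p c)
    (hpq : Perp p q) : ∃ B : conjClass T, ∃ d, Linked p A B ∧ EigLine (B : H →L[ℂ] H) p c ∧
      EigLine (B : H →L[ℂ] H) q d := by
  obtain ⟨s, hs, hps⟩ := exists_perp hT hp
  obtain ⟨B, h1, h2, h3⟩ := exists_linked_eigenvector hT hp hs s.rep_nonzero hps q.rep_nonzero hpq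
  exact ⟨B, c, h1, h3 c _ hp hpq hps, h2⟩

theorem exists_vertex_eigLine (hT : Admissible T) (p : ℙ ℂ H) :
    ∃ A : conjClass T, ∃ c, EigLine (A : H →L[ℂ] H) p c := by
  obtain ⟨r, c, hr, h, -⟩ := exists_eigLine_perp hT ⟨T, mem_conjClass_self T⟩ p p
  obtain ⟨B, d, -, -, h2⟩ := exists_vertex_eigLine_of_perp hT hr h.symm
  exact ⟨B, d, h2⟩

/-! ### The global line map -/

/-- The line maps at all vertices are restrictions of one map. -/
theorem exists_forall_lineMap (f : commGraph T ≃g commGraph T) (hT : Admissible T) :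
    ∃ F : ℙ ℂ H → ℙ ℂ H, ∀ A, LineMap f A F := by
  choose φ hφ using exists_lineMap f hT
  choose V c hV using exists_vertex_eigLine hT (T := T)
  have key : ∀ {A : conjClass T} {p c}, EigLine (A : H →L[ℂ] H) p c → φ (V p) p = φ A p := fun hp =>
    LineMap.eq_of_linked hT (linked_of_eigLine hT (hV _) hp) (hV _) (hφ _) (hφ _)
  refine ⟨fun p => φ (V p) p, fun A => ⟨?_, ?_⟩⟩
  · intro p q B h
    obtain ⟨k, l, -, hp, hq, -⟩ := id h
    rw [key hp, key hq]
    exact (hφ A).map p q B h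
  · intro c
    obtain ⟨c', h⟩ := (hφ A).eig c
    refine ⟨c', fun p hp => ?_⟩
    rw [key hp]
    exact h p hp

theorem exists_vertex_eigLine₂ (hT : Admissible T) (hpq : Perp p q) :
    ∃ A : conjClass T, ∃ c d, EigLine (A : H →L[ℂ] H) p c ∧ EigLine (A : H →L[ℂ] H) q d := by
  obtain ⟨A, c, hA⟩ := exists_vertex_eigLine hT p
  obtain ⟨B, d, -, h1, h2⟩ := exists_vertex_eigLine_of_perp hT hA hpq
  exact ⟨B, c, d, h1, h2⟩

theorem surjective_of_lineMap (hT : Admissible T) {F : ℙ ℂ H → ℙ ℂ H} (hF : ∀ A, LineMap f A F) :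
    Function.Surjective F := by
  obtain ⟨G, hG⟩ := exists_forall_lineMap f.symm hT
  intro p
  obtain ⟨A, c, hp⟩ := exists_vertex_eigLine hT p
  have h1 : LineMap f.symm.symm (f.symm A) F := hF (f.symm A)
  exact ⟨G p, (hG A).symm_apply hT h1 hp⟩

theorem perp_iff_of_lineMap (hT : Admissible T) {F : ℙ ℂ H → ℙ ℂ H} (hF : ∀ A, LineMap f A F)
    (p q : ℙ ℂ H) : Perp (F p) (F q) ↔ Perp p q := by
  have main : ∀ {f : commGraph T ≃g commGraph T} {F : ℙ ℂ H → ℙ ℂ H} {p q}, (∀ A, LineMap f A F) →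
      Perp p q → Perp (F p) (F q) := by
    intro f F p q hF h
    obtain ⟨A, c, d, hp, hq⟩ := exists_vertex_eigLine₂ hT h
    exact (hF A).perp hT hp hq h
  obtain ⟨G, hG⟩ := exists_forall_lineMap f.symm hT
  have hGF : ∀ p, G (F p) = p := by
    intro p
    obtain ⟨A, c, hp⟩ := exists_vertex_eigLine hT p
    exact (hF A).symm_apply hT (hG _) hp
  refine ⟨fun h => ?_, main hF⟩
  have := main hG h
  rwa [hGF, hGF] at this

/-- The permutation of the eigenvalues induced by `f` is the same at all vertices. -/
theorem exists_eigenvalue_map (hT : Admissible T) {F : ℙ ℂ H → ℙ ℂ H} (hF : ∀ A, LineMap f A F) :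
    ∃ δ : ℝ → ℝ, ∀ (A : conjClass T) p c, EigLine (A : H →L[ℂ] H) p c →
      EigLine (f A : H →L[ℂ] H) (F p) (δ c) := by
  choose δ hδ using (hF ⟨T, mem_conjClass_self T⟩).eig
  let Q : conjClass T → Prop := fun A => ∀ p c, EigLine (A : H →L[ℂ] H) p c →
    EigLine (f A : H →L[ℂ] H) (F p) (δ c)
  have hstep : ∀ {A B : conjClass T} {x y}, Q A → Swap (A : H →L[ℂ] H) B x y → Q B := by
    intro A B x y hA h p c hp
    have hsA := hT.sa A
    obtain ⟨k, l, hkl, hx, hy, -⟩ := id h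
    have hxB := h.eigLine_left hsA hy
    have hyB := h.eigLine_right hsA hx
    -- an eigenline for `c` which is not affected by the swap
    obtain ⟨r, hr, hxr, hyr⟩ : ∃ r, EigLine (B : H →L[ℂ] H) r c ∧ Perp x r ∧ Perp y r := by
      by_cases hcl : l = c
      · subst hcl
        obtain ⟨r, hr, hxr⟩ := exists_perp hT hxB
        exact ⟨r, hr, hxr, hyB.perp (hT.sa B) hkl hr⟩
      by_cases hck : k = c
      · subst hck
        obtain ⟨r, hr, hxr⟩ := exists_perp hT hyB
        exact ⟨r, hr, hxB.perp (hT.sa B) hkl.symm hr, hxr⟩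
      · exact ⟨p, hp, hxB.perp (hT.sa B) hcl hp, hyB.perp (hT.sa B) hck hp⟩
    obtain ⟨c', hc'⟩ := (hF B).eig c
    have h1 := hA r c ((h.rev hsA).eigLine_of_perp hr hxr hyr)
    have h2 := ((hF A).map x y B h).eigLine_of_perp h1
      ((perp_iff_of_lineMap hT hF _ _).2 hxr) ((perp_iff_of_lineMap hT hF _ _).2 hyr)
    rw [← (hc' r hr).unique h2]
    exact hc' p hp
  have hlink : ∀ {p A B}, Linked p A B → Q A → Q B := by
    intro p A B h hA
    induction h with
    | refl => exact hA
    | tail _ h2 ih => obtain ⟨-, x, y, h, -⟩ := h2; exact hstep ih h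
  refine ⟨δ, fun A => ?_⟩
  obtain ⟨c, d, hcd, hc, hd⟩ := hT.exists_ne
  set A₀ : conjClass T := ⟨T, mem_conjClass_self T⟩
  obtain ⟨q, hq⟩ := exists_eigLine_of hT A hc
  obtain ⟨p, e, hp, hqp, -⟩ := exists_eigLine_perp hT A₀ q q
  obtain ⟨B, k, h1, -, h2⟩ := exists_vertex_eigLine_of_perp hT hp hqp.symm
  exact hlink (linked_of_eigLine hT h2 hq) (hlink h1 fun p c hp => hδ c p hp)

end

/-! ### Uhlhorn's theorem -/

/-- A field endomorphism of `ℂ` commuting with the conjugation preserves `ℝ`, which has no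
endomorphisms but the identity. -/
theorem eq_id_or_eq_conj (τ : ℂ →+* ℂ) (h : ∀ a, τ (starRingEnd ℂ a) = starRingEnd ℂ (τ a)) :
    τ = RingHom.id ℂ ∨ τ = starRingEnd ℂ := by
  have hre : ∀ r : ℝ, ((τ r).re : ℂ) = τ r := fun r => by
    rw [← Complex.conj_eq_iff_re, ← h, Complex.conj_ofReal]
  let ρ : ℝ →+* ℝ :=
    { toFun := fun r => (τ r).re
      map_one' := by simp
      map_zero' := by simp
      map_add' := fun a b => by simp
      map_mul' := fun a b => by
        have h1 := congrArg Complex.im (hre a)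
        have h2 : (τ a).im = 0 := by rw [← h1, Complex.ofReal_im]
        simp [h2] }
  have hτ : ∀ r : ℝ, τ r = r := fun r => by
    have h1 : ρ r = r := by rw [Subsingleton.elim ρ (RingHom.id ℝ)]; rfl
    rw [← hre]
    exact_mod_cast h1
  have hI : τ Complex.I = Complex.I ∨ τ Complex.I = -Complex.I := by
    rw [← sq_eq_sq_iff_eq_or_eq_neg, ← map_pow, Complex.I_sq, map_neg, map_one]
  rcases hI with hI | hI
  · left
    ext z
    conv_lhs => rw [← Complex.re_add_im z]
    rw [map_add, map_mul, hτ, hτ, hI, Complex.re_add_im, RingHom.id_apply]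
  · right
    ext z
    conv_lhs => rw [← Complex.re_add_im z]
    conv_rhs => rw [← Complex.re_add_im z]
    simp only [map_add, map_mul, hτ, hI, Complex.conj_ofReal, Complex.conj_I]

section

variable {K L : Type*} [NormedAddCommGroup K] [InnerProductSpace ℂ K] [NormedAddCommGroup L]
  [InnerProductSpace ℂ L]

theorem exists_inner_eq {x y : K} (hx : x ≠ 0) (hy : y ≠ 0) (hxy : ⟪x, y⟫_ℂ = 0) (a : ℂ) :
    ∃ z, ⟪x, z⟫_ℂ = a ∧ ⟪y, z⟫_ℂ = a := by
  have h1 : ⟪x, x⟫_ℂ ≠ 0 := inner_self_ne_zero.2 hx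
  have h2 : ⟪y, y⟫_ℂ ≠ 0 := inner_self_ne_zero.2 hy
  refine ⟨(a / ⟪x, x⟫_ℂ) • x + (a / ⟪y, y⟫_ℂ) • y, ?_, ?_⟩
  · rw [inner_add_right, inner_smul_right, inner_smul_right, hxy, mul_zero, add_zero,
      div_mul_cancel₀ _ h1]
  · rw [inner_add_right, inner_smul_right, inner_smul_right, inner_eq_zero_symm.1 hxy, mul_zero,
      zero_add, div_mul_cancel₀ _ h2]

variable {g : K → L}

/-- A map which preserves lines, orthogonality and the relation `⟪x, y⟫ = -1` transforms all inner
products by one function. -/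
theorem exists_inner_map (hm : ∀ x y, ⟪x, y⟫_ℂ = -1 → ⟪g x, g y⟫_ℂ = -1)
    (hperp : ∀ x y, ⟪x, y⟫_ℂ = 0 → ⟪g x, g y⟫_ℂ = 0)
    (hline : ∀ (a : ℂ) x, a ≠ 0 → ∃ b : ℂ, g (a • x) = b • g x)
    (hdim : ∀ x y : K, ∃ v, v ≠ 0 ∧ ⟪x, v⟫_ℂ = 0 ∧ ⟪y, v⟫_ℂ = 0) :
    ∃ τ : ℂ → ℂ, ∀ x y, ⟪g x, g y⟫_ℂ = τ ⟪x, y⟫_ℂ := by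
  -- by scaling, the image of `⟪x, y⟫` depends on `⟪x, y⟫` and either of the vectors only
  have h1 : ∀ {x x' y}, ⟪x, y⟫_ℂ = ⟪x', y⟫_ℂ → ⟪x, y⟫_ℂ ≠ 0 → ⟪g x, g y⟫_ℂ = ⟪g x', g y⟫_ℂ := by
    intro x x' y h h0
    have h0' := h ▸ h0
    obtain ⟨b, hb⟩ := hline (-1 / ⟪x, y⟫_ℂ) y (div_ne_zero (by norm_num) h0)
    have k1 := hm x ((-1 / ⟪x, y⟫_ℂ) • y) (by rw [inner_smul_right, div_mul_cancel₀ _ h0])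
    have k2 := hm x' ((-1 / ⟪x, y⟫_ℂ) • y) (by rw [inner_smul_right, h, div_mul_cancel₀ _ h0'])
    rw [hb, inner_smul_right] at k1 k2
    have hb0 : b ≠ 0 := by rintro rfl; simp at k1
    exact mul_left_cancel₀ hb0 (k1.trans k2.symm)
  have h2 : ∀ {x y y'}, ⟪x, y⟫_ℂ = ⟪x, y'⟫_ℂ → ⟪x, y⟫_ℂ ≠ 0 → ⟪g x, g y⟫_ℂ = ⟪g x, g y'⟫_ℂ := by
    intro x y y' h h0
    rw [← inner_conj_symm, ← inner_conj_symm (g x)]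
    congr 1
    apply h1
    · rw [← inner_conj_symm, h, inner_conj_symm]
    · rwa [Ne, inner_eq_zero_symm]
  have h3 : ∀ {x y x' y'}, ⟪x, x'⟫_ℂ = 0 → ⟪x, y⟫_ℂ = ⟪x', y'⟫_ℂ → ⟪x, y⟫_ℂ ≠ 0 →
      ⟪g x, g y⟫_ℂ = ⟪g x', g y'⟫_ℂ := by
    intro x y x' y' hxx h h0
    have hx : x ≠ 0 := by rintro rfl; simp at h0
    have hx' : x' ≠ 0 := by rintro rfl; simp at h; exact h0 h
    obtain ⟨z, hz, hz'⟩ := exists_inner_eq hx hx' hxx ⟪x, y⟫_ℂ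
    rw [h2 hz.symm h0, h1 (hz.trans hz'.symm) (by rwa [hz]), h2 (hz'.trans h) (by rwa [hz'])]
  have h4 : ∀ {x y x' y'}, ⟪x, y⟫_ℂ = ⟪x', y'⟫_ℂ → ⟪g x, g y⟫_ℂ = ⟪g x', g y'⟫_ℂ := by
    intro x y x' y' h
    by_cases h0 : ⟪x, y⟫_ℂ = 0
    · rw [hperp _ _ h0, hperp _ _ (h ▸ h0)]
    obtain ⟨v, hv, hxv, hxv'⟩ := hdim x x'
    have k1 : ⟪v, (⟪x, y⟫_ℂ / ⟪v, v⟫_ℂ) • v⟫_ℂ = ⟪x, y⟫_ℂ := by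
      rw [inner_smul_right, div_mul_cancel₀ _ (inner_self_ne_zero.2 hv)]
    rw [h3 hxv k1.symm h0, h3 (inner_eq_zero_symm.1 hxv') (k1.trans h) (by rwa [k1])]
  obtain ⟨u, hu, -, -⟩ := hdim 0 0
  refine ⟨fun a => ⟪g u, g ((a / ⟪u, u⟫_ℂ) • u)⟫_ℂ, fun x y => h4 ?_⟩
  rw [inner_smul_right, div_mul_cancel₀ _ (inner_self_ne_zero.2 hu)]

/-- A surjective map between inner product spaces which preserves lines, orthogonality and the
relation `⟪x, y⟫ = -1` is a linear or conjugate-linear isometry. -/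
theorem exists_semilinear_isometry (hg : Function.Surjective g)
    (hm : ∀ x y, ⟪x, y⟫_ℂ = -1 ↔ ⟪g x, g y⟫_ℂ = -1)
    (hperp : ∀ x y, ⟪x, y⟫_ℂ = 0 ↔ ⟪g x, g y⟫_ℂ = 0)
    (hline : ∀ (a : ℂ) x, a ≠ 0 → ∃ b : ℂ, g (a • x) = b • g x)
    (hdim : ∀ x y : K, ∃ v, v ≠ 0 ∧ ⟪x, v⟫_ℂ = 0 ∧ ⟪y, v⟫_ℂ = 0) :
    ∃ τ : ℂ →+* ℂ, (τ = RingHom.id ℂ ∨ τ = starRingEnd ℂ) ∧ (∀ x y, g (x + y) = g x + g y) ∧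
      (∀ a x, g (a • x) = τ a • g x) ∧ ∀ x y, ⟪g x, g y⟫_ℂ = τ ⟪x, y⟫_ℂ := by
  obtain ⟨τ, hτ⟩ := exists_inner_map (fun x y => (hm x y).1) (fun x y => (hperp x y).1) hline hdim
  have g0 : g 0 = 0 := inner_self_eq_zero.1 ((hperp 0 0).1 (inner_self_eq_zero.2 rfl))
  obtain ⟨u', hu', -, -⟩ := hdim 0 0
  obtain ⟨u, hu⟩ : ∃ u : K, ⟪u, u⟫_ℂ = 1 := by
    refine ⟨((‖u'‖ : ℂ))⁻¹ • u', ?_⟩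
    have : (‖u'‖ : ℂ) ≠ 0 := by simpa using hu'
    rw [inner_smul_left, inner_smul_right, inner_self_eq_norm_sq_to_K]
    simp
    field_simp
  have hu0 : u ≠ 0 := by rintro rfl; simp at hu
  have hval : ∀ a : ℂ, ⟪u, a • u⟫_ℂ = a := fun a => by rw [inner_smul_right, hu, mul_one]
  have hτm : ∀ a, τ a = -1 ↔ a = -1 := fun a => by rw [← hval a, ← hτ, hm]
  have hτz : ∀ a, τ a = 0 ↔ a = 0 := fun a => by rw [← hval a, ← hτ, hperp]
  have hconj : ∀ a, τ (starRingEnd ℂ a) = starRingEnd ℂ (τ a) := fun a => by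
    rw [← hval a, inner_conj_symm, ← hτ, ← hτ, inner_conj_symm]
  have hs : ∀ (a : ℂ) x, ∃ b : ℂ, g (a • x) = b • g x := by
    intro a x
    by_cases ha : a = 0
    · exact ⟨0, by rw [ha, zero_smul, zero_smul, g0]⟩
    · exact hline a x ha
  have hmul' : ∀ a b, τ (a * b) * τ 1 = τ a * τ b := by
    intro a b
    obtain ⟨k, hk⟩ := hs a u
    have e1 : τ (a * b) = k * τ b := by
      have : ⟪(starRingEnd ℂ b) • u, a • u⟫_ℂ = a * b := by
        rw [inner_smul_left, hval]; simp [mul_comm]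
      rw [← this, ← hτ, hk, inner_smul_right, hτ, inner_smul_left, hu]
      simp
    have e2 : τ a = k * τ 1 := by
      rw [← hval a, ← hτ, hk, inner_smul_right, hτ, hu]
    rw [e1, e2]; ring
  have hτ1 : τ 1 = 1 := by
    have h1 : τ 1 * τ 1 = 1 := by
      have := hmul' (-1) (-1)
      rw [(hτm _).2 rfl] at this
      simpa using this
    rcases mul_self_eq_one_iff.1 h1 with h2 | h2
    · exact h2
    · exact absurd ((hτm 1).1 h2) (by norm_num)
  have hmul : ∀ a b, τ (a * b) = τ a * τ b := fun a b => by rw [← hmul', hτ1, mul_one]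
  have hone : ∀ a, τ a = 1 → a = 1 := by
    intro a ha
    have h1 : τ (-1 * a) = -1 := by rw [hmul, ha, (hτm _).2 rfl, mul_one]
    have h2 := (hτm _).1 h1
    linear_combination -h2
  have hext : ∀ {y z : L}, (∀ x, ⟪y, g x⟫_ℂ = ⟪z, g x⟫_ℂ) → y = z := by
    intro y z h
    refine ext_inner_right ℂ fun w => ?_
    obtain ⟨x, rfl⟩ := hg w
    exact h x
  have hsmul : ∀ (a : ℂ) x, g (a • x) = τ a • g x := by
    intro a x
    refine hext fun z => ?_
    rw [hτ, inner_smul_left, inner_smul_left, hmul, hconj, hτ]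
  have hadd_perp : ∀ {x y}, ⟪x, y⟫_ℂ = 0 → x ≠ 0 → y ≠ 0 → g (x + y) = g x + g y := by
    intro x y hxy hx hy
    obtain ⟨w, hw⟩ := hg (g x + g y)
    have hyx := inner_eq_zero_symm.1 hxy
    have hxx : ⟪x, x⟫_ℂ ≠ 0 := inner_self_ne_zero.2 hx
    have hyy : ⟪y, y⟫_ℂ ≠ 0 := inner_self_ne_zero.2 hy
    have hz : ∀ z, τ ⟪w, z⟫_ℂ = τ ⟪x, z⟫_ℂ + τ ⟪y, z⟫_ℂ := fun z => by
      rw [← hτ, ← hτ, ← hτ, hw, inner_add_left]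
    have τ0 : τ 0 = 0 := (hτz 0).2 rfl
    have hcan : ∀ a b, b ≠ 0 → τ a = τ b → a = b := by
      intro a b hb hab
      have h1 : τ (a * b⁻¹) = 1 := by rw [hmul, hab, ← hmul, mul_inv_cancel₀ hb, hτ1]
      have h2 := hone _ h1
      field_simp at h2
      exact h2
    have hwx : ⟪w, x⟫_ℂ = ⟪x, x⟫_ℂ := hcan _ _ hxx (by rw [hz, hyx, τ0, add_zero])
    have hwy : ⟪w, y⟫_ℂ = ⟪y, y⟫_ℂ := hcan _ _ hyy (by rw [hz, hxy, τ0, zero_add])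
    have hd : w - (x + y) = 0 := by
      set d := w - (x + y) with hd
      have k1 : ⟪x, d⟫_ℂ = 0 := inner_eq_zero_symm.1 (by
        rw [hd, inner_sub_left, inner_add_left, hwx, hyx]; ring)
      have k2 : ⟪y, d⟫_ℂ = 0 := inner_eq_zero_symm.1 (by
        rw [hd, inner_sub_left, inner_add_left, hwy, hxy]; ring)
      have k3 : ⟪w, d⟫_ℂ = 0 := (hτz _).1 (by rw [hz, k1, k2, τ0, add_zero])
      rw [← inner_self_eq_zero (𝕜 := ℂ)]
      nth_rewrite 1 [hd]
      rw [inner_sub_left, inner_add_left, k1, k2, k3]; ring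
    rw [← hw, sub_eq_zero.1 hd]
  obtain ⟨v, hv0, huv, -⟩ := hdim u u
  have hvv : ⟪v, v⟫_ℂ ≠ 0 := inner_self_ne_zero.2 hv0
  have hadd : ∀ a b, τ (a + b) = τ a + τ b := by
    intro a b
    by_cases ha : a = 0
    · rw [ha, (hτz 0).2 rfl, zero_add, zero_add]
    by_cases hb : b = 0
    · rw [hb, (hτz 0).2 rfl, add_zero, add_zero]
    have hb' : b / ⟪v, v⟫_ℂ ≠ 0 := div_ne_zero hb hvv
    have e3 : ⟪v, a • u⟫_ℂ = 0 := by rw [inner_smul_right, inner_eq_zero_symm.1 huv, mul_zero]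
    have e4 : ⟪u, (b / ⟪v, v⟫_ℂ) • v⟫_ℂ = 0 := by rw [inner_smul_right, huv, mul_zero]
    have e5 : ⟪v, (b / ⟪v, v⟫_ℂ) • v⟫_ℂ = b := by rw [inner_smul_right, div_mul_cancel₀ b hvv]
    have e1 : ⟪u + v, a • u + (b / ⟪v, v⟫_ℂ) • v⟫_ℂ = a + b := by
      rw [inner_add_left, inner_add_right, inner_add_right, hval, e3, e4, e5, add_zero, zero_add]
    have e2 : g (a • u + (b / ⟪v, v⟫_ℂ) • v) = g (a • u) + g ((b / ⟪v, v⟫_ℂ) • v) :=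
      hadd_perp (by rw [inner_smul_left, inner_smul_right, huv]; simp) (smul_ne_zero ha hu0)
        (smul_ne_zero hb' hv0)
    rw [← e1, ← hτ, e2, hadd_perp huv hu0 hv0, inner_add_left, inner_add_right, inner_add_right,
      hτ, hτ, hτ, hτ, hval, e3, e4, e5, (hτz 0).2 rfl, add_zero, zero_add]
  refine ⟨⟨⟨⟨τ, hτ1⟩, hmul⟩, (hτz 0).2 rfl, hadd⟩, eq_id_or_eq_conj _ hconj, ?_, hsmul, hτ⟩
  intro x y
  refine hext fun z => ?_
  rw [inner_add_left, hτ, hτ, hτ, inner_add_left, hadd]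

end

/-- Within the orthogonal complement of `f`, a vector orthogonal to all vectors orthogonal to `x` is
a multiple of `x`. -/
theorem exists_smul_of_inner {f x y : H} (hx : ⟪f, x⟫_ℂ = 0) (hy : ⟪f, y⟫_ℂ = 0)
    (h : ∀ z, z ≠ 0 → ⟪f, z⟫_ℂ = 0 → ⟪x, z⟫_ℂ = 0 → ⟪z, y⟫_ℂ = 0) : ∃ a : ℂ, y = a • x := by
  by_cases hx0 : x = 0
  · refine ⟨0, ?_⟩
    by_contra hy0
    rw [zero_smul] at hy0
    exact hy0 (inner_self_eq_zero.1 (h y hy0 hy (by rw [hx0, inner_zero_left])))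
  have hxx : ⟪x, x⟫_ℂ ≠ 0 := inner_self_ne_zero.2 hx0
  refine ⟨⟪x, y⟫_ℂ / ⟪x, x⟫_ℂ, ?_⟩
  by_contra hne
  set z := y - (⟪x, y⟫_ℂ / ⟪x, x⟫_ℂ) • x with hz
  have h1 : ⟪x, z⟫_ℂ = 0 := by
    rw [hz, inner_sub_right, inner_smul_right, div_mul_cancel₀ _ hxx, sub_self]
  have h2 := h z (sub_ne_zero.2 hne)
    (by rw [hz, inner_sub_right, inner_smul_right, hx, hy, mul_zero, sub_zero]) h1
  apply sub_ne_zero.2 hne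
  rw [← inner_self_eq_zero (𝕜 := ℂ)]
  change ⟪z, z⟫_ℂ = 0
  nth_rewrite 2 [hz]
  rw [inner_sub_right, h2, inner_smul_right, inner_eq_zero_symm.1 h1, mul_zero, sub_zero]

/-- Uhlhorn's theorem in dimension at least four: a surjective transformation of the lines of `H`
which preserves orthogonality in both directions is induced by a unitary or anti-unitary operator.
The lines not orthogonal to a unit vector `e` are parametrized by the orthogonal complement of `e`,
via `x ↦ [e + x]`; in this chart orthogonality is the relation `⟪x, y⟫ = -1`. -/
theorem exists_of_perp_iff (hdim : ∀ x y z : H, ∃ v, v ≠ 0 ∧ ⟪x, v⟫_ℂ = 0 ∧ ⟪y, v⟫_ℂ = 0 ∧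
    ⟪z, v⟫_ℂ = 0) {F : ℙ ℂ H → ℙ ℂ H} (hF : Function.Surjective F)
    (hperp : ∀ p q, Perp (F p) (F q) ↔ Perp p q) :
    ∃ (τ : ℂ →+* ℂ) (U : H → H), (τ = RingHom.id ℂ ∨ τ = starRingEnd ℂ) ∧
      (∀ x y, U (x + y) = U x + U y) ∧ (∀ a x, U (a • x) = τ a • U x) ∧
      (∀ x y, ⟪U x, U y⟫_ℂ = τ ⟪x, y⟫_ℂ) ∧ Function.Surjective U ∧
      ∀ x (hx : x ≠ 0), ∃ hUx : U x ≠ 0,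
        F (Projectivization.mk ℂ x hx) = Projectivization.mk ℂ (U x) hUx := by
  have hunit : ∀ x : H, x ≠ 0 → ∃ y : H, ⟪y, y⟫_ℂ = 1 ∧ ∃ a : ℂ, y = a • x := by
    intro x hx
    refine ⟨((‖x‖ : ℂ))⁻¹ • x, ?_, _, rfl⟩
    have : (‖x‖ : ℂ) ≠ 0 := by simpa using hx
    rw [inner_smul_left, inner_smul_right, inner_self_eq_norm_sq_to_K]
    simp
    field_simp
  obtain ⟨e', he', -⟩ := hdim 0 0 0
  obtain ⟨e, he, -⟩ := hunit e' he'
  have he0 : e ≠ 0 := by rintro rfl; simp at he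
  obtain ⟨f, hf, b, hfb⟩ := hunit _ (F (Projectivization.mk ℂ e he0)).rep_nonzero
  have hf0 : f ≠ 0 := by rintro rfl; simp at hf
  have hFe : F (Projectivization.mk ℂ e he0) = Projectivization.mk ℂ f hf0 := by
    rw [← Projectivization.mk_rep (F _), eq_comm, Projectivization.mk_eq_mk_iff']
    exact ⟨b, hfb.symm⟩
  have hperp' : ∀ {x y x' y' : H} (hx : x ≠ 0) (hy : y ≠ 0) (hx' : x' ≠ 0) (hy' : y' ≠ 0),
      F (Projectivization.mk ℂ x hx) = Projectivization.mk ℂ x' hx' →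
      F (Projectivization.mk ℂ y hy) = Projectivization.mk ℂ y' hy' →
      (⟪x', y'⟫_ℂ = 0 ↔ ⟪x, y⟫_ℂ = 0) := by
    intro x y x' y' hx hy hx' hy' h1 h2
    rw [← perp_mk_mk hx' hy', ← perp_mk_mk hx hy, ← h1, ← h2, hperp]
  -- surjectivity of `F` in terms of vectors
  have hlift : ∀ z : H, z ≠ 0 → ∃ (w : H) (hw : w ≠ 0) (hz : z ≠ 0),
      F (Projectivization.mk ℂ w hw) = Projectivization.mk ℂ z hz := by
    intro z hz
    obtain ⟨p, hp⟩ := hF (Projectivization.mk ℂ z hz)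
    exact ⟨p.rep, p.rep_nonzero, hz, by rw [p.mk_rep, hp]⟩
  have hne : ∀ {u x : H}, ⟪u, u⟫_ℂ = 1 → ⟪u, x⟫_ℂ = 0 → ∀ a : ℂ, a ≠ 0 → a • u + x ≠ 0 := by
    intro u x hu hx a ha h
    have : ⟪u, a • u + x⟫_ℂ = 0 := by rw [h, inner_zero_right]
    rw [inner_add_right, inner_smul_right, hu, hx, mul_one, add_zero] at this
    exact ha this
  have hne1 : ∀ {u x : H}, ⟪u, u⟫_ℂ = 1 → ⟪u, x⟫_ℂ = 0 → u + x ≠ 0 := by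
    intro u x hu hx
    have := hne hu hx 1 one_ne_zero
    rwa [one_smul] at this
  have hin : ∀ {u x y : H}, ⟪u, u⟫_ℂ = 1 → ⟪u, x⟫_ℂ = 0 → ⟪u, y⟫_ℂ = 0 →
      ⟪u + x, u + y⟫_ℂ = 1 + ⟪x, y⟫_ℂ := by
    intro u x y hu hx hy
    rw [inner_add_left, inner_add_right, inner_add_right, hu, hy, inner_eq_zero_symm.1 hx]
    ring
  set K := (ℂ ∙ e)ᗮ with hK
  set L := (ℂ ∙ f)ᗮ with hL
  have memK : ∀ {x}, x ∈ K ↔ ⟪e, x⟫_ℂ = 0 := Submodule.mem_orthogonal_singleton_iff_inner_right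
  have memL : ∀ {x}, x ∈ L ↔ ⟪f, x⟫_ℂ = 0 := Submodule.mem_orthogonal_singleton_iff_inner_right
  have Ke : ∀ x : K, ⟪e, (x : H)⟫_ℂ = 0 := fun x => memK.1 x.2
  have Lf : ∀ x : L, ⟪f, (x : H)⟫_ℂ = 0 := fun x => memL.1 x.2
  -- the map in the charts given by `e` and `f`
  have hchart : ∀ x : K, ∃ y : L, F (Projectivization.mk ℂ (e + x) (hne1 he (Ke x))) =
      Projectivization.mk ℂ (f + y) (hne1 hf (Lf y)) := by
    intro x
    set r := (F (Projectivization.mk ℂ (e + x) (hne1 he (Ke x)))).rep with hr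
    have hr0 : r ≠ 0 := Projectivization.rep_nonzero _
    have hFr : F (Projectivization.mk ℂ (e + x) (hne1 he (Ke x))) = Projectivization.mk ℂ r hr0 :=
      (Projectivization.mk_rep _).symm
    have hfr : ⟪f, r⟫_ℂ ≠ 0 := by
      rw [Ne, hperp' he0 (hne1 he (Ke x)) hf0 hr0 hFe hFr, inner_add_right, he, Ke]
      simp
    refine ⟨⟨(⟪f, r⟫_ℂ)⁻¹ • r - f, memL.2 ?_⟩, ?_⟩
    · rw [inner_sub_right, inner_smul_right, inv_mul_cancel₀ hfr, hf, sub_self]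
    · rw [hFr, Projectivization.mk_eq_mk_iff']
      refine ⟨⟪f, r⟫_ℂ, ?_⟩
      rw [add_sub_cancel, smul_smul, mul_inv_cancel₀ hfr, one_smul]
  choose g hg using hchart
  have hgm : ∀ x y : K, ⟪x, y⟫_ℂ = -1 ↔ ⟪g x, g y⟫_ℂ = -1 := by
    intro x y
    have h := hperp' _ _ _ _ (hg x) (hg y)
    rw [hin he (Ke x) (Ke y), hin hf (Lf _) (Lf _)] at h
    rw [Submodule.coe_inner, Submodule.coe_inner, eq_neg_iff_add_eq_zero, eq_neg_iff_add_eq_zero,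
      add_comm, ← h, add_comm]
  -- the line of `x` is the line orthogonal to `e` in the plane of `e` and `e + x`
  have hgF : ∀ (x : K) (hx : (x : H) ≠ 0), ∃ hgx : (g x : H) ≠ 0,
      F (Projectivization.mk ℂ (x : H) hx) = Projectivization.mk ℂ (g x : H) hgx := by
    intro x hx
    set r := (F (Projectivization.mk ℂ (x : H) hx)).rep with hr
    have hr0 : r ≠ 0 := Projectivization.rep_nonzero _
    have hFr : F (Projectivization.mk ℂ (x : H) hx) = Projectivization.mk ℂ r hr0 :=
      (Projectivization.mk_rep _).symm
    obtain ⟨a, ha⟩ := exists_smul_of_inner (Lf (g x)) ((hperp' he0 hx hf0 hr0 hFe hFr).2 (Ke x)) (by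
      intro z hz hfz hgz
      obtain ⟨w, hw, hz, hFw⟩ := hlift z hz
      rw [hperp' hw hx hz hr0 hFw hFr]
      have h1 := (hperp' he0 hw hf0 hz hFe hFw).1 hfz
      have h2 := (hperp' _ hw _ hz (hg x) hFw).1 (by rw [inner_add_left, hfz, hgz, add_zero])
      rw [inner_add_left, h1, zero_add] at h2
      exact inner_eq_zero_symm.1 h2)
    have hgx : (g x : H) ≠ 0 := by
      intro h0
      rw [h0, smul_zero] at ha
      exact hr0 ha
    refine ⟨hgx, ?_⟩
    rw [hFr, Projectivization.mk_eq_mk_iff']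
    exact ⟨a, ha.symm⟩
  have hg0 : g 0 = 0 := by
    have h1 := hg 0
    have h2 : Projectivization.mk ℂ (e + (0 : K)) (hne1 he (Ke 0)) =
        Projectivization.mk ℂ e he0 := by
      congr 1; simp
    rw [h2, hFe, Projectivization.mk_eq_mk_iff'] at h1
    obtain ⟨a, ha⟩ := h1
    have h3 := congrArg (fun v => ⟪f, v⟫_ℂ) ha
    simp only [inner_smul_right, inner_add_right, hf, Lf, add_zero, mul_one] at h3
    rw [h3, one_smul] at ha
    exact Subtype.ext (by simpa using ha)
  have hgp : ∀ x y : K, ⟪x, y⟫_ℂ = 0 ↔ ⟪g x, g y⟫_ℂ = 0 := by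
    intro x y
    by_cases hx : (x : H) = 0
    · obtain rfl : x = 0 := Subtype.ext hx
      simp [hg0]
    by_cases hy : (y : H) = 0
    · obtain rfl : y = 0 := Subtype.ext hy
      simp [hg0]
    obtain ⟨hx', h1⟩ := hgF x hx
    obtain ⟨hy', h2⟩ := hgF y hy
    exact (hperp' hx hy hx' hy' h1 h2).symm
  have hgl : ∀ (a : ℂ) (x : K), a ≠ 0 → ∃ b : ℂ, g (a • x) = b • g x := by
    intro a x ha
    by_cases hx : (x : H) = 0
    · obtain rfl : x = 0 := Subtype.ext hx
      exact ⟨0, by simp [hg0]⟩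
    obtain ⟨hx', h1⟩ := hgF x hx
    obtain ⟨hy', h2⟩ := hgF (a • x) (smul_ne_zero ha hx)
    have h3 : Projectivization.mk ℂ ((a • x : K) : H) (smul_ne_zero ha hx) =
        Projectivization.mk ℂ (x : H) hx := by
      rw [Projectivization.mk_eq_mk_iff']
      exact ⟨a, rfl⟩
    rw [h3, h1, eq_comm, Projectivization.mk_eq_mk_iff'] at h2
    obtain ⟨b, hb⟩ := h2
    exact ⟨b, Subtype.ext hb.symm⟩
  have hgs : Function.Surjective g := by
    intro y
    obtain ⟨w, hw, hz, hFw⟩ := hlift (f + y) (hne1 hf (Lf y))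
    have hew : ⟪e, w⟫_ℂ ≠ 0 := by
      rw [Ne, ← hperp' he0 hw hf0 hz hFe hFw, inner_add_right, hf, Lf]
      simp
    set x : K := ⟨(⟪e, w⟫_ℂ)⁻¹ • w - e, memK.2 (by
      rw [inner_sub_right, inner_smul_right, inv_mul_cancel₀ hew, he, sub_self])⟩ with hx
    have h1 : Projectivization.mk ℂ (e + x) (hne1 he (Ke x)) = Projectivization.mk ℂ w hw := by
      rw [Projectivization.mk_eq_mk_iff']
      exact ⟨(⟪e, w⟫_ℂ)⁻¹, by simp [hx]⟩
    have h2 := hg x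
    rw [h1, hFw, Projectivization.mk_eq_mk_iff'] at h2
    obtain ⟨a, ha⟩ := h2
    have h3 := congrArg (fun v => ⟪f, v⟫_ℂ) ha
    simp only [inner_smul_right, inner_add_right, hf, Lf, add_zero, mul_one] at h3
    rw [h3, one_smul] at ha
    exact ⟨x, Subtype.ext (add_left_cancel ha)⟩
  obtain ⟨τ, hτ, gadd, gsmul, ginner⟩ := exists_semilinear_isometry hgs hgm hgp hgl (by
    intro x y
    obtain ⟨v, hv, h1, h2, h3⟩ := hdim e x y
    exact ⟨⟨v, memK.2 h1⟩, fun h => hv (congrArg Subtype.val h), h2, h3⟩)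
  have hPmem : ∀ v : H, v - ⟪e, v⟫_ℂ • e ∈ K := fun v => memK.2 (by
    rw [inner_sub_right, inner_smul_right, he, mul_one, sub_self])
  set P : H → K := fun v => ⟨v - ⟪e, v⟫_ℂ • e, hPmem v⟩ with hP
  have hdec : ∀ v, v = ⟪e, v⟫_ℂ • e + P v := fun v => by simp [hP]
  have hPK : ∀ (a : ℂ) (x : K), ⟪e, a • e + x⟫_ℂ = a ∧ P (a • e + x) = x := by
    intro a x
    have h1 : ⟪e, a • e + x⟫_ℂ = a := by
      rw [inner_add_right, inner_smul_right, he, Ke, mul_one, add_zero]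
    exact ⟨h1, Subtype.ext (by simp only [hP, h1, add_sub_cancel_left])⟩
  have ginner' : ∀ x y : K, ⟪(g x : H), (g y : H)⟫_ℂ = τ ⟪(x : H), (y : H)⟫_ℂ := ginner
  refine ⟨τ, fun v => τ ⟪e, v⟫_ℂ • f + g (P v), hτ, ?_, ?_, ?_, ?_, ?_⟩
  · intro x y
    have h1 : P (x + y) = P x + P y := Subtype.ext (by
      simp only [hP, Submodule.coe_add, inner_add_right]; module)
    simp only [h1, gadd, inner_add_right, map_add, Submodule.coe_add]
    module
  · intro a x
    have h1 : P (a • x) = a • P x := Subtype.ext (by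
      simp only [hP, Submodule.coe_smul, inner_smul_right]; module)
    simp only [h1, gsmul, inner_smul_right, map_mul, Submodule.coe_smul]
    module
  · intro x y
    have hτc : ∀ a, τ (starRingEnd ℂ a) = starRingEnd ℂ (τ a) := by
      intro a
      rcases hτ with rfl | rfl <;> simp
    conv_rhs => rw [hdec x, hdec y]
    simp only [inner_add_left, inner_add_right, inner_smul_left, inner_smul_right, hf, he, Lf, Ke,
      inner_eq_zero_symm.1 (Lf _), inner_eq_zero_symm.1 (Ke _), ginner', map_add, map_mul, hτc,
      map_zero, map_one, mul_zero]
  · intro z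
    obtain ⟨x, hx⟩ := hgs ⟨z - ⟪f, z⟫_ℂ • f, memL.2 (by
      rw [inner_sub_right, inner_smul_right, hf, mul_one, sub_self])⟩
    obtain ⟨a, ha⟩ : ∃ a, τ a = ⟪f, z⟫_ℂ := by
      rcases hτ with rfl | rfl
      · exact ⟨_, rfl⟩
      · exact ⟨_, Complex.conj_conj _⟩
    refine ⟨a • e + x, ?_⟩
    simp only [hPK, hx, ha, add_sub_cancel]
  · intro v hv
    by_cases hev : ⟪e, v⟫_ℂ = 0
    · obtain ⟨h1, h2⟩ := hgF ⟨v, memK.2 hev⟩ hv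
      have h3 : P v = ⟨v, memK.2 hev⟩ := Subtype.ext (by simp [hP, hev])
      have h4 : τ ⟪e, v⟫_ℂ • f + (g (P v) : H) = g ⟨v, memK.2 hev⟩ := by
        have h5 : τ ⟪e, v⟫_ℂ = 0 := by rw [hev, map_zero]
        rw [h3, h5, zero_smul, zero_add]
      refine ⟨fun h => h1 (h4.symm.trans h), ?_⟩
      rw [h2]
      congr 1
      exact h4.symm
    · have hτ0 : τ ⟪e, v⟫_ℂ ≠ 0 := (map_ne_zero τ).2 hev
      refine ⟨hne hf (Lf _) _ hτ0, ?_⟩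
      have h1 : Projectivization.mk ℂ v hv = Projectivization.mk ℂ (e + ((⟪e, v⟫_ℂ)⁻¹ • P v : K))
          (hne1 he (Ke _)) := by
        rw [Projectivization.mk_eq_mk_iff']
        refine ⟨⟪e, v⟫_ℂ, ?_⟩
        rw [smul_add, Submodule.coe_smul, smul_smul, mul_inv_cancel₀ hev, one_smul, ← hdec]
      rw [h1, hg, eq_comm, Projectivization.mk_eq_mk_iff']
      refine ⟨τ ⟪e, v⟫_ℂ, ?_⟩
      rw [gsmul, smul_add, Submodule.coe_smul, smul_smul, map_inv₀, mul_inv_cancel₀ hτ0, one_smul]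

/-! ### The induced operator -/

theorem mem_spectrum_of_eigenvector {A : H →L[ℂ] H} {x : H} (hx : x ≠ 0) {c : ℂ} (h : A x = c • x) :
    c ∈ spectrum ℂ A := by
  rw [spectrum.mem_iff]
  rintro ⟨V, hV⟩
  apply hx
  have h1 : (V : H →L[ℂ] H) x = 0 := by
    rw [hV, sub_apply, h, Algebra.algebraMap_eq_smul_one, smul_apply, one_apply_eq_self, sub_self]
  calc x = ((V⁻¹ : (H →L[ℂ] H)ˣ) : H →L[ℂ] H) ((V : H →L[ℂ] H) x) := by
        rw [← mul_apply_eq_comp, V.inv_mul, one_apply_eq_self]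
    _ = 0 := by rw [h1, map_zero]

theorem starProjection_eigSpace_of_ne {A : H →L[ℂ] H} (hA : IsSelfAdjoint A) {c d : ℝ} (hcd : c ≠ d)
    {x : H} (hx : A x = (d : ℂ) • x) : (eigSpace A c).starProjection x = 0 := by
  rw [Submodule.starProjection_apply_eq_zero_iff, Submodule.mem_orthogonal]
  exact fun y hy => inner_eq_zero_of_eigenvalue_ne hA hcd (mem_eigSpace.1 hy) hx

/-- `δ(A)` multiplies the eigenspace of `A` for `a (δ i)` by `a i`. -/
theorem permute_apply_of_eigenvector {A : H →L[ℂ] H} (hA : IsSelfAdjoint A) {k : ℕ} {a : Fin k → ℝ}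
    (ha : Function.Injective a) (δ : Equiv.Perm (Fin k)) {i : Fin k} {x : H}
    (hx : A x = (a (δ i) : ℂ) • x) : permute a δ A x = (a i : ℂ) • x := by
  rw [permute, sum_apply, Finset.sum_eq_single i]
  · rw [smul_apply, Submodule.starProjection_eq_self_iff.2 (mem_eigSpace.2 hx)]
  · intro j _ hj
    rw [smul_apply, starProjection_eigSpace_of_ne hA (fun h => hj (δ.injective (ha h))) hx,
      smul_zero]
  · simp

section

variable {T : H →L[ℂ] H} {k : ℕ} {a : Fin k → ℝ} {n : Fin k → Cardinal}

theorem eigSpace_ne_bot_iff (hspec : spectrum ℂ T = Set.range (fun i => (a i : ℂ)))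
    (hn : ∀ i, Module.rank ℂ (eigSpace T (a i)) = n i) (hn_one : ∀ i, 1 < n i) {c : ℝ} :
    eigSpace T c ≠ ⊥ ↔ ∃ i, a i = c := by
  constructor
  · intro h
    obtain ⟨x, hx, hx0⟩ := Submodule.exists_mem_ne_zero_of_ne_bot h
    have h1 := mem_spectrum_of_eigenvector hx0 (mem_eigSpace.1 hx)
    rw [hspec] at h1
    obtain ⟨i, hi⟩ := h1
    exact ⟨i, Complex.ofReal_injective hi⟩
  · rintro ⟨i, rfl⟩ h
    have h1 := hn i
    rw [h, rank_bot] at h1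
    exact absurd (hn_one i) (by rw [← h1]; simp)

theorem admissible (hT : IsSelfAdjoint T) (hTfin : FiniteRank T) (hk : 2 ≤ k)
    (ha : Function.Injective a) (hspec : spectrum ℂ T = Set.range (fun i => (a i : ℂ)))
    (hn : ∀ i, Module.rank ℂ (eigSpace T (a i)) = n i) (hn_one : ∀ i, 1 < n i)
    (hn_two : ∀ i j, n i = 2 → n j = 2 → i = j) : Admissible T := by
  have hne := fun c => eigSpace_ne_bot_iff hspec hn hn_one (c := c)
  have h2 : ∀ {c}, Module.rank ℂ (eigSpace T c) = 2 → ∃ i, a i = c := by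
    intro c hc
    rw [← hne]
    intro h
    rw [h, rank_bot] at hc
    exact two_ne_zero hc.symm
  refine ⟨hT, hTfin, ?_, ?_, ?_, ?_⟩
  · intro c hc
    obtain ⟨i, rfl⟩ := (hne c).1 hc
    rw [hn]; exact hn_one i
  · intro c d hc hd
    obtain ⟨i, rfl⟩ := h2 hc
    obtain ⟨j, rfl⟩ := h2 hd
    rw [hn_two i j ((hn i).symm.trans hc) ((hn j).symm.trans hd)]
  · exact ⟨a ⟨0, by omega⟩, a ⟨1, by omega⟩, ha.ne (by simp), (hne _).2 ⟨_, rfl⟩,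
      (hne _).2 ⟨_, rfl⟩⟩
  · exact (Set.finite_range a).subset fun c hc => (hne c).1 hc

/-- A space with an admissible operator has dimension at least four: any given line lies outside
some eigenspace of dimension at least three of a conjugate operator, and is orthogonal to it. -/
theorem exists_inner_eq_zero₃ (hT : Admissible T) (x y z : H) :
    ∃ v : H, v ≠ 0 ∧ ⟪x, v⟫_ℂ = 0 ∧ ⟪y, v⟫_ℂ = 0 ∧ ⟪z, v⟫_ℂ = 0 := by
  have main : ∀ p q r : ℙ ℂ H, ∃ s, Perp p s ∧ Perp q s ∧ Perp r s := by
    intro p q r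
    obtain ⟨e, he, heT⟩ := exists_big hT
    -- a vertex for which `p` belongs to another eigenvalue than `e`
    obtain ⟨A, g, hge, hp⟩ : ∃ A : conjClass T, ∃ g, g ≠ e ∧ EigLine (A : H →L[ℂ] H) p g := by
      obtain ⟨A, g, hp⟩ := exists_vertex_eigLine hT p
      by_cases hge : g = e
      · obtain ⟨l, q, hl, hq⟩ := exists_eigLine_ne hT A g
        obtain ⟨B, hB⟩ := exists_vertex hT hl.symm hp hq
        exact ⟨B, l, hge ▸ hl, hB.eigLine_left (hT.sa A) hq⟩
      · exact ⟨A, g, hge, hp⟩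
    obtain ⟨l, hl⟩ := exists_eigLine_of hT A he
    obtain ⟨s, hs, h1, h2⟩ := heT.exists_perp hT hl q r
    exact ⟨s, hp.perp (hT.sa A) hge hs, h1, h2⟩
  obtain ⟨c, -, -, hc, -⟩ := hT.exists_ne
  obtain ⟨l, -⟩ := exists_eigLine_of hT ⟨T, mem_conjClass_self T⟩ hc
  have hline : ∀ x : H, ∃ p : ℙ ℂ H, ∃ a : ℂ, x = a • p.rep := by
    intro x
    by_cases hx : x = 0
    · exact ⟨l, 0, by rw [hx, zero_smul]⟩
    · obtain ⟨b, hb, h⟩ := exists_rep_mk x hx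
      exact ⟨_, b⁻¹, by rw [h, smul_smul, inv_mul_cancel₀ hb, one_smul]⟩
  obtain ⟨p, α, rfl⟩ := hline x
  obtain ⟨q, β, rfl⟩ := hline y
  obtain ⟨r, γ, rfl⟩ := hline z
  obtain ⟨s, h1, h2, h3⟩ := main p q r
  refine ⟨s.rep, s.rep_nonzero, ?_, ?_, ?_⟩ <;> rw [inner_smul_left]
  · rw [h1, mul_zero]
  · rw [h2, mul_zero]
  · rw [h3, mul_zero]

/-- The linear and the conjugate-linear case of the theorem in one statement. -/
theorem exists_semilinear_of_iso (hT : Admissible T) (ha : Function.Injective a)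
    (hne : ∀ c, eigSpace T c ≠ ⊥ ↔ ∃ i, a i = c)
    (hn : ∀ i, Module.rank ℂ (eigSpace T (a i)) = n i) (f : commGraph T ≃g commGraph T) :
    ∃ δ ∈ multPerm n, ∃ (τ : ℂ →+* ℂ) (U : H → H), (τ = RingHom.id ℂ ∨ τ = starRingEnd ℂ) ∧
      (∀ x y, U (x + y) = U x + U y) ∧ (∀ a x, U (a • x) = τ a • U x) ∧
      (∀ x y, ⟪U x, U y⟫_ℂ = τ ⟪x, y⟫_ℂ) ∧ Function.Surjective U ∧
      ∀ (A : conjClass T) x, (f A : H →L[ℂ] H) (U x) = U (permute a δ (A : H →L[ℂ] H) x) := by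
  obtain ⟨F, hF⟩ := exists_forall_lineMap f hT
  obtain ⟨δ, hδ⟩ := exists_eigenvalue_map hT hF
  obtain ⟨τ, U, hτ, Uadd, Usmul, Uinner, Usurj, hUF⟩ := exists_of_perp_iff
    (exists_inner_eq_zero₃ hT) (surjective_of_lineMap hT hF) (perp_iff_of_lineMap hT hF)
  set A₀ : conjClass T := ⟨T, mem_conjClass_self T⟩ with hA₀
  have hτr : ∀ r : ℝ, τ (r : ℂ) = r := by
    intro r
    rcases hτ with rfl | rfl
    · rfl
    · exact Complex.conj_ofReal r
  have U0 : U 0 = 0 := by simpa using Uadd 0 0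
  have hUeig : ∀ (A : conjClass T) (c : ℝ) x, (A : H →L[ℂ] H) x = (c : ℂ) • x →
      (f A : H →L[ℂ] H) (U x) = (δ c : ℂ) • U x := by
    intro A c x hx
    by_cases hx0 : x = 0
    · rw [hx0, U0, map_zero, smul_zero]
    obtain ⟨hUx, h⟩ := hUF x hx0
    have h1 := hδ A _ c ((eigLine_mk hx0).2 hx)
    rw [h] at h1
    exact (eigLine_mk hUx).1 h1
  have hex : ∀ i, ∃ p, EigLine (A₀ : H →L[ℂ] H) p (a i) := fun i =>
    exists_eigLine_of hT A₀ ((hne _).2 ⟨i, rfl⟩)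
  have hδa : ∀ i, ∃ j, a j = δ (a i) := by
    intro i
    obtain ⟨p, hp⟩ := hex i
    obtain ⟨q, hq⟩ := (hδ A₀ p _ hp).exists_in hT A₀
    exact (hne _).1 (eigSpace_ne_bot_of_eigLine hq)
  choose ε hε using hδa
  have εinj : Function.Injective ε := by
    intro i j hij
    by_contra hne
    obtain ⟨p, hp⟩ := hex i
    obtain ⟨q, hq⟩ := hex j
    obtain ⟨B, hB⟩ := exists_vertex hT (ha.ne hne) hp hq
    have h1 := (((hF A₀).map p q B hB).eq (hδ A₀ p _ hp) (hδ A₀ q _ hq)).1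
    rw [← hε, ← hε, hij] at h1
    exact h1 rfl
  -- `f A` acts on the image of the eigenspace for `a i` by `a (σ i)`, whereas `δ(A)` acts on it by
  -- `a (δ⁻¹ i)`, so that `δ` has to be the inverse of `σ`
  let σ : Equiv.Perm (Fin k) := Equiv.ofBijective ε (Finite.injective_iff_bijective.1 εinj)
  have hUiff : ∀ (i : Fin k) x, T x = (a i : ℂ) • x ↔
      (f A₀ : H →L[ℂ] H) (U x) = (a (ε i) : ℂ) • U x := by
    intro i x
    rw [hε]
    refine ⟨hUeig A₀ (a i) x, fun h => ?_⟩
    refine mem_eigSpace_of_inner hT.selfAdjoint hT.finiteRank fun d hd y hy => ?_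
    by_cases hy0 : y = 0
    · rw [hy0, inner_zero_left]
    obtain ⟨j, rfl⟩ := (hne d).1 (eigSpace_ne_bot_of_eigLine ((eigLine_mk hy0).2 hy))
    have h1 : ⟪U y, U x⟫_ℂ = 0 := by
      refine inner_eq_zero_of_eigenvalue_ne (hT.sa _) ?_ (hUeig A₀ (a j) y hy) h
      rw [← hε, ← hε]
      exact fun h => hd (congrArg a (εinj (ha h)))
    rw [Uinner] at h1
    exact (map_eq_zero τ).1 h1
  have hσ : σ ∈ multPerm n := by
    intro i
    rw [← hn, ← hn, ← rank_eigSpace_of_mem (f A₀).2 (a (σ i))]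
    have hUmem : ∀ x : eigSpace T (a i), U x ∈ eigSpace (f A₀ : H →L[ℂ] H) (a (σ i)) := fun x =>
      mem_eigSpace.2 ((hUiff i x).1 (mem_eigSpace.1 x.2))
    let V : eigSpace T (a i) →+ eigSpace (f A₀ : H →L[ℂ] H) (a (σ i)) :=
      AddMonoidHom.mk' (fun x => ⟨U x, hUmem x⟩) fun x y => Subtype.ext (Uadd x y)
    have hV : Function.Bijective V := by
      constructor
      · rw [injective_iff_map_eq_zero]
        intro x hx
        have h1 : U x = 0 := congrArg Subtype.val hx
        have h2 := Uinner x x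
        rw [h1, inner_zero_left, eq_comm, map_eq_zero, inner_self_eq_zero] at h2
        exact Subtype.ext h2
      · rintro ⟨y, hy⟩
        obtain ⟨x, rfl⟩ := Usurj y
        exact ⟨⟨x, mem_eigSpace.2 ((hUiff i x).2 (mem_eigSpace.1 hy))⟩, rfl⟩
    have hτb : Function.Bijective τ := by
      rcases hτ with rfl | rfl
      · exact Function.bijective_id
      · exact (starRingAut (R := ℂ)).bijective
    exact (rank_eq_of_equiv_equiv τ (AddEquiv.ofBijective V hV) hτb
      fun r m => Subtype.ext (Usmul r m)).symm
  refine ⟨σ⁻¹, inv_mem hσ, τ, U, hτ, Uadd, Usmul, Uinner, Usurj, fun A x => ?_⟩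
  have hterm : ∀ (c : ℝ) y, (A : H →L[ℂ] H) y = (c : ℂ) • y →
      (f A : H →L[ℂ] H) (U y) = U (permute a σ⁻¹ (A : H →L[ℂ] H) y) := by
    intro c y hy
    by_cases hy0 : y = 0
    · rw [hy0, map_zero, U0, map_zero]
    obtain ⟨q, hq⟩ := EigLine.exists_in hT ((eigLine_mk hy0).2 hy) A₀
    obtain ⟨i, rfl⟩ := (hne c).1 (eigSpace_ne_bot_of_eigLine hq)
    have h1 : σ⁻¹ (σ i) = i := σ.symm_apply_apply i
    rw [permute_apply_of_eigenvector (hT.sa A) ha σ⁻¹ (i := σ i) (by rw [h1, hy]), Usmul, hτr,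
      hUeig A _ y hy, ← hε]
    rfl
  let U' : H →+ H := AddMonoidHom.mk' U Uadd
  obtain ⟨φ, hφ, rfl⟩ := exists_decomp (hT.sa A) (hT.fr A) x
  have hU' : ∀ v, U v = U' v := fun v => rfl
  rw [Finsupp.sum, map_sum, hU', hU', map_sum, map_sum, map_sum]
  exact Finset.sum_congr rfl fun c _ => hterm c _ (hφ c)

end

end OrthoGrassmann

theorem theorem5 {H : Type*} [NormedAddCommGroup H] [InnerProductSpace ℂ H] [CompleteSpace H]
    (T : H →L[ℂ] H) (hT : IsSelfAdjoint T) (hTfin : OrthoGrassmann.FiniteRank T)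
    {k : ℕ} (hk : 2 ≤ k)
    (a : Fin k → ℝ) (ha : Function.Injective a)
    (hspec : spectrum ℂ T = Set.range (fun i => (a i : ℂ)))
    (n : Fin k → Cardinal)
    (hn : ∀ i, Module.rank ℂ (OrthoGrassmann.eigSpace T (a i)) = n i)
    (hn_one : ∀ i, 1 < n i)
    (hn_two : ∀ i j, n i = 2 → n j = 2 → i = j)
    (f : OrthoGrassmann.commGraph T ≃g OrthoGrassmann.commGraph T) :
    ∃ δ ∈ OrthoGrassmann.multPerm n,
      (∃ U ∈ unitary (H →L[ℂ] H), ∀ A : OrthoGrassmann.conjClass T,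
        (f A : H →L[ℂ] H) = U * OrthoGrassmann.permute a δ (A : H →L[ℂ] H) * star U) ∨
      (∃ U : H ≃ₛₗ[starRingEnd ℂ] H, OrthoGrassmann.IsAntiunitary U ∧
        ∀ (A : OrthoGrassmann.conjClass T) (x : H),
          (f A : H →L[ℂ] H) x
            = U (OrthoGrassmann.permute a δ (A : H →L[ℂ] H) (U.symm x))) := by
  obtain ⟨δ, hδ, τ, U, hτ, Uadd, Usmul, Uinner, Usurj, hU⟩ :=
    OrthoGrassmann.exists_semilinear_of_iso
      (OrthoGrassmann.admissible hT hTfin hk ha hspec hn hn_one hn_two) ha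
      (fun _ => OrthoGrassmann.eigSpace_ne_bot_iff hspec hn hn_one) hn f
  refine ⟨δ, hδ, ?_⟩
  rcases hτ with rfl | rfl
  · left
    let V : H →ₗᵢ[ℂ] H := LinearMap.isometryOfInner
      { toFun := U, map_add' := Uadd, map_smul' := Usmul } Uinner
    let W := (Unitary.linearIsometryEquiv (𝕜 := ℂ) (H := H)).symm
      (LinearIsometryEquiv.ofSurjective V Usurj)
    have hW : ∀ x, (W : H →L[ℂ] H) x = U x := fun _ => rfl
    refine ⟨W, W.2, fun A => ?_⟩
    have h1 : (f A : H →L[ℂ] H) * W = W * OrthoGrassmann.permute a δ (A : H →L[ℂ] H) := by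
      ext x
      simp only [mul_apply_eq_comp, hW, hU]
    rw [← h1, mul_assoc, (Unitary.mem_iff.1 W.2).2, mul_one]
  · right
    let V : H →ₛₗ[starRingEnd ℂ] H := { toFun := U, map_add' := Uadd, map_smul' := Usmul }
    have hV : Function.Bijective V := by
      refine ⟨?_, Usurj⟩
      rw [injective_iff_map_eq_zero]
      intro x hx
      have h1 : U x = 0 := hx
      have h2 := Uinner x x
      rw [h1, inner_zero_left, eq_comm, map_eq_zero, inner_self_eq_zero] at h2
      exact h2
    refine ⟨LinearEquiv.ofBijective V hV, Uinner, fun A x => ?_⟩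
    obtain ⟨y, rfl⟩ := (LinearEquiv.ofBijective V hV).surjective x
    rw [LinearEquiv.symm_apply_apply]
    exact hU A y
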